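/- **Theorem.** The theory $\mathbf{V\#L}$ proves that (MP) implies (PALT). Here $\mathbf{V\#L}$ is the theory of two-sorted bounded arithmetic (numbers, and strings, i.e. finite sets of numbers read as binary numbers) over the vocabulary $0,1,+,\cdot,|\ |;=_1,=_2,\le,\in$ whose axioms are 2-BASIC, comprehension $\exists X\,(|X|\le y\wedge\forall z<y\,(z\in X\leftrightarrow\varphi(z)))$ for $\Sigma^B_0$ formulas $\varphi$ not containing $X$, string multiplication $\forall X,Y\,\exists Z\,(Z=X\cdot Y)$, and matrix powering $\forall X\,\forall m\,\exists Y\,(Y=X^m)$ for square matrices $X$ of integers (binary integers coded by strings). A theory proves a formula if the formula is a logical consequence of its axioms. In $\mathbf{V\#L}$ the Pfaffian of a skew symmetric integer matrix $A\in\mathrm{Mat}(2n,2n)$ is defined by the following algorithm. Let $J$ be the block diagonal matrix with blocks $\begin{pmatrix}0&1\\-1&0\end{pmatrix}$. The coefficient vector of the empty matrix is $\bar p=(1)$. For $n\ge1$ write $$A=\begin{pmatrix}0&a_{12}&R\\-a_{12}&0&-{}^tS\\-{}^tR&S&M\end{pmatrix},\qquad M\in\mathrm{Mat}(2n-2,2n-2),$$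 let $P_A\in\mathrm{Mat}(n+1,n)$ be the lower triangular Toeplitz matrix with first column $1,\ a_{12},\ RJS,\ RJ(MJ)S,\ \dots,\ RJ(MJ)^{n-2}S$, and put $\bar p_A=P_A\,\bar p_M$. Then $\mathrm{pf}(A)$ is the last entry of $\bar p_A$. The determinant of an integer matrix $B\in\mathrm{Mat}(N,N)$ is defined by $$\det(B)=(-1)^{N(N-1)/2}\,\mathrm{pf}\begin{pmatrix}0&B\\-{}^tB&0\end{pmatrix}.$$ (MP) is the statement that $\mathrm{pf}({}^tBAB)=\mathrm{pf}(A)\det(B)$ for all $n$, all skew symmetric $A\in\mathrm{Mat}(2n,2n)$ and all $B\in\mathrm{Mat}(2n,2n)$. (PALT) is the statement that $\mathrm{pf}(A[i:j])=-\mathrm{pf}(A)$ for all $n$, all skew symmetric $A\in\mathrm{Mat}(2n,2n)$ and all $1\le i\ne j\le 2n$, where $A[i:j]$ arises from $A$ by simultaneously swapping rows $i,j$ and columns $i,j$. (This includes that both Pfaffians exist, i.e. that the algorithm can be carried out.) -/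

import Mathlib

universe u

namespace BoundedArith

/-! ## Two-sorted first-order logic over the vocabulary
`0, 1, +, ·, | |; =₁, =₂, ≤, ∈` of bounded arithmetic.

There is a sort of numbers and a sort of strings (finite sets of numbers, read as binary numbers).
Variables of both sorts are named by natural numbers; strings have no terms besides variables. -/

/-- Number terms; `len X` is the length `|X|` of the string variable named `X`. -/
inductive Term : Type
  | var (x : ℕ) : Term
  | zero : Term
  | one : Term
  | add (s t : Term) : Term
  | mul (s t : Term) : Term
  | len (X : ℕ) : Term

namespace Term

instance : Zero Term := ⟨zero⟩
instance : One Term := ⟨one⟩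
instance : Add Term := ⟨add⟩
instance : Mul Term := ⟨mul⟩

/-- The number variable `x` occurs in the term. -/
def HasNumVar (x : ℕ) : Term → Prop
  | var y => y = x
  | zero => False
  | one => False
  | add s t => s.HasNumVar x ∨ t.HasNumVar x
  | mul s t => s.HasNumVar x ∨ t.HasNumVar x
  | len _ => False

/-- The string variable `X` occurs in the term. -/
def HasStrVar (X : ℕ) : Term → Prop
  | var _ => False
  | zero => False
  | one => False
  | add s t => s.HasStrVar X ∨ t.HasStrVar X
  | mul s t => s.HasStrVar X ∨ t.HasStrVar X
  | len Y => Y = X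

end Term

/-- Two-sorted formulas. `mem t X` is `t ∈ X`, also written `X(t)`. -/
inductive Formula : Type
  | eqN (s t : Term) : Formula
  | le (s t : Term) : Formula
  | eqS (X Y : ℕ) : Formula
  | mem (t : Term) (X : ℕ) : Formula
  | not (φ : Formula) : Formula
  | and (φ ψ : Formula) : Formula
  | or (φ ψ : Formula) : Formula
  | imp (φ ψ : Formula) : Formula
  | allN (x : ℕ) (φ : Formula) : Formula
  | exN (x : ℕ) (φ : Formula) : Formula
  | allS (X : ℕ) (φ : Formula) : Formula
  | exS (X : ℕ) (φ : Formula) : Formula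

namespace Formula

/-- The string variable `X` occurs in the formula (free, bound or as a quantified name). -/
def HasStrVar (X : ℕ) : Formula → Prop
  | eqN s t => s.HasStrVar X ∨ t.HasStrVar X
  | le s t => s.HasStrVar X ∨ t.HasStrVar X
  | eqS Y Z => Y = X ∨ Z = X
  | mem t Y => t.HasStrVar X ∨ Y = X
  | not φ => φ.HasStrVar X
  | and φ ψ => φ.HasStrVar X ∨ ψ.HasStrVar X
  | or φ ψ => φ.HasStrVar X ∨ ψ.HasStrVar X
  | imp φ ψ => φ.HasStrVar X ∨ ψ.HasStrVar X
  | allN _ φ => φ.HasStrVar X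
  | exN _ φ => φ.HasStrVar X
  | allS Y φ => Y = X ∨ φ.HasStrVar X
  | exS Y φ => Y = X ∨ φ.HasStrVar X

/-- The class `Σ^B_0`: no string quantifiers, and every number quantifier is bounded by a term
not containing the quantified variable. -/
inductive IsSigma0 : Formula → Prop
  | eqN (s t : Term) : IsSigma0 (eqN s t)
  | le (s t : Term) : IsSigma0 (le s t)
  | eqS (X Y : ℕ) : IsSigma0 (eqS X Y)
  | mem (t : Term) (X : ℕ) : IsSigma0 (mem t X)
  | not {φ : Formula} : IsSigma0 φ → IsSigma0 (not φ)
  | and {φ ψ : Formula} : IsSigma0 φ → IsSigma0 ψ → IsSigma0 (and φ ψ)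
  | or {φ ψ : Formula} : IsSigma0 φ → IsSigma0 ψ → IsSigma0 (or φ ψ)
  | imp {φ ψ : Formula} : IsSigma0 φ → IsSigma0 ψ → IsSigma0 (imp φ ψ)
  | ballN {x : ℕ} {t : Term} {φ : Formula} : ¬ t.HasNumVar x → IsSigma0 φ →
      IsSigma0 (allN x (imp (le (.var x) t) φ))
  | bexN {x : ℕ} {t : Term} {φ : Formula} : ¬ t.HasNumVar x → IsSigma0 φ →
      IsSigma0 (exN x (and (le (.var x) t) φ))

end Formula

/-- Structures for the two-sorted vocabulary. Both equality symbols are interpreted as equality,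
and both sorts are non-empty (the number sort contains `zero`). -/
structure Struct where
  Num : Type u
  Str : Type u
  strNonempty : Nonempty Str
  zero : Num
  one : Num
  add : Num → Num → Num
  mul : Num → Num → Num
  len : Str → Num
  le : Num → Num → Prop
  mem : Num → Str → Prop

/-- Value of a term under an assignment. -/
def Term.eval (M : Struct.{u}) (ρ : ℕ → M.Num) (σ : ℕ → M.Str) : Term → M.Num
  | var x => ρ x
  | zero => M.zero
  | one => M.one
  | add s t => M.add (s.eval M ρ σ) (t.eval M ρ σ)
  | mul s t => M.mul (s.eval M ρ σ) (t.eval M ρ σ)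
  | len X => M.len (σ X)

/-- Tarski's satisfaction relation. -/
def Formula.Sat (M : Struct.{u}) : Formula → (ℕ → M.Num) → (ℕ → M.Str) → Prop
  | eqN s t, ρ, σ => s.eval M ρ σ = t.eval M ρ σ
  | le s t, ρ, σ => M.le (s.eval M ρ σ) (t.eval M ρ σ)
  | eqS X Y, _, σ => σ X = σ Y
  | mem t X, ρ, σ => M.mem (t.eval M ρ σ) (σ X)
  | not φ, ρ, σ => ¬ φ.Sat M ρ σ
  | and φ ψ, ρ, σ => φ.Sat M ρ σ ∧ ψ.Sat M ρ σ
  | or φ ψ, ρ, σ => φ.Sat M ρ σ ∨ ψ.Sat M ρ σ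
  | imp φ ψ, ρ, σ => φ.Sat M ρ σ → ψ.Sat M ρ σ
  | allN x φ, ρ, σ => ∀ a : M.Num, φ.Sat M (Function.update ρ x a) σ
  | exN x φ, ρ, σ => ∃ a : M.Num, φ.Sat M (Function.update ρ x a) σ
  | allS X φ, ρ, σ => ∀ a : M.Str, φ.Sat M ρ (Function.update σ X a)
  | exS X φ, ρ, σ => ∃ a : M.Str, φ.Sat M ρ (Function.update σ X a)

/-- `M` is a model of the universal closure of `φ`. -/
def Struct.Models (M : Struct.{u}) (φ : Formula) : Prop :=
  ∀ (ρ : ℕ → M.Num) (σ : ℕ → M.Str), φ.Sat M ρ σ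

/-- `T ⊢ φ`: a theory consists of the logical consequences of its axioms, so `φ` is a theorem of
the theory with axioms `T` iff every model of (the universal closures of) `T` is a model of `φ`. -/
def Proves (T : Set Formula) (φ : Formula) : Prop :=
  ∀ M : Struct.{u}, (∀ ψ ∈ T, M.Models ψ) → M.Models φ

/-! ## Writing formulas

`Fml` is a formula awaiting a name `k` such that `k, k+1, …` are unused; a quantifier takes the
name `k` and passes `k + 1` on. So bound variables are always fresh, and formulas can be
written with Lean's binders. `close` turns a sentence written in this way into a formula. -/

/-- A formula depending on the first unused variable name. -/
abbrev Fml : Type := ℕ → Formula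

namespace Fml

def close (φ : Fml) : Formula := φ 0

def eqN (s t : Term) : Fml := fun _ => .eqN s t
def le (s t : Term) : Fml := fun _ => .le s t
def eqS (X Y : ℕ) : Fml := fun _ => .eqS X Y
def mem (t : Term) (X : ℕ) : Fml := fun _ => .mem t X
def not (φ : Fml) : Fml := fun k => .not (φ k)
def and (φ ψ : Fml) : Fml := fun k => .and (φ k) (ψ k)
def or (φ ψ : Fml) : Fml := fun k => .or (φ k) (ψ k)
def imp (φ ψ : Fml) : Fml := fun k => .imp (φ k) (ψ k)
def iff (φ ψ : Fml) : Fml := and (imp φ ψ) (imp ψ φ)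
def xor (φ ψ : Fml) : Fml := not (iff φ ψ)
def falsum : Fml := not (eqN 0 0)

def allN (f : Term → Fml) : Fml := fun k => .allN k (f (.var k) (k + 1))
def exN (f : Term → Fml) : Fml := fun k => .exN k (f (.var k) (k + 1))
def allS (f : ℕ → Fml) : Fml := fun k => .allS k (f k (k + 1))
def exS (f : ℕ → Fml) : Fml := fun k => .exS k (f k (k + 1))

end Fml

infixr:35 " ⋏ " => Fml.and
infixr:30 " ⋎ " => Fml.or
infixr:25 " ⟾ " => Fml.imp
infix:20 " ⬌ " => Fml.iff

namespace Fml

/-- `s < t` -/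
def lt (s t : Term) : Fml := le s t ⋏ not (eqN s t)

/-- `∀ x ≤ t`, `∃ x ≤ t`, `∀ x < t`, `∃ x < t` -/
def allLe (t : Term) (f : Term → Fml) : Fml := allN fun x => le x t ⟾ f x
def exLe (t : Term) (f : Term → Fml) : Fml := exN fun x => le x t ⋏ f x
def allLt (t : Term) (f : Term → Fml) : Fml := allLe t fun x => not (eqN x t) ⟾ f x
def exLt (t : Term) (f : Term → Fml) : Fml := exLe t fun x => not (eqN x t) ⋏ f x

end Fml

open Fml

/-! ## Binary numbers, integers, arrays

A `Nat2` is a definable binary number: a formula for its bits, and a term above all positions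
of bits `1`. -/

structure Nat2 where
  bit : Term → Fml
  bd : Term

/-- The pairing function `⟨x, y⟩ = (x + y)(x + y + 1) + 2y`. -/
def pair (x y : Term) : Term := (x + y) * (x + y + 1) + (y + y)

/-- The binary number `∑ {2^i | X(i)}` given by a string variable. -/
def str (X : ℕ) : Nat2 := ⟨fun i => mem i X, .len X⟩

/-- Quantifiers over strings, seen as binary numbers. -/
def Fml.all (f : Nat2 → Fml) : Fml := allS fun X => f (str X)
def Fml.ex (f : Nat2 → Fml) : Fml := exS fun X => f (str X)

namespace Nat2

def zero : Nat2 := ⟨fun _ => falsum, 0⟩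
def one : Nat2 := ⟨fun i => eqN i 0, 1⟩

/-- `X = Y` -/
def eqv (X Y : Nat2) : Fml := allLt (X.bd + Y.bd) fun i => X.bit i ⬌ Y.bit i

/-- There is a carry into position `i` in the addition of `X` and `Y`. -/
def carry (X Y : Nat2) (i : Term) : Fml :=
  exLt i fun k => X.bit k ⋏ Y.bit k ⋏ allLt i fun j => lt k j ⟾ X.bit j ⋎ Y.bit j

/-- `X + Y` -/
def add (X Y : Nat2) : Nat2 :=
  ⟨fun i => xor (xor (X.bit i) (Y.bit i)) (carry X Y i), X.bd + Y.bd⟩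

/-- `2^b X` -/
def shift (b : Term) (X : Nat2) : Nat2 :=
  ⟨fun i => exLe i fun l => eqN (b + l) i ⋏ X.bit l, b + X.bd⟩

/-- `X` if `φ`, and `0` otherwise -/
def guard (φ : Fml) (X : Nat2) : Nat2 := ⟨fun i => φ ⋏ X.bit i, X.bd⟩

/-- The row `X^[i] = {j | X(⟨i, j⟩)}`. -/
def row (X : Nat2) (i : Term) : Nat2 := ⟨fun j => X.bit (pair i j), X.bd⟩

/-- `Z = X · Y`: there is an array `W` whose row `b` is the product of `X` with the number
formed by the bits of `Y` below `b`, and `Z` is the last row. -/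
def isMul (X Y Z : Nat2) : Fml := ex fun W =>
  (W.row 0).eqv zero ⋏
  (allLt Y.bd fun b => (W.row (b + 1)).eqv ((W.row b).add (guard (Y.bit b) (shift b X)))) ⋏
  Z.eqv (W.row Y.bd)

end Nat2

/-- Integers are coded by a positive and a negative part, and denote the difference. -/
structure Int2 where
  pos : Nat2
  neg : Nat2

namespace Int2

def zero : Int2 := ⟨.zero, .zero⟩
def one : Int2 := ⟨.one, .zero⟩
def add (x y : Int2) : Int2 := ⟨x.pos.add y.pos, x.neg.add y.neg⟩
def opp (x : Int2) : Int2 := ⟨x.neg, x.pos⟩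

/-- `x = y` as integers -/
def eqv (x y : Int2) : Fml := (x.pos.add y.neg).eqv (y.pos.add x.neg)

def shift (b : Term) (x : Int2) : Int2 := ⟨x.pos.shift b, x.neg.shift b⟩
def guard (φ : Fml) (x : Int2) : Int2 := ⟨x.pos.guard φ, x.neg.guard φ⟩
def bd (x : Int2) : Term := x.pos.bd + x.neg.bd

end Int2

/-- The integer coded by a single binary number (string): rows `0` and `1` are its parts. -/
def Nat2.int (X : Nat2) : Int2 := ⟨X.row 0, X.row 1⟩

/-- Entries of one-, two- and three-dimensional arrays of integers coded by a string. -/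
def Nat2.at1 (X : Nat2) (i : Term) : Int2 := (X.row i).int
def Nat2.at2 (X : Nat2) (i j : Term) : Int2 := ((X.row i).row j).int
def Nat2.at3 (X : Nat2) (i j k : Term) : Int2 := (((X.row i).row j).row k).int

namespace Int2

/-- `W` is a multiplication table for `x · y`: its entry `b` is the product of `x` with the
integer formed by the bits of `y` below `b`. -/
def isTable (x y : Int2) (W : Nat2) : Fml :=
  (W.at1 0).eqv zero ⋏
  allLt y.bd fun b => (W.at1 (b + 1)).eqv
    (((W.at1 b).add (guard (y.pos.bit b) (shift b x))).add
      (opp (guard (y.neg.bit b) (shift b x))))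

/-- `z = x · y` -/
def isMul (x y z : Int2) : Fml := ex fun W => isTable x y W ⋏ z.eqv (W.at1 y.bd)

/-- `c = ∑_{k < n} a_k b_k`, as computed in `T`: row `0` of `T` consists of multiplication tables
for the products `a_k b_k`, and row `1` of the partial sums. -/
def isDot (n : Term) (a b : Term → Int2) (c : Int2) (T : Nat2) : Fml :=
  (allLt n fun k => isTable (a k) (b k) ((T.row 0).row k)) ⋏
  ((T.row 1).at1 0).eqv zero ⋏
  (allLt n fun k => ((T.row 1).at1 (k + 1)).eqv
    (((T.row 1).at1 k).add (((T.row 0).row k).at1 (b k).bd))) ⋏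
  c.eqv ((T.row 1).at1 n)

end Int2

/-! ## Matrices of integers

A string codes the `n × n` matrix of integers with entries `X.at2 i j`, `i, j < n`.
Indices start from `0`. -/

/-- `C = A B` for `n × n` matrices given by their entries -/
def isMatMul (n : Term) (A B C : Term → Term → Int2) : Fml := ex fun T =>
  allLt n fun i => allLt n fun j =>
    Int2.isDot n (fun k => A i k) (fun k => B k j) (C i j) ((T.row i).row j)

/-- `Y = X^m` for `n × n` matrices: `S` is the sequence of the powers `X^0, …, X^m`, and `T`
contains the computations of all the inner products. -/
def isMatPow (n : Term) (X : Nat2) (m : Term) (Y : Nat2) : Fml := ex fun S => ex fun T =>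
  (allLt n fun i => allLt n fun j =>
    (eqN i j ⟾ (S.at3 0 i j).eqv .one) ⋏ (not (eqN i j) ⟾ (S.at3 0 i j).eqv .zero)) ⋏
  (allLt m fun e => allLt n fun i => allLt n fun j =>
    Int2.isDot n (fun k => S.at3 e i k) (fun k => X.at2 k j) (S.at3 (e + 1) i j)
      (((T.row e).row i).row j)) ⋏
  (allLt n fun i => allLt n fun j => (Y.at2 i j).eqv (S.at3 m i j))

/-! ## The theory `V#L` -/

/-- The axioms `2-BASIC` -/
def basicAxioms : List Formula := [
  -- B1 to B12
  close (allN fun x => not (eqN (x + 1) 0)),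
  close (allN fun x => allN fun y => eqN (x + 1) (y + 1) ⟾ eqN x y),
  close (allN fun x => eqN (x + 0) x),
  close (allN fun x => allN fun y => eqN (x + (y + 1)) ((x + y) + 1)),
  close (allN fun x => eqN (x * 0) 0),
  close (allN fun x => allN fun y => eqN (x * (y + 1)) (x * y + x)),
  close (allN fun x => allN fun y => le x y ⋏ le y x ⟾ eqN x y),
  close (allN fun x => allN fun y => le x (x + y)),
  close (allN fun x => le 0 x),
  close (allN fun x => allN fun y => le x y ⋎ le y x),
  close (allN fun x => allN fun y => le x y ⬌ lt x (y + 1)),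
  close (allN fun x => not (eqN x 0) ⟾ exLe x fun y => eqN (y + 1) x),
  -- L1, L2 and extensionality
  close (allS fun X => allN fun y => mem y X ⟾ lt y (.len X)),
  close (allS fun X => allN fun y => eqN (y + 1) (.len X) ⟾ mem y X),
  close (allS fun X => allS fun Y =>
    eqN (.len X) (.len Y) ⋏ (allLt (.len X) fun i => mem i X ⬌ mem i Y) ⟾ eqS X Y)]

/-- Comprehension for `φ(z)`: `∃ X (|X| ≤ y ∧ ∀ z (z < y → (X(z) ↔ φ(z))))`. -/
def compAxiom (φ : Formula) (y z X : ℕ) : Formula :=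
  .exS X (.and (.le (.len X) (.var y))
    (.allN z (.imp (lt (.var z) (.var y) 0)
      (.and (.imp (.mem (.var z) X) φ) (.imp φ (.mem (.var z) X))))))

/-- String multiplication: `∀ X, Y ∃ Z (Z = X · Y)` -/
def multAxiom : Formula :=
  close (all fun X => all fun Y => ex fun Z => Nat2.isMul X Y Z)

/-- Matrix powering: `∀ X ∀ m ∃ Y (Y = X^m)`, where `X` is an `n × n` matrix of integers -/
def powAxiom : Formula :=
  close (allN fun n => all fun X => allN fun m => ex fun Y => isMatPow n X m Y)

/-- The axioms of `V#L` -/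
def VSharpL : Set Formula :=
  {ψ | ψ ∈ basicAxioms} ∪
  {ψ | ∃ (φ : Formula) (y z X : ℕ), φ.IsSigma0 ∧ ¬ φ.HasStrVar X ∧ y ≠ z ∧
    ψ = compAxiom φ y z X} ∪
  {multAxiom, powAxiom}

/-! ## The Pfaffian and its properties, as formulas -/

/-- The `N × N` matrix `A` is skew symmetric. -/
def isSkew (N : Term) (A : Nat2) : Fml :=
  allLt N fun i => allLt N fun j => (A.at2 i j).eqv (A.at2 j i).opp

/-- One step of the Berkowitz type algorithm for the Pfaffian.

The matrix in question is the lower right `2(r+1) × 2(r+1)` submatrix of `A`, from index `2k` on,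
with block decomposition `[[0, a, R], [-a, 0, -Sᵗ], [-Rᵗ, S, M]]` where `M` is `2r × 2r`.
* `U k j` is the row vector `R J (M J)^j`, for `j < r`, evaluated from left to right
  (a row vector `x` has `(x J)_{2l} = - x_{2l+1}` and `(x J)_{2l+1} = x_{2l}`);
* `C k j` is the number `R J (M J)^j S`, for `j < r`;
* `P k` is the lower triangular Toeplitz matrix with `r + 2` rows and `r + 1` columns and with
  first column `1, a, R J S, R J (M J) S, …, R J (M J)^(r-1) S`;
* `Q k` is the vector of the `r + 2` Pfaffian coefficients, the product of `P k` and `Q (k+1)`.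
`T₁`, `T₂`, `T₃` contain the computations of the inner products. -/
def isPfStep (A U C P Q T₁ T₂ T₃ : Nat2) (k r : Term) : Fml :=
  let o : Term := (k + k) + (1 + 1)
  let a : Int2 := A.at2 (k + k) (k + k + 1)
  let R : Term → Int2 := fun t => A.at2 (k + k) (o + t)
  let S : Term → Int2 := fun s => A.at2 (o + s) (k + k + 1)
  let M : Term → Term → Int2 := fun s t => A.at2 (o + s) (o + t)
  let u : Term → Term → Int2 := fun j t => U.at3 k j t
  let c : Term → Int2 := fun j => C.at2 k j
  let p : Term → Term → Int2 := fun i i' => P.at3 k i i'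
  (allLt r fun l =>
    (u 0 (l + l)).eqv (R (l + l + 1)).opp ⋏ (u 0 (l + l + 1)).eqv (R (l + l))) ⋏
  (allLt r fun j => lt (j + 1) r ⟾ allLt r fun l =>
    Int2.isDot (r + r) (fun s => u j s) (fun s => (M s (l + l + 1)).opp)
      (u (j + 1) (l + l)) (((T₁.row k).row j).row (l + l)) ⋏
    Int2.isDot (r + r) (fun s => u j s) (fun s => M s (l + l))
      (u (j + 1) (l + l + 1)) (((T₁.row k).row j).row (l + l + 1))) ⋏
  (allLt r fun j => Int2.isDot (r + r) (fun s => u j s) S (c j) ((T₂.row k).row j)) ⋏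
  (allLt (r + 1 + 1) fun i => allLt (r + 1) fun i' =>
    (lt i i' ⟾ (p i i').eqv .zero) ⋏
    (eqN i i' ⟾ (p i i').eqv .one) ⋏
    (eqN i (i' + 1) ⟾ (p i i').eqv a) ⋏
    (allLt r fun j => eqN i (i' + (1 + 1) + j) ⟾ (p i i').eqv (c j))) ⋏
  (allLt (r + 1 + 1) fun i =>
    Int2.isDot (r + 1) (fun i' => p i i') (fun i' => Q.at2 (k + 1) i') (Q.at2 k i)
      ((T₃.row k).row i))

/-- `p = pf(A)` for the `2n × 2n` matrix `A`: the result of the Berkowitz type algorithm, which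
starts with the coefficient vector `(1)` of the empty matrix and returns the last coefficient. -/
def isPf (n : Term) (A : Nat2) (p : Int2) : Fml :=
  ex fun U => ex fun C => ex fun P => ex fun Q => ex fun T₁ => ex fun T₂ => ex fun T₃ =>
    (allLt n fun k => allLt n fun r => eqN (k + 1 + r) n ⟾ isPfStep A U C P Q T₁ T₂ T₃ k r) ⋏
    (Q.at2 n 0).eqv .one ⋏
    p.eqv (Q.at2 0 n)

/-- `d = det(B)` for the `N × N` matrix `B`:
`det(B) = (-1)^(N(N-1)/2) pf [[0, B], [-Bᵗ, 0]]`. The sign is `+` iff `N(N-1)` is of the form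
`4m`. -/
def isDet (N : Term) (B : Nat2) (d : Int2) : Fml := ex fun D =>
  (allLt N fun i => allLt N fun j =>
    (D.at2 i j).eqv .zero ⋏
    (D.at2 i (N + j)).eqv (B.at2 i j) ⋏
    (D.at2 (N + i) j).eqv (B.at2 j i).opp ⋏
    (D.at2 (N + i) (N + j)).eqv .zero) ⋏
  ex fun q => isPf N D q.int ⋏
    ((exLe (N * N) fun m => eqN (N * N) (N + (m + m + m + m))) ⟾ d.eqv q.int) ⋏
    (not (exLe (N * N) fun m => eqN (N * N) (N + (m + m + m + m))) ⟾ d.eqv q.int.opp)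

/-- The transposition of `i` and `j` maps `s` to `t`. -/
def isSwapped (i j s t : Term) : Fml :=
  (eqN s i ⋏ eqN t j) ⋎ (eqN s j ⋏ eqN t i) ⋎ (not (eqN s i) ⋏ not (eqN s j) ⋏ eqN t s)

/-- `A' = A[i:j]`: the `N × N` matrix `A'` arises from `A` by swapping rows `i, j` and
columns `i, j`. -/
def isSwap (N : Term) (A : Nat2) (i j : Term) (A' : Nat2) : Fml :=
  allLt N fun s => allLt N fun t => allLt N fun s' => allLt N fun t' =>
    isSwapped i j s s' ⋏ isSwapped i j t t' ⟾ (A'.at2 s' t').eqv (A.at2 s t)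

/-- (MP): `pf(Bᵗ A B) = pf(A) det(B)` for `2n × 2n` matrices `A`, `B` with `A` skew symmetric.
Here `D = A B` and `C = Bᵗ D`. -/
def MP : Formula := close <|
  allN fun n => all fun A => all fun B => all fun D => all fun C =>
    isSkew (n + n) A ⟾
    isMatMul (n + n) (fun i j => A.at2 i j) (fun i j => B.at2 i j) (fun i j => D.at2 i j) ⟾
    isMatMul (n + n) (fun i j => B.at2 j i) (fun i j => D.at2 i j) (fun i j => C.at2 i j) ⟾
    all fun p => all fun q => all fun d =>
      isPf n A p.int ⟾ isPf n C q.int ⟾ isDet (n + n) B d.int ⟾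
        Int2.isMul p.int d.int q.int

/-- (PALT): `pf(A[i:j]) = - pf(A)` for skew symmetric `2n × 2n` matrices `A` and `i ≠ j`.
It includes that both Pfaffians exist. -/
def PALT : Formula := close <|
  allN fun n => all fun A => allLt (n + n) fun i => allLt (n + n) fun j => all fun A' =>
    isSkew (n + n) A ⟾ not (eqN i j) ⟾ isSwap (n + n) A i j A' ⟾
      (ex fun p => isPf n A p.int) ⋏
      (ex fun q => isPf n A' q.int) ⋏
      all fun p => all fun q => isPf n A p.int ⟾ isPf n A' q.int ⟾ q.int.eqv p.int.opp

end BoundedArith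

set_option linter.unusedSectionVars false
set_option linter.unusedVariables false

namespace BoundedArith

open Fml

/-! ## Numbers of a model -/

section occurs
variable (x : ℕ) (s t : Term)
-- Fix a model of V#L. Its numbers form an ordered semiring, and formal differences of its strings
-- form a commutative ring `ZM M` of integers. All statements are translated into statements about
-- this ring, with indices starting from 0.
--
-- (MP) is applied only to 0/1 matrices `B` whose column `j` has its single 1 in row `σ j`. Then
-- `ᵗBAB` has the entries `A (σ i) (σ j)`, so applying `σ` to the indices multiplies every Pfaffian
-- by one scalar, `det B`, which does not depend on `A` (`MP'.exists_isSgn`). No determinant is ever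
-- evaluated: the scalars are found by testing on the matrix `J`. Scalars multiply under composition
-- (`IsSgn.comp`), and the identity has only the scalar 1 because pf(J) = 1 (`IsSgn.eq_one`).
-- Swapping the indices 0 and 1 of `J` gives Pfaffian -1, so the transposition (0 1) has scalar -1
-- (`MP'.isSgn_swap_zero_one`). Both Pfaffians are easy, since all vectors `S` of the algorithm
-- vanish and it collapses to a product of entries (`isPf'.eval_special`). If a transposition with
-- scalar -1 is conjugated by one with scalar `f`, the result has scalar `f · (-1) · f = -f²`, and
-- `f² = 1` because the conjugating transposition is an involution (`MP'.isSgn_conj`). Two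
-- conjugations lead from (0 1) to every transposition.
--
-- Most of the labour is to make this available in a weak theory. Comprehension holds for Σ^B_0
-- formulas only, so induction is available only for predicates whose initial segments are coded by
-- strings. The classes `LP`, `LF`, `LS` and `LZ` express this for predicates, number functions,
-- sequences of strings and sequences of integers. Their closure properties are proved once, and
-- instance search then justifies the individual inductions.
--
-- The powering axiom is exploited through its witnesses, which contain the multiplication tables
-- and partial sums of all inner products involved. Squares of suitable matrices thus yield products
-- (`exists_table`, `LZ.mul`) and sums (`exists_partial_sums`), for whole families at once. Powers
-- of a bordered matrix iterate any linear recurrence (`exists_linRec`). The Pfaffian algorithm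
-- consists of two such recurrences, run for all its steps simultaneously by means of block matrices
-- (`exists_krylov`, `exists_pfCoeffs`). Hence every Pfaffian exists (`exists_isPf`). This is part
-- of (PALT), and it is also what permits the use of (MP) on auxiliary matrices.
@[simp] theorem hasNumVar_var (y : ℕ) : (Term.var y).HasNumVar x ↔ y = x := Iff.rfl
@[simp] theorem hasStrVar_var (y : ℕ) : (Term.var y).HasStrVar x ↔ False := Iff.rfl
@[simp] theorem hasStrVar_zero : (0 : Term).HasStrVar x ↔ False := Iff.rfl
@[simp] theorem hasStrVar_one : (1 : Term).HasStrVar x ↔ False := Iff.rfl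
@[simp] theorem hasStrVar_add : (s + t).HasStrVar x ↔ s.HasStrVar x ∨ t.HasStrVar x := Iff.rfl
@[simp] theorem hasStrVar_mul : (s * t).HasStrVar x ↔ s.HasStrVar x ∨ t.HasStrVar x := Iff.rfl
end occurs

section Num

variable {M : Struct.{u}}

/-- `M` is a model of `V#L`. -/
class VModel (M : Struct.{u}) : Prop where
  models : ∀ ψ ∈ VSharpL, M.Models ψ

instance : Zero M.Num := ⟨M.zero⟩
instance : One M.Num := ⟨M.one⟩
instance : Add M.Num := ⟨M.add⟩
instance : Mul M.Num := ⟨M.mul⟩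
instance : LE M.Num := ⟨M.le⟩
instance : LT M.Num := ⟨fun a b => a ≤ b ∧ a ≠ b⟩
instance : Membership M.Num M.Str := ⟨fun X a => M.mem a X⟩
instance : Nonempty M.Str := M.strNonempty

theorem Struct.lt_iff {a b : M.Num} : a < b ↔ a ≤ b ∧ a ≠ b := Iff.rfl

section eval
variable (ρ : ℕ → M.Num) (σ : ℕ → M.Str)
@[simp] theorem eval_var (x : ℕ) : (Term.var x).eval M ρ σ = ρ x := rfl
@[simp] theorem eval_zero : (0 : Term).eval M ρ σ = 0 := rfl
@[simp] theorem eval_one : (1 : Term).eval M ρ σ = 1 := rfl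
@[simp] theorem eval_add (s t : Term) : (s + t).eval M ρ σ = s.eval M ρ σ + t.eval M ρ σ := rfl
@[simp] theorem eval_mul (s t : Term) : (s * t).eval M ρ σ = s.eval M ρ σ * t.eval M ρ σ := rfl
@[simp] theorem eval_len (X : ℕ) : (Term.len X).eval M ρ σ = M.len (σ X) := rfl
@[simp] theorem sat_eqN (s t : Term) :
    (Formula.eqN s t).Sat M ρ σ ↔ s.eval M ρ σ = t.eval M ρ σ := Iff.rfl
@[simp] theorem sat_le (s t : Term) :
    (Formula.le s t).Sat M ρ σ ↔ s.eval M ρ σ ≤ t.eval M ρ σ := Iff.rfl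
@[simp] theorem sat_eqS (X Y : ℕ) : (Formula.eqS X Y).Sat M ρ σ ↔ σ X = σ Y := Iff.rfl
@[simp] theorem sat_mem (t : Term) (X : ℕ) :
    (Formula.mem t X).Sat M ρ σ ↔ t.eval M ρ σ ∈ σ X := Iff.rfl
@[simp] theorem sat_not (φ : Formula) : φ.not.Sat M ρ σ ↔ ¬ φ.Sat M ρ σ := Iff.rfl
@[simp] theorem sat_and (φ ψ : Formula) :
    (φ.and ψ).Sat M ρ σ ↔ φ.Sat M ρ σ ∧ ψ.Sat M ρ σ := Iff.rfl
@[simp] theorem sat_or (φ ψ : Formula) :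
    (φ.or ψ).Sat M ρ σ ↔ φ.Sat M ρ σ ∨ ψ.Sat M ρ σ := Iff.rfl
@[simp] theorem sat_imp (φ ψ : Formula) :
    (φ.imp ψ).Sat M ρ σ ↔ (φ.Sat M ρ σ → ψ.Sat M ρ σ) := Iff.rfl
@[simp] theorem sat_allN (x : ℕ) (φ : Formula) :
    (Formula.allN x φ).Sat M ρ σ ↔ ∀ a, φ.Sat M (Function.update ρ x a) σ := Iff.rfl
@[simp] theorem sat_exN (x : ℕ) (φ : Formula) :
    (Formula.exN x φ).Sat M ρ σ ↔ ∃ a, φ.Sat M (Function.update ρ x a) σ := Iff.rfl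
@[simp] theorem sat_allS (x : ℕ) (φ : Formula) :
    (Formula.allS x φ).Sat M ρ σ ↔ ∀ a, φ.Sat M ρ (Function.update σ x a) := Iff.rfl
@[simp] theorem sat_exS (x : ℕ) (φ : Formula) :
    (Formula.exS x φ).Sat M ρ σ ↔ ∃ a, φ.Sat M ρ (Function.update σ x a) := Iff.rfl
end eval

theorem models_basic [h : VModel M] {φ : Formula} (hφ : φ ∈ basicAxioms)
    (ρ : ℕ → M.Num) (σ : ℕ → M.Str) : φ.Sat M ρ σ :=
  h.models φ (Or.inl (Or.inl hφ)) ρ σ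

variable [VModel M]

/-! ### The axioms read in a model, and induction -/

theorem basic_all : (∀ x : M.Num, x + 1 ≠ 0) ∧
    (∀ x y : M.Num, x + 1 = y + 1 → x = y) ∧
    (∀ x : M.Num, x + 0 = x) ∧
    (∀ x y : M.Num, x + (y + 1) = x + y + 1) ∧
    (∀ x : M.Num, x * 0 = 0) ∧
    (∀ x y : M.Num, x * (y + 1) = x * y + x) ∧
    (∀ x y : M.Num, x ≤ y → y ≤ x → x = y) ∧
    (∀ x y : M.Num, x ≤ x + y) ∧
    (∀ x : M.Num, 0 ≤ x) ∧
    (∀ x y : M.Num, x ≤ y ∨ y ≤ x) ∧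
    (∀ x y : M.Num, x ≤ y ↔ x < y + 1) ∧
    (∀ x : M.Num, x ≠ 0 → ∃ y, y ≤ x ∧ y + 1 = x) ∧
    (∀ (X : M.Str) (y : M.Num), y ∈ X → y < M.len X) ∧
    (∀ (X : M.Str) (y : M.Num), y + 1 = M.len X → y ∈ X) ∧
    (∀ X Y : M.Str, M.len X = M.len Y → (∀ i < M.len X, i ∈ X ↔ i ∈ Y) → X = Y) := by
  obtain ⟨s⟩ := M.strNonempty
  have key := fun (φ : Formula) (hφ : φ ∈ basicAxioms) =>
    models_basic (M := M) hφ (fun _ => 0) (fun _ => s)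
  simp only [basicAxioms, List.forall_mem_cons] at key
  simp only [close, allN, allS, exLe, exN, allLt, allLe, lt, Fml.le, Fml.not, Fml.and, Fml.or,
    Fml.imp, Fml.iff, Fml.eqN, Fml.eqS, Fml.mem, sat_allN, sat_exN, sat_allS, sat_not, sat_eqN,
    sat_and, sat_or, sat_imp, sat_le, sat_eqS, sat_mem, eval_var, eval_zero, eval_one, eval_add,
    eval_mul, eval_len, Function.update] at key
  obtain ⟨h1, h2, h3, h4, h5, h6, h7, h8, h9, h10, h11, h12, h13, h14, h15, -⟩ := key
  simp at h1 h2 h3 h4 h5 h6 h7 h8 h9 h10 h11 h12 h13 h14 h15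
  refine ⟨h1, h2, h3, h4, h5, h6, h7, h8, h9, h10, fun x y => ?_, h12, h13, h14, ?_⟩
  · rw [Struct.lt_iff]; exact ⟨(h11 x y).1, fun h => (h11 x y).2 h.1 h.2⟩
  · intro X Y h h'
    exact h15 X Y h fun i h1 h2 => iff_def.1 (h' i ⟨h1, h2⟩)

/-- The names are fixed once and for all: number name 0 is the element tested, number name 1 the
bound, and string name 0 the set being defined. Parameters therefore use number names from 2 on and
string names from 1 on. -/
theorem comprehension (φ : Formula) (hφ : φ.IsSigma0) (hX : ¬ φ.HasStrVar 0) (ρ : ℕ → M.Num)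
    (σ : ℕ → M.Str) (b : M.Num) : ∃ X : M.Str, M.len X ≤ b ∧ ∀ z < b,
      (z ∈ X ↔ φ.Sat M (Function.update (Function.update ρ 1 b) 0 z) (Function.update σ 0 X)) := by
  have h := VModel.models (M := M) (compAxiom φ 1 0 0)
    (Or.inl (Or.inr ⟨φ, 1, 0, 0, hφ, hX, by decide, rfl⟩)) (Function.update ρ 1 b) σ
  simp only [compAxiom, lt, Fml.le, Fml.not, Fml.and, Fml.eqN, sat_exS, sat_and, sat_le, eval_len,
    eval_var, sat_allN, sat_imp, sat_not, sat_eqN, sat_mem] at h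
  simp at h
  obtain ⟨X, h1, h2⟩ := h
  exact ⟨X, h1, fun z hz => iff_def.2 (h2 z hz.1 hz.2)⟩

/-- Every initial segment of `P` is a string. -/
class LP (P : M.Num → Prop) : Prop where
  code : ∀ b, ∃ X : M.Str, M.len X ≤ b ∧ ∀ z < b, (z ∈ X ↔ P z)

theorem LP.of_formula {P : M.Num → Prop} (φ : Formula) (hφ : φ.IsSigma0) (hX : ¬ φ.HasStrVar 0)
    (ρ : ℕ → M.Num) (σ : ℕ → M.Str)
    (h : ∀ b z X, φ.Sat M (Function.update (Function.update ρ 1 b) 0 z) (Function.update σ 0 X) ↔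
      P z) : LP P := by
  refine ⟨fun b => ?_⟩
  obtain ⟨X, h1, h2⟩ := comprehension φ hφ hX ρ σ b
  exact ⟨X, h1, fun z hz => (h2 z hz).trans (h b z X)⟩

theorem Struct.le_refl (a : M.Num) : a ≤ a := by
  have h3 := (basic_all (M := M)).2.2.1
  have h8 := (basic_all (M := M)).2.2.2.2.2.2.2.1
  simpa [h3] using h8 a 0

theorem Struct.lt_succ_self (a : M.Num) : a < a + 1 :=
  ((basic_all (M := M)).2.2.2.2.2.2.2.2.2.2.1 a a).1 (Struct.le_refl a)

/-- The least number principle in disguise: by L2 a non-empty string contains the predecessor of its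
length, which is its largest element. Applied to the set of those `z` up to which the predicate
holds throughout, this gives an element from which the induction step leads to a contradiction. -/
theorem LP.induction {P : M.Num → Prop} (hP : LP P) (h0 : P 0) (h1 : ∀ a, P a → P (a + 1))
    (a : M.Num) : P a := by
  obtain ⟨b1, b2, b3, b4, b5, b6, b7, b8, b9, b10, b11, b12, l1, l2, ext⟩ := basic_all (M := M)
  by_contra ha
  obtain ⟨Y, -, hY⟩ := hP.code (a + 1)
  -- `X` is the largest initial segment of the numbers up to `a` that is contained in `Y`.
  obtain ⟨X, hXl, hX⟩ := comprehension (M := M)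
    (.allN 2 (.imp (.le (.var 2) (.var 0)) (.mem (.var 2) 1)))
    (.ballN (by simp [Term.HasNumVar]) (.mem _ _))
    (by simp [Formula.HasStrVar, Term.HasStrVar]) (fun _ => 0) (fun _ => Y) (a + 1)
  simp [Function.update] at hX
  have hz : (0 : M.Num) < a + 1 := ⟨b9 _, fun h => b1 a h.symm⟩
  have h0X : (0 : M.Num) ∈ X := by
    rw [hX 0 hz]
    intro y hy
    have : y = 0 := b7 _ _ hy (b9 y)
    subst this
    exact (hY 0 hz).2 h0
  have hl : M.len X ≠ 0 := fun h => by
    have := l1 X 0 h0X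
    rw [h] at this
    exact this.2 rfl
  obtain ⟨y, -, hy⟩ := b12 _ hl
  have hyX := l2 X y hy
  have hyl := l1 X y hyX
  rw [← hy] at hXl
  have hya : y ≤ a := by
    by_cases e : y + 1 = a + 1
    · rw [b2 _ _ e]; exact Struct.le_refl a
    · refine (b10 y a).resolve_right fun h => ?_
      have h1 := (b11 a y).1 h
      exact h1.2 (b7 _ _ h1.1 ((b11 _ _).2 ⟨hXl, e⟩))
  have hy1 := (b11 y a).1 hya
  have hyY := (hX y hy1).1 hyX
  have hPy : P y := (hY y hy1).1 (hyY y (Struct.le_refl y))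
  by_cases e : y + 1 = a + 1
  · rw [b2 _ _ e] at hPy
    exact ha hPy
  · have h2 : y + 1 < a + 1 := ⟨hXl, e⟩
    have h3 : y + 1 ∈ X := by
      rw [hX _ h2]
      intro w hw
      by_cases hw' : w = y + 1
      · rw [hw']; exact (hY _ h2).2 (h1 y hPy)
      · exact hyY w ((b11 w y).2 ⟨hw, hw'⟩)
    exact (l1 X _ h3).2 hy

/-- Assignments with values `a`, `b` at the names `2`, `3`. -/
def params (a b : M.Num) : ℕ → M.Num
  | 2 => a
  | 3 => b
  | _ => 0

/-- Assignments with values `X`, `Y` at the names `1`, `2`. -/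
def sparams (X Y : M.Str) : ℕ → M.Str
  | 1 => X
  | 2 => Y
  | _ => X

/-- Serves the semiring laws: the induction variable has name 0, and the names 2 and 3 hold two
fixed parameters. -/
theorem LP.induction_eqN (s t : Term) (P : M.Num → Prop) (a b : M.Num)
    (hX : ¬ (Formula.eqN s t).HasStrVar 0)
    (h : ∀ (d z : M.Num) (σ : ℕ → M.Str),
      s.eval M (Function.update (Function.update (params a b) 1 d) 0 z) σ =
      t.eval M (Function.update (Function.update (params a b) 1 d) 0 z) σ ↔ P z)
    (h0 : P 0) (h1 : ∀ a, P a → P (a + 1)) : ∀ c, P c :=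
  LP.induction (LP.of_formula (.eqN s t) (.eqN s t) hX (params a b)
    (fun _ => Classical.arbitrary _) fun d z _ => h d z _) h0 h1

/-! ### The ordered semiring of numbers -/

namespace Struct

theorem add_zero' (a : M.Num) : a + 0 = a := (basic_all (M := M)).2.2.1 a
theorem add_succ' (a b : M.Num) : a + (b + 1) = a + b + 1 := (basic_all (M := M)).2.2.2.1 a b
theorem mul_zero' (a : M.Num) : a * 0 = 0 := (basic_all (M := M)).2.2.2.2.1 a
theorem mul_succ' (a b : M.Num) : a * (b + 1) = a * b + a :=
  (basic_all (M := M)).2.2.2.2.2.1 a b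

theorem zero_add' : ∀ a : M.Num, 0 + a = a :=
  LP.induction_eqN (0 + .var 0) (.var 0) _ 0 0 (by simp [Formula.HasStrVar])
    (fun d z σ => by simp) (add_zero' 0) fun a h => by rw [add_succ', h]

theorem succ_add' (a : M.Num) : ∀ b : M.Num, a + 1 + b = a + b + 1 :=
  LP.induction_eqN (.var 2 + 1 + .var 0) (.var 2 + .var 0 + 1) _ a 0 (by simp [Formula.HasStrVar])
    (fun d z σ => by simp [params]) (by rw [add_zero', add_zero']) fun b h => by
      rw [add_succ', h, add_succ']

theorem add_comm' (a : M.Num) : ∀ b : M.Num, a + b = b + a :=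
  LP.induction_eqN (.var 2 + .var 0) (.var 0 + .var 2) _ a 0 (by simp [Formula.HasStrVar])
    (fun d z σ => by simp [params]) (by rw [add_zero', zero_add']) fun b h => by
      rw [add_succ', h, succ_add']

theorem add_assoc' (a b : M.Num) : ∀ c : M.Num, a + b + c = a + (b + c) :=
  LP.induction_eqN (.var 2 + .var 3 + .var 0) (.var 2 + (.var 3 + .var 0)) _ a b
    (by simp [Formula.HasStrVar]) (fun d z σ => by simp [params])
    (by rw [add_zero', add_zero']) fun c h => by rw [add_succ', add_succ', add_succ', h]

theorem zero_mul' : ∀ a : M.Num, 0 * a = 0 :=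
  LP.induction_eqN (0 * .var 0) 0 _ 0 0 (by simp [Formula.HasStrVar])
    (fun d z σ => by simp) (mul_zero' 0) fun a h => by rw [mul_succ', h, add_zero']

theorem succ_mul' (a : M.Num) : ∀ b : M.Num, (a + 1) * b = a * b + b :=
  LP.induction_eqN ((.var 2 + 1) * .var 0) (.var 2 * .var 0 + .var 0) _ a 0
    (by simp [Formula.HasStrVar]) (fun d z σ => by simp [params])
    (by rw [mul_zero', mul_zero', add_zero']) fun b h => by
      rw [mul_succ', h, mul_succ', add_assoc', add_assoc', ← add_assoc' b a 1, ← add_assoc' a b 1,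
        add_comm' b a]

theorem mul_comm' (a : M.Num) : ∀ b : M.Num, a * b = b * a :=
  LP.induction_eqN (.var 2 * .var 0) (.var 0 * .var 2) _ a 0 (by simp [Formula.HasStrVar])
    (fun d z σ => by simp [params]) (by rw [mul_zero', zero_mul']) fun b h => by
      rw [mul_succ', h, succ_mul']

theorem mul_add' (a b : M.Num) : ∀ c : M.Num, a * (b + c) = a * b + a * c :=
  LP.induction_eqN (.var 2 * (.var 3 + .var 0)) (.var 2 * .var 3 + .var 2 * .var 0) _ a b
    (by simp [Formula.HasStrVar]) (fun d z σ => by simp [params])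
    (by rw [add_zero', mul_zero', add_zero']) fun c h => by
      rw [add_succ', mul_succ', mul_succ', h, add_assoc']

theorem mul_assoc' (a b : M.Num) : ∀ c : M.Num, a * b * c = a * (b * c) :=
  LP.induction_eqN (.var 2 * .var 3 * .var 0) (.var 2 * (.var 3 * .var 0)) _ a b
    (by simp [Formula.HasStrVar]) (fun d z σ => by simp [params])
    (by rw [mul_zero', mul_zero', mul_zero']) fun c h => by
      rw [mul_succ', mul_succ', mul_add', h]

theorem mul_one' (a : M.Num) : a * 1 = a := by
  have := mul_succ' a 0
  rwa [zero_add', mul_zero', zero_add'] at this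

end Struct

instance : CommSemiring M.Num where
  add_assoc := Struct.add_assoc'
  zero_add := Struct.zero_add'
  add_zero := Struct.add_zero'
  add_comm := fun a b => Struct.add_comm' a b
  left_distrib := Struct.mul_add'
  right_distrib a b c := by
    rw [Struct.mul_comm', Struct.mul_add', Struct.mul_comm' c a, Struct.mul_comm' c b]
  zero_mul := Struct.zero_mul'
  mul_zero := Struct.mul_zero'
  mul_assoc := Struct.mul_assoc'
  one_mul a := by rw [Struct.mul_comm', Struct.mul_one']
  mul_one := Struct.mul_one'
  mul_comm := fun a b => Struct.mul_comm' a b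
  nsmul := nsmulRec

namespace Struct

theorem add_one_ne_zero (a : M.Num) : a + 1 ≠ 0 := (basic_all (M := M)).1 a
theorem add_one_inj {a b : M.Num} (h : a + 1 = b + 1) : a = b := (basic_all (M := M)).2.1 a b h
theorem le_antisymm' {a b : M.Num} (h : a ≤ b) (h' : b ≤ a) : a = b :=
  (basic_all (M := M)).2.2.2.2.2.2.1 a b h h'
theorem le_add_right' (a b : M.Num) : a ≤ a + b := (basic_all (M := M)).2.2.2.2.2.2.2.1 a b
theorem le_total' (a b : M.Num) : a ≤ b ∨ b ≤ a := (basic_all (M := M)).2.2.2.2.2.2.2.2.2.1 a b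
theorem le_iff_lt_succ {a b : M.Num} : a ≤ b ↔ a < b + 1 :=
  (basic_all (M := M)).2.2.2.2.2.2.2.2.2.2.1 a b
theorem exists_pred {a : M.Num} (h : a ≠ 0) : ∃ b, b + 1 = a :=
  ((basic_all (M := M)).2.2.2.2.2.2.2.2.2.2.2.1 a h).imp fun _ h => h.2

theorem succ_le_of_lt {a b : M.Num} (h : a < b) : a + 1 ≤ b := by
  rcases le_total' (a + 1) b with h1 | h1
  · exact h1
  · by_cases e : b = a + 1
    · exact e ▸ le_refl _
    · exact absurd (le_antisymm' h.1 (le_iff_lt_succ.2 ⟨h1, e⟩)) h.2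

theorem lt_of_succ_le {a b : M.Num} (h : a + 1 ≤ b) : a < b := by
  have h2 := lt_succ_self a
  rcases le_total' a b with h1 | h1
  · exact ⟨h1, fun e => h2.2 (le_antisymm' h2.1 (e ▸ h))⟩
  · have h3 := le_iff_lt_succ.1 h1
    exact absurd (le_antisymm' h3.1 h) h3.2

/-- The bound on `z` is there to keep the quantifier bounded, so that the induction on `y` is over a
Σ^B_0 formula. -/
theorem exists_add_of_le {x : M.Num} : ∀ y : M.Num, y ≤ x → ∃ z, z ≤ x ∧ y + z = x := by
  refine LP.induction (LP.of_formula
    (.imp (.le (.var 0) (.var 2)) (.exN 4 (.and (.le (.var 4) (.var 2))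
      (.eqN (.var 0 + .var 4) (.var 2)))))
    (.imp (.le _ _) (.bexN (by simp) (.eqN _ _)))
    (by simp [Formula.HasStrVar]) (params x 0) (fun _ => Classical.arbitrary _)
    fun b z X => by simp [params, Function.update]) ?_ ?_
  · exact fun _ => ⟨x, le_refl x, zero_add x⟩
  · intro a ih h
    obtain ⟨z, hz, e⟩ := ih (lt_of_succ_le h).1
    have hz0 : z ≠ 0 := by
      rintro rfl
      exact (lt_of_succ_le h).2 (by simpa using e)
    obtain ⟨w, rfl⟩ := exists_pred hz0
    refine ⟨w, ?_, by rw [← e]; ring⟩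
    rw [← e]
    have := le_add_right' w (a + 1)
    rwa [show w + (a + 1) = a + (w + 1) by ring] at this

theorem le_iff_add {x y : M.Num} : x ≤ y ↔ ∃ z, y = x + z :=
  ⟨fun h => (exists_add_of_le x h).imp fun _ h => h.2.symm, fun ⟨z, h⟩ => h ▸ le_add_right' x z⟩

theorem add_right_cancel' (a b : M.Num) : ∀ c : M.Num, a + c = b + c → a = b := by
  refine LP.induction (LP.of_formula
    (.imp (.eqN (.var 2 + .var 0) (.var 3 + .var 0)) (.eqN (.var 2) (.var 3)))
    (.imp (.eqN _ _) (.eqN _ _)) (by simp [Formula.HasStrVar]) (params a b)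
    (fun _ => Classical.arbitrary _) fun b z X => by simp [params]) (by simp) ?_
  intro c ih h
  rw [← add_assoc, ← add_assoc] at h
  exact ih (add_one_inj h)

end Struct

noncomputable instance : LinearOrder M.Num where
  le_refl := Struct.le_refl
  le_trans a b c h h' := by
    obtain ⟨x, rfl⟩ := Struct.le_iff_add.1 h
    obtain ⟨y, rfl⟩ := Struct.le_iff_add.1 h'
    rw [add_assoc]; exact Struct.le_add_right' _ _
  le_antisymm a b h h' := Struct.le_antisymm' h h'
  le_total := Struct.le_total'
  lt_iff_le_not_ge a b := by
    rw [Struct.lt_iff]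
    exact ⟨fun h => ⟨h.1, fun h' => h.2 (Struct.le_antisymm' h.1 h')⟩,
      fun h => ⟨h.1, fun e => h.2 (e ▸ Struct.le_refl _)⟩⟩
  toDecidableLE := Classical.decRel _

theorem Struct.add_one_le_iff {a b : M.Num} : a + 1 ≤ b ↔ a < b :=
  ⟨Struct.lt_of_succ_le, Struct.succ_le_of_lt⟩

theorem Struct.lt_add_one_iff {a b : M.Num} : a < b + 1 ↔ a ≤ b := Struct.le_iff_lt_succ.symm

instance : IsOrderedAddMonoid M.Num where
  add_le_add_left a b h c := by
    obtain ⟨x, rfl⟩ := Struct.le_iff_add.1 h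
    exact Struct.le_iff_add.2 ⟨x, by ring⟩

instance : IsOrderedCancelAddMonoid M.Num where
  le_of_add_le_add_left a b c h := by
    obtain ⟨x, hx⟩ := Struct.le_iff_add.1 h
    refine Struct.le_iff_add.2 ⟨x, Struct.add_right_cancel' _ _ a ?_⟩
    rw [add_comm c a, hx]; ring

instance : CanonicallyOrderedAdd M.Num where
  exists_add_of_le h := Struct.le_iff_add.1 h
  le_add_self a b := by rw [add_comm]; exact Struct.le_add_right' a b
  le_self_add a b := Struct.le_add_right' a b

instance : Nontrivial M.Num := ⟨⟨0, 1, fun h => Struct.add_one_ne_zero (0 : M.Num) (by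
  rw [zero_add]; exact h.symm)⟩⟩

theorem Struct.mul_lt_mul_left' {a b c : M.Num} (h : 0 < c) (hab : a < b) : c * a < c * b := by
  obtain ⟨c, rfl⟩ := Struct.exists_pred (a := c) h.ne'
  obtain ⟨x, rfl⟩ := Struct.le_iff_add.1 (Struct.add_one_le_iff.2 hab)
  rw [show (c + 1) * (a + 1 + x) = (c + 1) * a + (c * (x + 1) + x) + 1 by ring]
  exact Struct.lt_add_one_iff.2 (Struct.le_add_right' _ _)

instance : IsStrictOrderedRing M.Num where
  zero_le_one := zero_le
  mul_lt_mul_of_pos_left _ h _ _ hab := Struct.mul_lt_mul_left' h hab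
  mul_lt_mul_of_pos_right c h a b hab := by
    rw [mul_comm a, mul_comm b]; exact Struct.mul_lt_mul_left' h hab

noncomputable instance : Sub M.Num :=
  ⟨fun a b => if h : b ≤ a then (Struct.le_iff_add.1 h).choose else 0⟩

theorem Struct.add_sub_of_le' {a b : M.Num} (h : b ≤ a) : b + (a - b) = a := by
  change b + (if h : b ≤ a then (Struct.le_iff_add.1 h).choose else 0) = a
  rw [dif_pos h]
  exact (Struct.le_iff_add.1 h).choose_spec.symm

theorem Struct.sub_eq_zero_of_lt {a b : M.Num} (h : a < b) : a - b = 0 :=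
  dif_neg (not_le.2 h)

instance : OrderedSub M.Num where
  tsub_le_iff_right a b c := by
    rcases le_or_gt b a with h | h
    · rw [← add_le_add_iff_left b, Struct.add_sub_of_le' h, add_comm b c]
    · rw [Struct.sub_eq_zero_of_lt h]
      exact ⟨fun _ => h.le.trans (by rw [add_comm]; exact Struct.le_add_right' _ _), fun _ => zero_le⟩

/-- Once the predicate is replaced by a string `Y` that codes it up to `n`, the implication `a ≤ n →
a ∈ Y` is itself Σ^B_0 and ordinary induction applies to it. -/
theorem LP.induction_lt {P : M.Num → Prop} (hP : LP P) {n : M.Num} (h0 : P 0)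
    (h1 : ∀ a < n, P a → P (a + 1)) : ∀ a ≤ n, P a := by
  obtain ⟨Y, -, hY⟩ := hP.code (n + 1)
  have key : LP fun a => a ≤ n → a ∈ Y := by
    refine LP.of_formula (.imp (.le (.var 0) (.var 2)) (.mem (.var 0) 1)) (.imp (.le _ _) (.mem _ _))
      (by simp [Formula.HasStrVar]) (params n 0) (sparams Y Y) fun b z X => ?_
    simp [params, sparams]
  intro a ha
  refine (hY a (Struct.lt_add_one_iff.2 ha)).1 (key.induction (fun _ => ?_) (fun b ih hb => ?_) a ha)
  · exact (hY 0 (Struct.lt_add_one_iff.2 (zero_le))).2 h0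
  · have hbn := Struct.add_one_le_iff.1 hb
    exact (hY _ (Struct.lt_add_one_iff.2 hb)).2
      (h1 b hbn ((hY _ (Struct.lt_add_one_iff.2 hbn.le)).1 (ih hbn.le)))

/-- The extensionality axiom also asks for equal lengths. These follow, since by L1 and L2 the
length is one more than the largest element, or 0. -/
theorem Struct.ext {X Y : M.Str} (h : ∀ i : M.Num, i ∈ X ↔ i ∈ Y) : X = Y := by
  obtain ⟨-, -, -, -, -, -, -, -, -, -, -, -, l1, l2, ext⟩ := basic_all (M := M)
  have key : ∀ X Y : M.Str, (∀ i : M.Num, i ∈ X → i ∈ Y) → M.len X ≤ M.len Y := by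
    intro X Y h
    by_cases h0 : M.len X = 0
    · rw [h0]; exact zero_le
    · obtain ⟨a, ha⟩ := Struct.exists_pred h0
      rw [← ha]
      exact Struct.add_one_le_iff.2 (l1 _ _ (h _ (l2 _ _ ha)))
  exact ext X Y (le_antisymm (key X Y fun i => (h i).1) (key Y X fun i => (h i).2)) fun i _ => h i

theorem Struct.lt_len {X : M.Str} {i : M.Num} (h : i ∈ X) : i < M.len X :=
  (basic_all (M := M)).2.2.2.2.2.2.2.2.2.2.2.2.1 X i h

theorem Struct.len_le {X : M.Str} {b : M.Num} (h : ∀ i ∈ X, i < b) : M.len X ≤ b := by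
  by_cases h0 : M.len X = 0
  · rw [h0]; exact zero_le
  · obtain ⟨a, ha⟩ := Struct.exists_pred h0
    rw [← ha]
    exact Struct.add_one_le_iff.2 (h a
      ((basic_all (M := M)).2.2.2.2.2.2.2.2.2.2.2.2.2.1 X a ha))

theorem LP.exists_str {P : M.Num → Prop} (hP : LP P) (b : M.Num) :
    ∃ X : M.Str, ∀ z : M.Num, z ∈ X ↔ z < b ∧ P z := by
  obtain ⟨X, h1, h2⟩ := hP.code b
  refine ⟨X, fun z => ⟨fun h => ?_, fun h => (h2 z h.1).2 h.2⟩⟩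
  have hz := (Struct.lt_len h).trans_le h1
  exact ⟨hz, (h2 z hz).1 h⟩

end Num

/-! ### Pairing, and closure properties of locally coded predicates and functions -/

section Definable
variable {M : Struct.{u}}

/-- The pairing function on the numbers of a model. -/
def kpair (x y : M.Num) : M.Num := (x + y) * (x + y + 1) + (y + y)

@[simp] theorem eval_pair (ρ : ℕ → M.Num) (σ : ℕ → M.Str) (s t : Term) :
    (pair s t).eval M ρ σ = kpair (s.eval M ρ σ) (t.eval M ρ σ) := rfl

@[simp] theorem hasStrVar_pair (x : ℕ) (s t : Term) :
    (pair s t).HasStrVar x ↔ s.HasStrVar x ∨ t.HasStrVar x := by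
  simp [pair]

variable [VModel M]

theorem kpair_mono {x y x' y' : M.Num} (hx : x ≤ x') (hy : y ≤ y') : kpair x y ≤ kpair x' y' := by
  unfold kpair; gcongr

theorem le_kpair_left (x y : M.Num) : x ≤ kpair x y := by
  rw [show kpair x y = x + ((x + y) * (x + y) + (y + (y + y))) by unfold kpair; ring]
  exact le_self_add

theorem le_kpair_right (x y : M.Num) : y ≤ kpair x y := by
  rw [show kpair x y = y + ((x + y) * (x + y) + (x + (y + y))) by unfold kpair; ring]
  exact le_self_add

/-- On pairs with sum `s` the pairing function stays between `s(s+1)` and `s(s+1) + 2s`, which is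
less than `(s+1)(s+2)`. So the code determines the sum, and then the difference of the code and
`s(s+1)` determines the second component. -/
theorem kpair_sum_le {x y x' y' : M.Num} (h : kpair x y = kpair x' y') : x' + y' ≤ x + y := by
  by_contra hlt
  rw [not_le] at hlt
  have h1 := Struct.add_one_le_iff.2 hlt
  have h2 : kpair x y < kpair x' y' := by
    calc kpair x y ≤ (x + y) * (x + y + 1) + ((x + y) + (x + y)) := by
          unfold kpair; gcongr <;> exact le_add_self
      _ < (x + y + 1) * (x + y + 1 + 1) := by
          rw [show (x + y + 1) * (x + y + 1 + 1) =
            (x + y) * (x + y + 1) + ((x + y) + (x + y)) + 1 + 1 by ring]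
          exact (Struct.lt_succ_self _).trans (Struct.lt_succ_self _)
      _ ≤ (x' + y') * (x' + y' + 1) := by gcongr
      _ ≤ kpair x' y' := le_self_add
  exact h2.ne h

theorem kpair_inj {x y x' y' : M.Num} : kpair x y = kpair x' y' ↔ x = x' ∧ y = y' := by
  refine ⟨fun h => ?_, fun h => by rw [h.1, h.2]⟩
  have hs : x + y = x' + y' := le_antisymm (kpair_sum_le h.symm) (kpair_sum_le h)
  have h2 : y + y = y' + y' := by
    unfold kpair at h
    rw [hs] at h
    exact add_left_cancel h
  have hy : y = y' := by
    rcases lt_trichotomy y y' with h | h | h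
    · exact absurd h2 (add_lt_add h h).ne
    · exact h
    · exact absurd h2 (add_lt_add h h).ne'
  subst hy
  exact ⟨add_right_cancel hs, rfl⟩

theorem kpair_lt {x y x' y' : M.Num} (hx : x < x') (hy : y ≤ y') : kpair x y < kpair x' y' := by
  refine lt_of_lt_of_le ?_ (kpair_mono (Struct.add_one_le_iff.2 hx) hy)
  rw [show kpair (x + 1) y = kpair x y + ((x + y + 1) + (x + y)) + 1 by unfold kpair; ring]
  exact Struct.lt_add_one_iff.2 le_self_add

open Classical in
/-- First component of a pair (`0` for non-pairs). -/
noncomputable def fst (c : M.Num) : M.Num := if h : ∃ x y, c = kpair x y then h.choose else 0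

open Classical in
/-- Second component of a pair (`0` for non-pairs). -/
noncomputable def snd (c : M.Num) : M.Num :=
  if h : ∃ x y, c = kpair x y then h.choose_spec.choose else 0

@[simp] theorem fst_kpair (x y : M.Num) : fst (kpair x y) = x := by
  have h : ∃ x' y', kpair x y = kpair x' y' := ⟨x, y, rfl⟩
  unfold fst
  rw [dif_pos h]
  exact (kpair_inj.1 h.choose_spec.choose_spec).1.symm

@[simp] theorem snd_kpair (x y : M.Num) : snd (kpair x y) = y := by
  have h : ∃ x' y', kpair x y = kpair x' y' := ⟨x, y, rfl⟩
  unfold snd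
  rw [dif_pos h]
  exact (kpair_inj.1 h.choose_spec.choose_spec).2.symm

/-- All quantifiers on the right are bounded by `c`, which makes the graph of `fst` Σ^B_0. The
second alternative is the default value at numbers that are not pairs. -/
theorem fst_eq_iff (c y : M.Num) : fst c = y ↔ (∃ x, x ≤ c ∧ c = kpair y x) ∨
    (y = 0 ∧ ¬ ∃ a, a ≤ c ∧ ∃ b, b ≤ c ∧ c = kpair a b) := by
  by_cases h : ∃ a b, c = kpair a b
  · obtain ⟨a, b, rfl⟩ := h
    have : ∃ a', a' ≤ kpair a b ∧ ∃ b', b' ≤ kpair a b ∧ kpair a b = kpair a' b' :=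
      ⟨a, le_kpair_left _ _, b, le_kpair_right _ _, rfl⟩
    simp only [fst_kpair, kpair_inj]
    exact ⟨fun h => Or.inl ⟨b, le_kpair_right _ _, h, rfl⟩, fun h => by
      rcases h with ⟨_, _, h, _⟩ | ⟨_, h⟩
      exacts [h, absurd ⟨a, le_kpair_left _ _, b, le_kpair_right _ _, rfl, rfl⟩ h]⟩
  · have h1 : fst c = 0 := dif_neg h
    have h2 : ¬ ∃ a, a ≤ c ∧ ∃ b, b ≤ c ∧ c = kpair a b := by
      rintro ⟨a, -, b, -, e⟩; exact h ⟨a, b, e⟩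
    have h3 : ¬ ∃ x, x ≤ c ∧ c = kpair y x := by
      rintro ⟨a, -, e⟩; exact h ⟨y, a, e⟩
    simp [h1, h2, h3, eq_comm]

theorem snd_eq_iff (c y : M.Num) : snd c = y ↔ (∃ x, x ≤ c ∧ c = kpair x y) ∨
    (y = 0 ∧ ¬ ∃ a, a ≤ c ∧ ∃ b, b ≤ c ∧ c = kpair a b) := by
  by_cases h : ∃ a b, c = kpair a b
  · obtain ⟨a, b, rfl⟩ := h
    have : ∃ a', a' ≤ kpair a b ∧ ∃ b', b' ≤ kpair a b ∧ kpair a b = kpair a' b' :=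
      ⟨a, le_kpair_left _ _, b, le_kpair_right _ _, rfl⟩
    simp only [snd_kpair, kpair_inj]
    exact ⟨fun h => Or.inl ⟨a, le_kpair_left _ _, rfl, h⟩, fun h => by
      rcases h with ⟨_, _, _, h⟩ | ⟨_, h⟩
      exacts [h, absurd ⟨a, le_kpair_left _ _, b, le_kpair_right _ _, rfl, rfl⟩ h]⟩
  · have h1 : snd c = 0 := dif_neg h
    have h2 : ¬ ∃ a, a ≤ c ∧ ∃ b, b ≤ c ∧ c = kpair a b := by
      rintro ⟨a, -, b, -, e⟩; exact h ⟨a, b, e⟩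
    have h3 : ¬ ∃ x, x ≤ c ∧ c = kpair x y := by
      rintro ⟨a, -, e⟩; exact h ⟨a, y, e⟩
    simp [h1, h2, h3, eq_comm]

theorem fst_le (c : M.Num) : fst c ≤ c := by
  rcases (fst_eq_iff c _).1 rfl with ⟨x, -, h⟩ | ⟨h, -⟩
  · exact (le_kpair_left (fst c) x).trans h.ge
  · rw [h]; exact zero_le

theorem snd_le (c : M.Num) : snd c ≤ c := by
  rcases (snd_eq_iff c _).1 rfl with ⟨x, -, h⟩ | ⟨h, -⟩
  · exact (le_kpair_right x (snd c)).trans h.ge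
  · rw [h]; exact zero_le

/-- `t` is locally bounded, and its graph is locally coded by strings. -/
class LF (t : M.Num → M.Num) : Prop where
  bdd : ∀ N, ∃ B, ∀ c < N, t c ≤ B
  graph : ∀ N, ∃ G : M.Str, ∀ y < N, ∀ c < N, (kpair y c ∈ G ↔ t c = y)

/-- A binary relation is coded by the set of its pairs; the names 10 and 11 are reserved for the two
arguments. -/
theorem exists_graph (R : M.Num → M.Num → Prop) (φ : Formula) (hφ : φ.IsSigma0)
    (hX : ¬ φ.HasStrVar 0) (ρ : ℕ → M.Num) (σ : ℕ → M.Str)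
    (h : ∀ b z y c X, φ.Sat M (Function.update (Function.update (Function.update
      (Function.update ρ 1 b) 0 z) 10 y) 11 c) (Function.update σ 0 X) ↔ R y c) (N : M.Num) :
    ∃ G : M.Str, ∀ y < N, ∀ c < N, (kpair y c ∈ G ↔ R y c) := by
  obtain ⟨G, -, hG⟩ := comprehension (M := M)
    (.exN 10 (.and (.le (.var 10) (.var 0)) (.exN 11 (.and (.le (.var 11) (.var 0))
      (.and (.eqN (.var 0) (pair (.var 10) (.var 11))) φ)))))
    (.bexN (by simp) (.bexN (by simp) (.and (.eqN _ _) hφ)))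
    (by simp [Formula.HasStrVar, hX]) ρ σ (kpair N N)
  refine ⟨G, fun y hy c hc => ?_⟩
  have hlt : kpair y c < kpair N N := kpair_lt hy hc.le
  rw [hG _ hlt]
  simp only [sat_exN, sat_and, sat_le, sat_eqN, h, eval_var, eval_pair]
  simp only [Function.update_self, ne_eq, kpair_inj, not_false_eq_true,
    Function.update_of_ne, OfNat.zero_ne_ofNat, Nat.reduceEqDiff]
  constructor
  · rintro ⟨a, -, b, -, ⟨rfl, rfl⟩, h⟩; exact h
  · exact fun h => ⟨y, le_kpair_left _ _, c, le_kpair_right _ _, ⟨rfl, rfl⟩, h⟩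

/-- The mechanism behind the closure properties: below each bound, the ingredients are replaced by
strings that code them, and what remains is a Σ^B_0 formula with these strings as parameters. -/
theorem LP.of_local {P : M.Num → Prop}
    (h : ∀ b, ∃ P' : M.Num → Prop, LP P' ∧ ∀ z < b, (P' z ↔ P z)) : LP P := by
  refine ⟨fun b => ?_⟩
  obtain ⟨P', hP', e⟩ := h b
  obtain ⟨X, h1, h2⟩ := hP'.code b
  exact ⟨X, h1, fun z hz => (h2 z hz).trans (e z hz)⟩

theorem LP.congr {P Q : M.Num → Prop} (hP : LP P) (h : ∀ z, P z ↔ Q z) : LP Q :=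
  (funext fun z => propext (h z) : P = Q) ▸ hP

instance LP.const_mem (X : M.Str) : LP fun z => z ∈ X :=
  LP.of_formula (.mem (.var 0) 1) (.mem _ _) (by simp [Formula.HasStrVar]) (params 0 0) (sparams X X)
    fun b z Y => by simp [sparams]

instance LP.not {P : M.Num → Prop} [hP : LP P] : LP fun z => ¬ P z := by
  refine LP.of_local fun b => ?_
  obtain ⟨X, -, hX⟩ := hP.code b
  refine ⟨fun z => z ∉ X, LP.of_formula (.not (.mem (.var 0) 1)) (.not (.mem _ _))
    (by simp [Formula.HasStrVar]) (params 0 0) (sparams X X) fun b z Y => by simp [sparams],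
    fun z hz => not_congr (hX z hz)⟩

instance LP.and {P Q : M.Num → Prop} [hP : LP P] [hQ : LP Q] : LP fun z => P z ∧ Q z := by
  refine LP.of_local fun b => ?_
  obtain ⟨X, -, hX⟩ := hP.code b
  obtain ⟨Y, -, hY⟩ := hQ.code b
  refine ⟨fun z => z ∈ X ∧ z ∈ Y, LP.of_formula (.and (.mem (.var 0) 1) (.mem (.var 0) 2))
    (.and (.mem _ _) (.mem _ _))
    (by simp [Formula.HasStrVar]) (params 0 0) (sparams X Y) fun b z Y => by simp [sparams],
    fun z hz => and_congr (hX z hz) (hY z hz)⟩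

instance LP.or {P Q : M.Num → Prop} [LP P] [LP Q] : LP fun z => P z ∨ Q z :=
  LP.congr (P := fun z => ¬ (¬ P z ∧ ¬ Q z)) inferInstance fun z => by tauto

instance LP.imp {P Q : M.Num → Prop} [LP P] [LP Q] : LP fun z => P z → Q z :=
  LP.congr (P := fun z => ¬ (P z ∧ ¬ Q z)) inferInstance fun z => by tauto

instance LP.iff {P Q : M.Num → Prop} [LP P] [LP Q] : LP fun z => P z ↔ Q z :=
  LP.congr (P := fun z => (P z → Q z) ∧ (Q z → P z)) inferInstance fun z => by tauto

theorem LP.comp {P : M.Num → Prop} (hP : LP P) (t : M.Num → M.Num) [ht : LF t] :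
    LP fun c => P (t c) := by
  refine LP.of_local fun b => ?_
  obtain ⟨B, hB⟩ := ht.bdd b
  obtain ⟨G, hG⟩ := ht.graph (max b (B + 1))
  obtain ⟨X, -, hX⟩ := hP.code (B + 1)
  refine ⟨fun z => ∃ y, y ≤ B ∧ kpair y z ∈ G ∧ y ∈ X,
    LP.of_formula (.exN 4 (.and (.le (.var 4) (.var 2))
      (.and (.mem (pair (.var 4) (.var 0)) 1) (.mem (.var 4) 2))))
    (.bexN (by simp) (.and (.mem _ _) (.mem _ _)))
    (by simp [Formula.HasStrVar]) (params B B) (sparams G X)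
    fun b z Y => by simp [sparams, params, Function.update], fun z hz => ?_⟩
  have hz' : z < max b (B + 1) := lt_max_of_lt_left hz
  constructor
  · rintro ⟨y, hy, h1, h2⟩
    have hy' := Struct.lt_add_one_iff.2 hy
    rw [(hG y (lt_max_of_lt_right hy') z hz').1 h1]
    exact (hX _ hy').1 h2
  · intro h
    have hy' := Struct.lt_add_one_iff.2 (hB z hz)
    exact ⟨t z, hB z hz, (hG _ (lt_max_of_lt_right hy') z hz').2 rfl, (hX _ hy').2 h⟩

theorem LF.comp {s t : M.Num → M.Num} (hs : LF s) (ht : LF t) : LF fun c => s (t c) := by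
  refine ⟨fun N => ?_, fun N => ?_⟩
  · obtain ⟨B, hB⟩ := ht.bdd N
    obtain ⟨B', hB'⟩ := hs.bdd (B + 1)
    exact ⟨B', fun c hc => hB' _ (Struct.lt_add_one_iff.2 (hB c hc))⟩
  · obtain ⟨B, hB⟩ := ht.bdd N
    obtain ⟨G, hG⟩ := ht.graph (max N (B + 1))
    obtain ⟨H, hH⟩ := hs.graph (max N (B + 1))
    obtain ⟨E, hE⟩ := exists_graph (fun y c => ∃ a, a ≤ B ∧ kpair a c ∈ G ∧ kpair y a ∈ H)
      (.exN 4 (.and (.le (.var 4) (.var 2)) (.and (.mem (pair (.var 4) (.var 11)) 1)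
        (.mem (pair (.var 10) (.var 4)) 2))))
      (.bexN (by simp) (.and (.mem _ _) (.mem _ _))) (by simp [Formula.HasStrVar]) (params B B)
      (sparams G H) (fun b z y c X => by simp [sparams, params, Function.update]) N
    refine ⟨E, fun y hy c hc => (hE y hy c hc).trans ⟨?_, ?_⟩⟩
    · rintro ⟨a, ha, h1, h2⟩
      have ha' : a < max N (B + 1) := lt_max_of_lt_right (Struct.lt_add_one_iff.2 ha)
      rw [(hG a ha' c (lt_max_of_lt_left hc)).1 h1]
      exact (hH y (lt_max_of_lt_left hy) a ha').1 h2
    · intro h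
      have ha' : t c < max N (B + 1) := lt_max_of_lt_right (Struct.lt_add_one_iff.2 (hB c hc))
      exact ⟨t c, hB c hc, (hG _ ha' c (lt_max_of_lt_left hc)).2 rfl,
        (hH y (lt_max_of_lt_left hy) _ ha').2 h⟩

/-- Monotonicity of the operation turns bounds for the arguments into a bound for the value. The
graph quantifies over the values of the arguments, within their bounds. -/
theorem LF.op {s t : M.Num → M.Num} (hs : LF s) (ht : LF t) (f : M.Num → M.Num → M.Num)
    (τ : Term) (hτ : ¬ τ.HasStrVar 0)
    (hf : ∀ ρ σ, τ.eval M ρ σ = f (ρ 4) (ρ 5))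
    (hm : ∀ a b a' b', a ≤ a' → b ≤ b' → f a b ≤ f a' b') : LF fun c => f (s c) (t c) := by
  refine ⟨fun N => ?_, fun N => ?_⟩
  · obtain ⟨B, hB⟩ := hs.bdd N
    obtain ⟨B', hB'⟩ := ht.bdd N
    exact ⟨f B B', fun c hc => hm _ _ _ _ (hB c hc) (hB' c hc)⟩
  · obtain ⟨B, hB⟩ := hs.bdd N
    obtain ⟨B', hB'⟩ := ht.bdd N
    obtain ⟨G, hG⟩ := hs.graph (max N (B + 1))
    obtain ⟨H, hH⟩ := ht.graph (max N (B' + 1))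
    obtain ⟨E, hE⟩ := exists_graph (fun y c => ∃ a, a ≤ B ∧ ∃ b, b ≤ B' ∧
        kpair a c ∈ G ∧ kpair b c ∈ H ∧ y = f a b)
      (.exN 4 (.and (.le (.var 4) (.var 2)) (.exN 5 (.and (.le (.var 5) (.var 3))
        (.and (.mem (pair (.var 4) (.var 11)) 1)
        (.and (.mem (pair (.var 5) (.var 11)) 2) (.eqN (.var 10) τ)))))))
      (.bexN (by simp) (.bexN (by simp) (.and (.mem _ _) (.and (.mem _ _) (.eqN _ _)))))
      (by simp [Formula.HasStrVar, hτ]) (params B B')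
      (sparams G H) (fun b z y c X => by simp [sparams, params, Function.update, hf]) N
    refine ⟨E, fun y hy c hc => (hE y hy c hc).trans ⟨?_, ?_⟩⟩
    · rintro ⟨a, ha, b, hb, h1, h2, rfl⟩
      rw [(hG a (lt_max_of_lt_right (Struct.lt_add_one_iff.2 ha)) c (lt_max_of_lt_left hc)).1 h1,
        (hH b (lt_max_of_lt_right (Struct.lt_add_one_iff.2 hb)) c (lt_max_of_lt_left hc)).1 h2]
    · intro h
      exact ⟨s c, hB c hc, t c, hB' c hc,
        (hG _ (lt_max_of_lt_right (Struct.lt_add_one_iff.2 (hB c hc))) c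
          (lt_max_of_lt_left hc)).2 rfl,
        (hH _ (lt_max_of_lt_right (Struct.lt_add_one_iff.2 (hB' c hc))) c
          (lt_max_of_lt_left hc)).2 rfl, h.symm⟩

instance LF.add {s t : M.Num → M.Num} [hs : LF s] [ht : LF t] : LF fun c => s c + t c :=
  hs.op ht (· + ·) (.var 4 + .var 5) (by simp) (fun _ _ => rfl) fun _ _ _ _ => add_le_add

instance LF.kpair_comp {s t : M.Num → M.Num} [hs : LF s] [ht : LF t] :
    LF fun c => kpair (s c) (t c) :=
  hs.op ht _ (pair (.var 4) (.var 5)) (by simp) (fun _ _ => rfl) fun _ _ _ _ => kpair_mono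

instance LF.id : LF fun c : M.Num => c := by
  refine ⟨fun N => ⟨N, fun c hc => hc.le⟩, fun N => ?_⟩
  exact exists_graph (fun y c => c = y) (.eqN (.var 11) (.var 10)) (.eqN _ _)
    (by simp [Formula.HasStrVar]) (params 0 0) (fun _ => Classical.arbitrary _)
    (fun b z y c X => by simp [Function.update]) N

instance (priority := low) LF.const (a : M.Num) : LF fun _ : M.Num => a := by
  refine ⟨fun N => ⟨a, fun c hc => le_rfl⟩, fun N => ?_⟩
  exact exists_graph (fun y c => a = y) (.eqN (.var 2) (.var 10)) (.eqN _ _)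
    (by simp [Formula.HasStrVar]) (params a 0) (fun _ => Classical.arbitrary _)
    (fun b z y c X => by simp [Function.update, params]) N

instance LF.fst_comp {t : M.Num → M.Num} [ht : LF t] : LF fun c => fst (t c) := by
  refine LF.comp ⟨fun N => ⟨N, fun c hc => (fst_le c).trans hc.le⟩, fun N => ?_⟩ ht
  simp only [fst_eq_iff]
  exact exists_graph _ (.or (.exN 4 (.and (.le (.var 4) (.var 11)) (.eqN (.var 11)
      (pair (.var 10) (.var 4))))) (.and (.eqN (.var 10) 0) (.not
      (.exN 4 (.and (.le (.var 4) (.var 11)) (.exN 5 (.and (.le (.var 5) (.var 11))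
        (.eqN (.var 11) (pair (.var 4) (.var 5))))))))))
    (.or (.bexN (by simp) (.eqN _ _)) (.and (.eqN _ _) (.not (.bexN (by simp) (.bexN (by simp)
      (.eqN _ _)))))) (by simp [Formula.HasStrVar]) (params 0 0)
    (fun _ => Classical.arbitrary _) (fun b z y c X => by simp [Function.update]) N

instance LF.snd_comp {t : M.Num → M.Num} [ht : LF t] : LF fun c => snd (t c) := by
  refine LF.comp ⟨fun N => ⟨N, fun c hc => (snd_le c).trans hc.le⟩, fun N => ?_⟩ ht
  simp only [snd_eq_iff]
  exact exists_graph _ (.or (.exN 4 (.and (.le (.var 4) (.var 11)) (.eqN (.var 11)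
      (pair (.var 4) (.var 10))))) (.and (.eqN (.var 10) 0) (.not
      (.exN 4 (.and (.le (.var 4) (.var 11)) (.exN 5 (.and (.le (.var 5) (.var 11))
        (.eqN (.var 11) (pair (.var 4) (.var 5))))))))))
    (.or (.bexN (by simp) (.eqN _ _)) (.and (.eqN _ _) (.not (.bexN (by simp) (.bexN (by simp)
      (.eqN _ _)))))) (by simp [Formula.HasStrVar]) (params 0 0)
    (fun _ => Classical.arbitrary _) (fun b z y c X => by simp [Function.update]) N

instance LF.fst_self : LF (fst : M.Num → M.Num) := LF.fst_comp (t := fun c => c)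

instance LF.snd_self : LF (snd : M.Num → M.Num) := LF.snd_comp (t := fun c => c)

instance LP.le {s t : M.Num → M.Num} [hs : LF s] [ht : LF t] : LP fun c => s c ≤ t c := by
  refine LP.of_local fun N => ?_
  obtain ⟨B, hB⟩ := hs.bdd N
  obtain ⟨B', hB'⟩ := ht.bdd N
  obtain ⟨G, hG⟩ := hs.graph (max N (B + 1))
  obtain ⟨H, hH⟩ := ht.graph (max N (B' + 1))
  refine ⟨fun c => ∃ a, a ≤ B ∧ ∃ b, b ≤ B' ∧ kpair a c ∈ G ∧ kpair b c ∈ H ∧ a ≤ b,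
    LP.of_formula
    (.exN 4 (.and (.le (.var 4) (.var 2)) (.exN 5 (.and (.le (.var 5) (.var 3))
      (.and (.mem (pair (.var 4) (.var 0)) 1)
      (.and (.mem (pair (.var 5) (.var 0)) 2) (.le (.var 4) (.var 5))))))))
    (.bexN (by simp) (.bexN (by simp) (.and (.mem _ _) (.and (.mem _ _) (.le _ _)))))
    (by simp [Formula.HasStrVar]) (params B B')
    (sparams G H) (fun b z X => by simp [sparams, params, Function.update]), fun c hc => ⟨?_, ?_⟩⟩
  · rintro ⟨a, ha, b, hb, h1, h2, h⟩
    rwa [(hG a (lt_max_of_lt_right (Struct.lt_add_one_iff.2 ha)) c (lt_max_of_lt_left hc)).1 h1,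
      (hH b (lt_max_of_lt_right (Struct.lt_add_one_iff.2 hb)) c (lt_max_of_lt_left hc)).1 h2]
  · intro h
    exact ⟨s c, hB c hc, t c, hB' c hc,
      (hG _ (lt_max_of_lt_right (Struct.lt_add_one_iff.2 (hB c hc))) c
        (lt_max_of_lt_left hc)).2 rfl,
      (hH _ (lt_max_of_lt_right (Struct.lt_add_one_iff.2 (hB' c hc))) c
        (lt_max_of_lt_left hc)).2 rfl, h⟩

instance LP.eq {s t : M.Num → M.Num} [LF s] [LF t] : LP fun c => s c = t c :=
  LP.congr (P := fun c => s c ≤ t c ∧ t c ≤ s c) inferInstance fun _ => le_antisymm_iff.symm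

instance LP.lt {s t : M.Num → M.Num} [LF s] [LF t] : LP fun c => s c < t c :=
  LP.congr (P := fun c => ¬ t c ≤ s c) inferInstance fun _ => not_le

instance (priority := low) LP.const (p : Prop) : LP fun _ : M.Num => p := by
  by_cases h : p
  · exact LP.congr (P := fun c : M.Num => c ≤ c) inferInstance fun _ => by simp [h]
  · exact LP.congr (P := fun c : M.Num => ¬ c ≤ c) inferInstance fun _ => by simp [h]

instance LP.const_mem_comp {t : M.Num → M.Num} [LF t] (X : M.Str) : LP fun z => t z ∈ X :=
  (LP.const_mem X).comp t

/-- A predicate of two variables is presented as a predicate of one code, with the inner variable as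
first component and the outer one as second. The same convention is used for all families with
several indices. -/
instance LP.bex {P : M.Num → M.Num → Prop} {t : M.Num → M.Num} [ht : LF t]
    [hP : LP fun d => P (snd d) (fst d)] :
    LP fun c => ∃ y, y ≤ t c ∧ P c y := by
  refine LP.of_local fun N => ?_
  obtain ⟨B, hB⟩ := ht.bdd N
  have hQ : LP fun d => fst d ≤ t (snd d) ∧
      P (snd d) (fst d) := by
    have : LF fun d => t (snd d) := ht.comp inferInstance
    infer_instance
  obtain ⟨X, -, hX⟩ := hQ.code (kpair B N + 1)
  refine ⟨fun z => ∃ y, y ≤ B ∧ kpair y z ∈ X,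
    LP.of_formula (.exN 4 (.and (.le (.var 4) (.var 2)) (.mem (pair (.var 4) (.var 0)) 1)))
    (.bexN (by simp) (.mem _ _))
    (by simp [Formula.HasStrVar]) (params B B) (sparams X X)
    fun b z Y => by simp [sparams, params, Function.update], fun z hz => ?_⟩
  have key : ∀ y ≤ B, (kpair y z ∈ X ↔ y ≤ t z ∧ P z y) := fun y hy => by
    rw [hX _ (Struct.lt_add_one_iff.2 (kpair_mono hy hz.le)), fst_kpair, snd_kpair]
  constructor
  · rintro ⟨y, hy, h⟩
    exact ⟨y, (key y hy).1 h⟩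
  · rintro ⟨y, hy, h⟩
    exact ⟨y, hy.trans (hB z hz), (key y (hy.trans (hB z hz))).2 ⟨hy, h⟩⟩

instance LP.bex_lt {P : M.Num → M.Num → Prop} {t : M.Num → M.Num} [ht : LF t]
    [hP : LP fun d => P (snd d) (fst d)] :
    LP fun c => ∃ y, y < t c ∧ P c y := by
  have : LF fun d => t (snd d) := ht.comp inferInstance
  exact LP.congr (P := fun c => ∃ y, y ≤ t c ∧ (y < t c ∧ P c y)) inferInstance fun _ =>
    exists_congr fun y => ⟨fun h => h.2, fun h => ⟨h.1.le, h⟩⟩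

instance LP.ball {P : M.Num → M.Num → Prop} {t : M.Num → M.Num} [ht : LF t]
    [hP : LP fun d => P (snd d) (fst d)] :
    LP fun c => ∀ y, y ≤ t c → P c y :=
  LP.congr (P := fun c => ¬ ∃ y, y ≤ t c ∧ ¬ P c y) inferInstance fun _ => by simp

instance LP.ball_lt {P : M.Num → M.Num → Prop} {t : M.Num → M.Num} [ht : LF t]
    [hP : LP fun d => P (snd d) (fst d)] :
    LP fun c => ∀ y, y < t c → P c y :=
  LP.congr (P := fun c => ¬ ∃ y, y < t c ∧ ¬ P c y) inferInstance fun _ => by simp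

/-- For functions given by a case distinction or implicitly, such as truncated subtraction, the
graph is easier to describe than the value. -/
theorem LF.of_graph {t : M.Num → M.Num}
    (h : LP fun d => t (snd d) = fst d)
    (hb : ∀ N, ∃ B, ∀ c < N, t c ≤ B) : LF t := by
  refine ⟨hb, fun N => ?_⟩
  obtain ⟨X, -, hX⟩ := h.code (kpair N N + 1)
  refine ⟨X, fun y hy c hc => ?_⟩
  rw [hX _ (Struct.lt_add_one_iff.2 (kpair_mono hy.le hc.le)), fst_kpair, snd_kpair]

open Classical in
instance LF.ite {P : M.Num → Prop} {s t : M.Num → M.Num} [hP : LP P] [hs : LF s] [ht : LF t]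
    [∀ c, Decidable (P c)] : LF fun c => if P c then s c else t c := by
  refine LF.of_graph ?_ fun N => ?_
  · have h1 : LF fun d => s (snd d) := hs.comp inferInstance
    have h2 : LF fun d => t (snd d) := ht.comp inferInstance
    have h3 : LP fun d => P (snd d) := hP.comp _
    refine LP.congr (P := fun d => (P (snd d) ∧ s (snd d) =
      fst d) ∨ (¬ P (snd d) ∧ t (snd d) =
      fst d)) inferInstance fun d => ?_
    by_cases h : P (snd d) <;> simp [h]
  · obtain ⟨B, hB⟩ := hs.bdd N
    obtain ⟨B', hB'⟩ := ht.bdd N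
    refine ⟨max B B', fun c hc => ?_⟩
    by_cases h : P c
    · simpa [h] using Or.inl (hB c hc)
    · simpa [h] using Or.inr (hB' c hc)

instance LF.sub {s t : M.Num → M.Num} [hs : LF s] [ht : LF t] : LF fun c => s c - t c := by
  have h1 : LF fun d => s (snd d) := hs.comp inferInstance
  have h2 : LF fun d => t (snd d) := ht.comp inferInstance
  refine LF.of_graph (LP.congr (P := fun d =>
    (s (snd d) ≤ t (snd d) ∧ fst d = 0) ∨
    (t (snd d) ≤ s (snd d) ∧
      t (snd d) + fst d = s (snd d))) inferInstance
      fun d => ?_) fun N => ?_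
  · generalize s (snd d) = a, t (snd d) = b, fst d = y
    constructor
    · rintro (⟨h, rfl⟩ | ⟨h, rfl⟩)
      · exact tsub_eq_zero_of_le h
      · exact add_tsub_cancel_left _ _
    · rintro rfl
      rcases le_total a b with h | h
      · exact Or.inl ⟨h, tsub_eq_zero_of_le h⟩
      · exact Or.inr ⟨h, add_tsub_cancel_of_le h⟩
  · obtain ⟨B, hB⟩ := hs.bdd N
    exact ⟨B, fun c hc => tsub_le_self.trans (hB c hc)⟩

instance LF.kpair_left (a : M.Num) : LF (kpair a) := LF.kpair_comp (s := fun _ => a) (t := fun c => c)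
instance LF.add_left (a : M.Num) : LF (HAdd.hAdd a) := LF.add (s := fun _ => a) (t := fun c => c)
instance LF.sub_left (a : M.Num) : LF (HSub.hSub a) := LF.sub (s := fun _ => a) (t := fun c => c)

end Definable

/-! ## Strings as binary numbers -/

section Strings
variable {M : Struct.{u}} [VModel M]

open Classical in
/-- The string `{z < b | P z}`. -/
noncomputable def mkS (P : M.Num → Prop) (b : M.Num) : M.Str :=
  if h : LP P then (h.exists_str b).choose else Classical.arbitrary _

theorem mem_mkS {P : M.Num → Prop} [h : LP P] {b z : M.Num} : z ∈ mkS P b ↔ z < b ∧ P z := by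
  unfold mkS
  rw [dif_pos h]
  exact (h.exists_str b).choose_spec z

namespace Struct

/-- The row `X^[c]`. -/
noncomputable def row (X : M.Str) (c : M.Num) : M.Str := mkS (fun j => kpair c j ∈ X) (M.len X)

theorem mem_row {X : M.Str} {c j : M.Num} : j ∈ row X c ↔ kpair c j ∈ X := by
  rw [row, mem_mkS]
  exact ⟨fun h => h.2, fun h => ⟨(le_kpair_right c j).trans_lt (lt_len h), h⟩⟩

theorem len_row_le (X : M.Str) (c : M.Num) : M.len (row X c) ≤ M.len X :=
  len_le fun _ hj => (mem_mkS.1 hj).1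

end Struct

open Struct

/-- `s` is locally coded as the sequence of the rows of a string. -/
class LS (s : M.Num → M.Str) : Prop where
  code : ∀ N, ∃ X : M.Str, ∀ c < N, row X c = s c

theorem LS.comp {s : M.Num → M.Str} (hs : LS s) (t : M.Num → M.Num) [ht : LF t] :
    LS fun c => s (t c) := by
  refine ⟨fun N => ?_⟩
  obtain ⟨B, hB⟩ := ht.bdd N
  obtain ⟨X, hX⟩ := hs.code (B + 1)
  refine ⟨mkS (fun d => kpair (t (fst d)) (snd d) ∈ X) (kpair N (M.len X)), fun c hc => ?_⟩
  have ht' : LF fun d => t (fst d) := ht.comp inferInstance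
  rw [← hX _ (lt_add_one_iff.2 (hB c hc))]
  refine Struct.ext fun j => ?_
  rw [mem_row, mem_mkS, mem_row, fst_kpair, snd_kpair]
  refine ⟨fun h => h.2, fun h => ⟨?_, h⟩⟩
  have hj : j < M.len X := (le_kpair_right _ _).trans_lt (lt_len h)
  exact kpair_lt hc hj.le

instance LP.mem {s : M.Num → M.Str} {t : M.Num → M.Num} [hs : LS s] [ht : LF t] :
    LP fun c => t c ∈ s c := by
  refine LP.of_local fun N => ?_
  obtain ⟨X, hX⟩ := hs.code N
  refine ⟨fun c => kpair c (t c) ∈ X, inferInstance, fun c hc => ?_⟩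
  beta_reduce
  rw [← mem_row, hX c hc]

theorem LS.len_bdd {s : M.Num → M.Str} (hs : LS s) : ∀ N, ∃ B, ∀ c < N, M.len (s c) ≤ B := by
  intro N
  obtain ⟨X, hX⟩ := hs.code N
  exact ⟨M.len X, fun c hc => hX c hc ▸ len_row_le X c⟩

/-- The bits at all positions form a predicate of pairs. The local bound on the lengths confines the
relevant pairs to an initial segment, so one string holds all the rows. -/
theorem LS.of_bits {s : M.Num → M.Str} (h : LP fun d => fst d ∈ s (snd d))
    (hb : ∀ N, ∃ B, ∀ c < N, M.len (s c) ≤ B) : LS s := by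
  refine ⟨fun N => ?_⟩
  obtain ⟨B, hB⟩ := hb N
  have h' : LP fun d => snd d ∈ s (fst d) :=
    LP.congr (h.comp fun d => kpair (snd d) (fst d)) fun d => by simp
  refine ⟨mkS (fun d => snd d ∈ s (fst d)) (kpair N B), fun c hc => Struct.ext fun j => ?_⟩
  rw [mem_row, mem_mkS, fst_kpair, snd_kpair]
  refine ⟨fun h => h.2, fun h => ⟨?_, h⟩⟩
  have hj : j < B := (lt_len h).trans_le (hB c hc)
  exact kpair_lt hc hj.le

instance (priority := low) LS.const (X : M.Str) : LS fun _ : M.Num => X :=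
  LS.of_bits inferInstance fun _ => ⟨M.len X, fun _ _ => le_rfl⟩

instance LS.row_comp {s : M.Num → M.Str} {t : M.Num → M.Num} [hs : LS s] [LF t] :
    LS fun c => row (s c) (t c) := by
  refine LS.of_bits ?_ fun N => ?_
  · simp only [mem_row]
    have := hs.comp (snd : M.Num → M.Num)
    have : LF fun d => t (snd d) := LF.comp ‹_› inferInstance
    infer_instance
  · obtain ⟨B, hB⟩ := hs.len_bdd N
    exact ⟨B, fun c hc => (len_row_le _ _).trans (hB c hc)⟩

open Classical in
instance LS.ite {P : M.Num → Prop} {s t : M.Num → M.Str} [hP : LP P] [hs : LS s] [ht : LS t]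
    [∀ c, Decidable (P c)] : LS fun c => if P c then s c else t c := by
  refine LS.of_bits ?_ fun N => ?_
  · have := hs.comp (snd : M.Num → M.Num)
    have := ht.comp (snd : M.Num → M.Num)
    have := hP.comp (snd : M.Num → M.Num)
    refine LP.congr (P := fun d => (P (snd d) ∧ fst d ∈ s (snd d)) ∨
      (¬ P (snd d) ∧ fst d ∈ t (snd d))) inferInstance fun d => ?_
    by_cases h : P (snd d) <;> simp [h]
  · obtain ⟨B, hB⟩ := hs.len_bdd N
    obtain ⟨B', hB'⟩ := ht.len_bdd N
    refine ⟨max B B', fun c hc => ?_⟩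
    by_cases h : P c
    · simpa [h] using Or.inl (hB c hc)
    · simpa [h] using Or.inr (hB' c hc)

/-- Strings with uniformly definable bits. -/
instance LS.mkS_comp {P : M.Num → M.Num → Prop} {t : M.Num → M.Num} [ht : LF t]
    [h : LP fun d => P (snd d) (fst d)] : LS fun c => mkS (P c) (t c) := by
  have hP : ∀ c, LP (P c) := fun c =>
    LP.congr (h.comp fun d => kpair d c) fun d => by simp
  refine LS.of_bits ?_ fun N => ?_
  · have : LF fun d => t (snd d) := LF.comp ‹_› inferInstance
    simp only [mem_mkS]
    infer_instance
  · obtain ⟨B, hB⟩ := ht.bdd N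
    exact ⟨B, fun c hc => len_le fun i hi => (mem_mkS.1 hi).1.trans_le (hB c hc)⟩

/-! ### Addition, shift and truncation of binary numbers -/

namespace Struct

noncomputable instance : Zero M.Str := ⟨mkS (fun _ => False) 0⟩

theorem not_mem_zero (i : M.Num) : i ∉ (0 : M.Str) := fun h => (mem_mkS.1 h).2

/-- There is a carry into position `i`. -/
def Carry (X Y : M.Str) (i : M.Num) : Prop :=
  ∃ k < i, k ∈ X ∧ k ∈ Y ∧ ∀ j < i, k < j → j ∈ X ∨ j ∈ Y

end Struct

instance LP.carry {s t : M.Num → M.Str} {u : M.Num → M.Num} [hs : LS s] [ht : LS t] [hu : LF u] :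
    LP fun c => Carry (s c) (t c) (u c) := by
  unfold Carry
  have := hs.comp (snd : M.Num → M.Num)
  have := ht.comp (snd : M.Num → M.Num)
  have := hs.comp (fun d : M.Num => snd (snd d))
  have := ht.comp (fun d : M.Num => snd (snd d))
  have : LF fun d => u (snd d) := hu.comp inferInstance
  infer_instance

instance LP.carry_self (X Y : M.Str) : LP (Carry X Y) := LP.carry (u := fun c => c)

namespace Struct

noncomputable instance : Add M.Str :=
  ⟨fun X Y => mkS (fun i => ¬ (¬ (i ∈ X ↔ i ∈ Y) ↔ Carry X Y i)) (M.len X + M.len Y)⟩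

theorem add_def (X Y : M.Str) : X + Y =
    mkS (fun i => ¬ (¬ (i ∈ X ↔ i ∈ Y) ↔ Carry X Y i)) (M.len X + M.len Y) := rfl

theorem not_carry_zero (X Y : M.Str) : ¬ Carry X Y 0 := fun ⟨_, h, _⟩ => not_lt_zero h

theorem carry_succ (X Y : M.Str) (i : M.Num) : Carry X Y (i + 1) ↔
    (i ∈ X ∧ i ∈ Y) ∨ ((i ∈ X ∨ i ∈ Y) ∧ Carry X Y i) := by
  constructor
  · rintro ⟨k, hk, h1, h2, h3⟩
    rcases (lt_add_one_iff.1 hk).eq_or_lt with rfl | hk'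
    · exact Or.inl ⟨h1, h2⟩
    · exact Or.inr ⟨h3 i (lt_succ_self i) hk', k, hk', h1, h2,
        fun j hj => h3 j (hj.trans (lt_succ_self i))⟩
  · rintro (⟨h1, h2⟩ | ⟨h, k, hk, h1, h2, h3⟩)
    · exact ⟨i, lt_succ_self i, h1, h2, fun j hj hj' =>
        absurd (lt_add_one_iff.1 hj) (not_le.2 hj')⟩
    · refine ⟨k, hk.trans (lt_succ_self i), h1, h2, fun j hj hkj => ?_⟩
      rcases (lt_add_one_iff.1 hj).eq_or_lt with rfl | hj'
      · exact h
      · exact h3 j hj' hkj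

theorem not_carry_of_ge {X Y : M.Str} {i : M.Num} (h : M.len X + M.len Y ≤ i) :
    ¬ Carry X Y i := by
  rintro ⟨k, hk, h1, h2, h3⟩
  obtain ⟨i, rfl⟩ := exists_pred (a := i) (zero_le.trans_lt hk).ne'
  have hX := lt_len h1
  have hY := lt_len h2
  have key : i < M.len X ∨ i < M.len Y := by
    rcases (lt_add_one_iff.1 hk).eq_or_lt with rfl | hk'
    · exact Or.inl hX
    · exact (h3 i (lt_succ_self i) hk').imp lt_len lt_len
  have h0 : (0 : M.Num) ≤ k := zero_le
  rcases key with h4 | h4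
  · have := add_one_le_iff.2 h4
    exact absurd h (not_le.2 (this.trans_lt (lt_add_of_pos_right _ (h0.trans_lt hY))))
  · have := add_one_le_iff.2 h4
    exact absurd h (not_le.2 (this.trans_lt (lt_add_of_pos_left _ (h0.trans_lt hX))))

theorem mem_add {X Y : M.Str} {i : M.Num} :
    i ∈ X + Y ↔ ¬ (¬ (i ∈ X ↔ i ∈ Y) ↔ Carry X Y i) := by
  rw [add_def, mem_mkS]
  refine ⟨fun h => h.2, fun h => ⟨?_, h⟩⟩
  by_contra hi
  rw [not_lt] at hi
  have h1 := not_carry_of_ge hi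
  have h2 : i ∉ X := fun h => absurd (lt_len h) (not_lt.2 (le_self_add.trans hi))
  have h3 : i ∉ Y := fun h => absurd (lt_len h) (not_lt.2 (le_add_self.trans hi))
  tauto

theorem len_add_le (X Y : M.Str) : M.len (X + Y) ≤ M.len X + M.len Y :=
  len_le fun _ hi => (mem_mkS.1 hi).1

theorem carry_comm (X Y : M.Str) (i : M.Num) : Carry X Y i ↔ Carry Y X i := by
  unfold Carry
  refine exists_congr fun k => and_congr_right fun _ => ?_
  simp only [or_comm (a := _ ∈ X)]
  tauto

theorem str_add_comm (X Y : M.Str) : X + Y = Y + X := by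
  refine Struct.ext fun i => ?_
  rw [mem_add, mem_add, carry_comm]
  tauto

theorem str_zero_add (X : M.Str) : 0 + X = X := by
  refine Struct.ext fun i => ?_
  have h : ¬ Carry 0 X i := fun ⟨k, _, h, _⟩ => not_mem_zero k h
  have := not_mem_zero i
  rw [mem_add]
  tauto

/-- In either bracketing of `X + Y + Z`, the two additions together send the same number of carries
(0, 1 or 2) into position `i`. Conjunction and disjunction express that number symmetrically, and
the induction step is a propositional tautology. -/
theorem carry_assoc (X Y Z : M.Str) (i : M.Num) :
    (Carry X Y i ∧ Carry (X + Y) Z i ↔ Carry Y Z i ∧ Carry X (Y + Z) i) ∧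
    (Carry X Y i ∨ Carry (X + Y) Z i ↔ Carry Y Z i ∨ Carry X (Y + Z) i) := by
  refine LP.induction (P := fun i => (Carry X Y i ∧ Carry (X + Y) Z i ↔
    Carry Y Z i ∧ Carry X (Y + Z) i) ∧ (Carry X Y i ∨ Carry (X + Y) Z i ↔
    Carry Y Z i ∨ Carry X (Y + Z) i)) inferInstance ?_ ?_ i
  · simp [not_carry_zero]
  · intro i ih
    simp only [carry_succ, mem_add]
    generalize (i ∈ X) = a, (i ∈ Y) = b, (i ∈ Z) = c, Carry X Y i = d, Carry (X + Y) Z i = e,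
      Carry Y Z i = f, Carry X (Y + Z) i = g at *
    by_cases a <;> by_cases b <;> by_cases c <;> by_cases d <;> by_cases e <;> by_cases f <;> simp_all

theorem str_add_assoc (X Y Z : M.Str) : X + Y + Z = X + (Y + Z) := by
  refine Struct.ext fun i => ?_
  have ih := carry_assoc X Y Z i
  simp only [mem_add]
  generalize (i ∈ X) = a, (i ∈ Y) = b, (i ∈ Z) = c, Carry X Y i = d, Carry (X + Y) Z i = e,
    Carry Y Z i = f, Carry X (Y + Z) i = g at *
  by_cases a <;> by_cases b <;> by_cases c <;> by_cases d <;> by_cases e <;> by_cases f <;> simp_all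

noncomputable instance : AddCommMonoid M.Str where
  add_assoc := str_add_assoc
  zero_add := str_zero_add
  add_zero X := by rw [str_add_comm, str_zero_add]
  add_comm := str_add_comm
  nsmul := nsmulRec

/-- A bit of a sum, together with one summand's bit and the carry, determines the other summand's
bit, and these determine the next carry. So the carries of both additions agree by induction, and
then the bits agree. -/
theorem str_add_right_cancel {X Y Z : M.Str} (h : X + Z = Y + Z) : X = Y := by
  have h' : ∀ i : M.Num, i ∈ X + Z ↔ i ∈ Y + Z := fun i => by rw [h]
  simp only [mem_add] at h'
  have key : ∀ i : M.Num, Carry X Z i ↔ Carry Y Z i := by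
    refine LP.induction (P := fun i => Carry X Z i ↔ Carry Y Z i) inferInstance ?_ ?_
    · simp [not_carry_zero]
    · intro i ih
      have := h' i
      simp only [carry_succ]
      generalize (i ∈ X) = a, (i ∈ Y) = b, (i ∈ Z) = c, Carry X Z i = d, Carry Y Z i = e at *
      by_cases a <;> by_cases b <;> by_cases c <;> by_cases d <;> simp_all
  refine Struct.ext fun i => ?_
  have := h' i
  rw [key i] at this
  generalize (i ∈ X) = a, (i ∈ Y) = b, (i ∈ Z) = c, Carry Y Z i = e at *
  by_cases a <;> by_cases b <;> by_cases c <;> by_cases e <;> simp_all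

instance : IsCancelAdd M.Str where
  add_left_cancel X Y Z h := by
    simp only [str_add_comm X] at h
    exact str_add_right_cancel h
  add_right_cancel X Y Z h := str_add_right_cancel h

theorem add_eq_union {X Y Z : M.Str} (h : ∀ i : M.Num, ¬ (i ∈ X ∧ i ∈ Y))
    (hZ : ∀ i : M.Num, i ∈ Z ↔ i ∈ X ∨ i ∈ Y) : X + Y = Z := by
  refine Struct.ext fun i => ?_
  have h1 : ¬ Carry X Y i := fun ⟨k, _, h1, h2, _⟩ => h k ⟨h1, h2⟩
  have h2 := h i
  rw [mem_add, hZ]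
  tauto

/-- `2^b X` -/
noncomputable def shift (b : M.Num) (X : M.Str) : M.Str :=
  mkS (fun i => ∃ l, l ≤ i ∧ b + l = i ∧ l ∈ X) (b + M.len X)

theorem mem_shift' {b : M.Num} {X : M.Str} {i : M.Num} :
    i ∈ shift b X ↔ ∃ l, l ≤ i ∧ b + l = i ∧ l ∈ X := by
  rw [shift, mem_mkS]
  refine ⟨fun h => h.2, fun h => ⟨?_, h⟩⟩
  obtain ⟨l, -, rfl, h⟩ := h
  exact (add_lt_add_iff_left b).2 (lt_len h)

theorem mem_shift {b : M.Num} {X : M.Str} {i : M.Num} :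
    i ∈ shift b X ↔ ∃ l, b + l = i ∧ l ∈ X := by
  rw [mem_shift']
  exact exists_congr fun l => ⟨fun h => h.2, fun h => ⟨h.1 ▸ le_add_self, h⟩⟩

theorem add_mem_shift {b : M.Num} {X : M.Str} {i : M.Num} : b + i ∈ shift b X ↔ i ∈ X := by
  rw [mem_shift]
  exact ⟨fun ⟨l, h, h'⟩ => add_left_cancel h ▸ h', fun h => ⟨i, rfl, h⟩⟩

theorem not_mem_shift {b : M.Num} {X : M.Str} {i : M.Num} (h : i < b) : i ∉ shift b X := by
  rw [mem_shift]
  rintro ⟨l, rfl, -⟩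
  exact absurd h (not_lt.2 le_self_add)

theorem shift_ext {b : M.Num} {X Y : M.Str} (h1 : ∀ i : M.Num, b + i ∈ X ↔ b + i ∈ Y)
    (h2 : ∀ i < b, i ∈ X ↔ i ∈ Y) : X = Y := by
  refine Struct.ext fun i => ?_
  rcases lt_or_ge i b with h | h
  · exact h2 i h
  · obtain ⟨l, rfl⟩ := le_iff_add.1 h
    exact h1 l

theorem carry_shift (b : M.Num) (X Y : M.Str) (i : M.Num) :
    Carry (shift b X) (shift b Y) (b + i) ↔ Carry X Y i := by
  refine LP.induction (P := fun i => Carry (shift b X) (shift b Y) (b + i) ↔ Carry X Y i)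
    inferInstance ?_ ?_ i
  · refine iff_of_false ?_ (not_carry_zero _ _)
    rintro ⟨k, hk, h, _⟩
    exact not_mem_shift (by simpa using hk) h
  · intro i ih
    rw [← add_assoc, carry_succ, carry_succ, ih, add_mem_shift, add_mem_shift]

theorem shift_add' (b : M.Num) (X Y : M.Str) : shift b (X + Y) = shift b X + shift b Y := by
  refine shift_ext (b := b) (fun i => ?_) fun i hi => ?_
  · rw [add_mem_shift, mem_add, mem_add, carry_shift, add_mem_shift, add_mem_shift]
  · have h1 : ¬ Carry (shift b X) (shift b Y) i := fun ⟨k, hk, h, _⟩ =>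
      not_mem_shift (hk.trans hi) h
    have := not_mem_shift (X := X) hi
    have := not_mem_shift (X := Y) hi
    have := not_mem_shift (X := X + Y) hi
    rw [mem_add]
    tauto

theorem shift_zero' (b : M.Num) : shift b (0 : M.Str) = 0 := by
  refine Struct.ext fun i => ?_
  simp [mem_shift, not_mem_zero]

theorem shift_shift (b c : M.Num) (X : M.Str) : shift b (shift c X) = shift (b + c) X := by
  refine Struct.ext fun i => ?_
  simp only [mem_shift]
  constructor
  · rintro ⟨_, rfl, l, rfl, h⟩
    exact ⟨l, by rw [add_assoc], h⟩
  · rintro ⟨l, rfl, h⟩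
    exact ⟨c + l, by rw [add_assoc], l, rfl, h⟩

theorem shift_zero_left (X : M.Str) : shift 0 X = X := by
  refine Struct.ext fun i => ?_
  simp [mem_shift]

/-- When a number is added to itself, the carry into position `i + 1` is just its bit `i`. -/
theorem shift_one (X : M.Str) : shift 1 X = X + X := by
  have key : ∀ i : M.Num, Carry X X (i + 1) ↔ i ∈ X := fun i => by
    rw [carry_succ]; tauto
  refine Struct.ext fun i => ?_
  rw [mem_add]
  by_cases h : i = 0
  · subst h
    have h1 := not_carry_zero X X
    have h2 := not_mem_shift (X := X) (zero_lt_one : (0 : M.Num) < 1)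
    tauto
  · obtain ⟨j, rfl⟩ := exists_pred h
    rw [key, add_comm, add_mem_shift]
    tauto

instance _root_.BoundedArith.LS.row_self (X : M.Str) : LS (row X) := LS.row_comp (t := fun c => c)
noncomputable instance : One M.Str := ⟨mkS (fun i => i = 0) 1⟩

theorem mem_one {i : M.Num} : i ∈ (1 : M.Str) ↔ i = 0 := by
  rw [show (1 : M.Str) = mkS (fun i => i = 0) 1 from rfl, mem_mkS]
  exact ⟨fun h => h.2, fun h => ⟨h ▸ zero_lt_one, h⟩⟩

theorem mem_shift_one {b i : M.Num} : i ∈ shift b (1 : M.Str) ↔ i = b := by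
  rw [mem_shift]
  simp [mem_one, eq_comm]

/-- The part of `X` below `b`. -/
noncomputable def restrict (X : M.Str) (b : M.Num) : M.Str := mkS (fun i => i ∈ X) b

theorem mem_restrict {X : M.Str} {b i : M.Num} : i ∈ restrict X b ↔ i < b ∧ i ∈ X := mem_mkS

theorem restrict_zero (X : M.Str) : restrict X 0 = 0 := by
  refine Struct.ext fun i => ?_
  simp [mem_restrict, not_mem_zero]

theorem restrict_of_len_le {X : M.Str} {b : M.Num} (h : M.len X ≤ b) : restrict X b = X := by
  refine Struct.ext fun i => ?_
  rw [mem_restrict]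
  exact ⟨fun h => h.2, fun h' => ⟨(lt_len h').trans_le h, h'⟩⟩

open Classical in
/-- `X` if `p`, and `0` otherwise -/
noncomputable def guard (p : Prop) (X : M.Str) : M.Str := if p then X else 0

theorem mem_guard {p : Prop} {X : M.Str} {i : M.Num} : i ∈ guard p X ↔ p ∧ i ∈ X := by
  unfold guard
  split <;> simp_all [not_mem_zero]

/-- The recursion on binary notation: truncations at successive positions differ by a single power
of two. Additive identities about strings are proved along it. -/
theorem restrict_succ (X : M.Str) (b : M.Num) :
    restrict X (b + 1) = restrict X b + guard (b ∈ X) (shift b 1) := by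
  symm
  refine add_eq_union (fun i => ?_) fun i => ?_
  · rw [mem_restrict, mem_guard, mem_shift_one]
    rintro ⟨h, h'⟩
    exact h.1.ne h'.2
  · rw [mem_restrict, mem_restrict, mem_guard, mem_shift_one, lt_add_one_iff, le_iff_lt_or_eq]
    constructor
    · rintro ⟨h | rfl, h'⟩
      exacts [Or.inl ⟨h, h'⟩, Or.inr ⟨h', rfl⟩]
    · rintro (⟨h, h'⟩ | ⟨h, rfl⟩)
      exacts [⟨Or.inl h, h'⟩, ⟨Or.inr rfl, h⟩]

end Struct

instance LS.add {s t : M.Num → M.Str} [hs : LS s] [ht : LS t] : LS fun c => s c + t c := by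
  have := hs.comp (snd : M.Num → M.Num)
  have := ht.comp (snd : M.Num → M.Num)
  refine LS.of_bits ?_ fun N => ?_
  · simp only [mem_add]
    infer_instance
  · obtain ⟨B, hB⟩ := hs.len_bdd N
    obtain ⟨B', hB'⟩ := ht.len_bdd N
    exact ⟨B + B', fun c hc => (len_add_le _ _).trans (add_le_add (hB c hc) (hB' c hc))⟩

instance LS.restrict_comp {s : M.Num → M.Str} {t : M.Num → M.Num} [hs : LS s] [ht : LF t] :
    LS fun c => restrict (s c) (t c) := by
  have := hs.comp (snd : M.Num → M.Num)
  unfold Struct.restrict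
  infer_instance

instance LS.restrict_self (X : M.Str) : LS (restrict X) := LS.restrict_comp (t := fun c => c)

instance LS.shift_comp {s : M.Num → M.Str} {t : M.Num → M.Num} [hs : LS s] [ht : LF t] :
    LS fun c => shift (t c) (s c) := by
  have := hs.comp (snd : M.Num → M.Num)
  have : LF fun d => t (snd d) := ht.comp inferInstance
  refine LS.of_bits ?_ fun N => ?_
  · have := hs.comp (fun d : M.Num => snd (snd d))
    have : LF fun d => t (snd (snd d)) := ht.comp inferInstance
    simp only [mem_shift']
    infer_instance
  · obtain ⟨B, hB⟩ := hs.len_bdd N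
    obtain ⟨B', hB'⟩ := ht.bdd N
    exact ⟨B' + B, fun c hc => len_le fun i hi => (mem_mkS.1 hi).1.trans_le
      (add_le_add (hB' c hc) (hB c hc))⟩

instance LP.str_eq {s t : M.Num → M.Str} [hs : LS s] [ht : LS t] : LP fun c => s c = t c := by
  refine LP.of_local fun N => ?_
  obtain ⟨B, hB⟩ := hs.len_bdd N
  obtain ⟨B', hB'⟩ := ht.len_bdd N
  have := hs.comp (snd : M.Num → M.Num)
  have := ht.comp (snd : M.Num → M.Num)
  refine ⟨fun c => ∀ i, i ≤ B + B' → (i ∈ s c ↔ i ∈ t c), inferInstance, fun c hc => ?_⟩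
  refine ⟨fun h => Struct.ext fun i => ?_, fun h => by simp [h]⟩
  by_cases hi : i ≤ B + B'
  · exact h i hi
  · refine iff_of_false (fun h' => hi ?_) fun h' => hi ?_
    · exact ((lt_len h').le.trans (hB c hc)).trans le_self_add
    · exact ((lt_len h').le.trans (hB' c hc)).trans le_add_self

end Strings

end BoundedArith

namespace BoundedArith
open Fml Struct
/-! ## Integers -/

section Integers

/-- The integers of a model. -/
def ZM (M : Struct.{u}) [VModel M] : Type u := Algebra.GrothendieckAddGroup M.Str

variable {M : Struct.{u}} [VModel M]

noncomputable instance : AddCommGroup (ZM M) :=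
  inferInstanceAs (AddCommGroup (Algebra.GrothendieckAddGroup M.Str))

/-- The inclusion of the binary numbers. -/
noncomputable def toZ : M.Str →+ ZM M := Algebra.GrothendieckAddGroup.of

/-- Uses cancellation for strings. It makes equality of differences the same as equality of cross
sums, which is how the formula `Int2.eqv` compares integers. -/
theorem toZ_injective : Function.Injective (toZ (M := M)) :=
  Algebra.GrothendieckAddGroup.of_injective

theorem exists_toZ_sub (z : ZM M) : ∃ p q : M.Str, z = toZ p - toZ q := by
  have h : ∀ y : Algebra.GrothendieckAddGroup M.Str, ∃ p q : M.Str,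
      y = Algebra.GrothendieckAddGroup.of p - Algebra.GrothendieckAddGroup.of q := fun y => by
    induction y using AddLocalization.ind with
    | _ y =>
      refine ⟨y.1, y.2, eq_sub_of_add_eq ?_⟩
      change AddLocalization.mk y.1 y.2 + AddLocalization.mk (y.2 : M.Str) 0 =
        AddLocalization.mk y.1 0
      rw [AddLocalization.mk_add, AddLocalization.mk_eq_mk_iff']
      simp [add_comm]
  exact h z

theorem toZ_sub_eq_iff {p q p' q' : M.Str} :
    (toZ p - toZ q : ZM M) = toZ p' - toZ q' ↔ p + q' = p' + q := by
  rw [sub_eq_sub_iff_add_eq_add, ← map_add, ← map_add, toZ_injective.eq_iff]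

/-- Shift as an additive map. -/
noncomputable def shiftHom (b : M.Num) : M.Str →+ M.Str where
  toFun := shift b
  map_zero' := shift_zero' b
  map_add' := shift_add' b

/-- Multiplication by `2^b`. -/
noncomputable def sh (b : M.Num) : ZM M →+ ZM M :=
  Algebra.GrothendieckAddGroup.lift (toZ.comp (shiftHom b))

theorem sh_toZ (b : M.Num) (X : M.Str) : sh b (toZ X) = toZ (shift b X) := by
  have := DFunLike.congr_fun
    (Algebra.GrothendieckAddGroup.lift.symm_apply_apply (toZ.comp (shiftHom b))) X
  exact this

theorem sh_toZ_sub (b : M.Num) (p q : M.Str) :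
    sh b (toZ p - toZ q) = toZ (shift b p) - toZ (shift b q) := by
  rw [map_sub, sh_toZ, sh_toZ]

theorem sh_sh (b c : M.Num) (z : ZM M) : sh b (sh c z) = sh (b + c) z := by
  obtain ⟨p, q, rfl⟩ := exists_toZ_sub z
  simp only [sh_toZ_sub, shift_shift]

theorem sh_zero (z : ZM M) : sh 0 z = z := by
  obtain ⟨p, q, rfl⟩ := exists_toZ_sub z
  simp only [sh_toZ_sub, shift_zero_left]

theorem sh_succ (b : M.Num) (z : ZM M) : sh (b + 1) z = sh b z + sh b z := by
  obtain ⟨p, q, rfl⟩ := exists_toZ_sub z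
  simp only [sh_toZ_sub, ← shift_shift b 1, shift_one, shift_add', map_add]
  abel

open Classical in
/-- `z` if `p`, and `0` otherwise -/
noncomputable def zguard (p : Prop) (z : ZM M) : ZM M := if p then z else 0

theorem toZ_guard (p : Prop) (X : M.Str) : toZ (Struct.guard p X) = zguard p (toZ X) := by
  unfold Struct.guard zguard; split <;> simp

theorem zguard_sub (p : Prop) (x y : ZM M) : zguard p (x - y) = zguard p x - zguard p y := by
  unfold zguard; split <;> simp

theorem zguard_add (p : Prop) (x y : ZM M) : zguard p (x + y) = zguard p x + zguard p y := by
  unfold zguard; split <;> simp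

theorem zguard_true {p : Prop} (h : p) (x : ZM M) : zguard p x = x := if_pos h
theorem zguard_false {p : Prop} (h : ¬ p) (x : ZM M) : zguard p x = 0 := if_neg h

/-- The integer coded by a string. -/
noncomputable def ival (X : M.Str) : ZM M := toZ (row X 0) - toZ (row X 1)

/-- The string with rows `p`, `q`. -/
noncomputable def mk2 (p q : M.Str) : M.Str :=
  mkS (fun j => j = kpair (fst j) (snd j) ∧
    ((fst j = 0 ∧ snd j ∈ p) ∨ (fst j = 1 ∧ snd j ∈ q))) (kpair 1 (M.len p + M.len q) + 1)

theorem mem_mk2 {p q : M.Str} {j : M.Num} : j ∈ mk2 p q ↔ j = kpair (fst j) (snd j) ∧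
    ((fst j = 0 ∧ snd j ∈ p) ∨ (fst j = 1 ∧ snd j ∈ q)) := by
  rw [mk2, mem_mkS]
  refine ⟨fun h => h.2, fun h => ⟨?_, h⟩⟩
  rw [h.1, lt_add_one_iff]
  rcases h.2 with ⟨h1, h2⟩ | ⟨h1, h2⟩
  · exact kpair_mono (h1 ▸ zero_le) ((lt_len h2).le.trans le_self_add)
  · exact kpair_mono h1.le ((lt_len h2).le.trans le_add_self)

theorem row_mk2_zero (p q : M.Str) : row (mk2 p q) 0 = p := by
  refine Struct.ext fun i => ?_
  simp [mem_row, mem_mk2]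

theorem row_mk2_one (p q : M.Str) : row (mk2 p q) 1 = q := by
  refine Struct.ext fun i => ?_
  simp [mem_row, mem_mk2]

theorem len_mk2_le (p q : M.Str) : M.len (mk2 p q) ≤ kpair 1 (M.len p + M.len q) + 1 :=
  len_le fun _ h => (mem_mkS.1 h).1

theorem ival_mk2 (p q : M.Str) : ival (mk2 p q) = toZ p - toZ q := by
  rw [ival, row_mk2_zero, row_mk2_one]

theorem exists_ival (z : ZM M) : ∃ X : M.Str, ival X = z := by
  obtain ⟨p, q, rfl⟩ := exists_toZ_sub z
  exact ⟨mk2 p q, ival_mk2 p q⟩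

/-- The family `f` of integers is locally coded by strings. -/
class LZ (f : M.Num → ZM M) : Prop where
  code : ∀ N, ∃ X : M.Str, ∀ c < N, ival (row X c) = f c

theorem LZ.of_local {f : M.Num → ZM M} (h : ∀ N, ∃ f', LZ f' ∧ ∀ c < N, f' c = f c) : LZ f := by
  refine ⟨fun N => ?_⟩
  obtain ⟨f', hf', h'⟩ := h N
  obtain ⟨X, hX⟩ := hf'.code N
  exact ⟨X, fun c hc => (hX c hc).trans (h' c hc)⟩

theorem LZ.of_ival {s : M.Num → M.Str} (hs : LS s) : LZ fun c => ival (s c) :=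
  ⟨fun N => (hs.code N).imp fun X hX c hc => by rw [hX c hc]⟩

theorem LZ.local_ival {f : M.Num → ZM M} (hf : LZ f) (N : M.Num) :
    ∃ s : M.Num → M.Str, LS s ∧ ∀ c < N, ival (s c) = f c := by
  obtain ⟨X, hX⟩ := hf.code N
  exact ⟨row X, inferInstance, hX⟩

theorem LZ.comp {f : M.Num → ZM M} (hf : LZ f) (t : M.Num → M.Num) [ht : LF t] :
    LZ fun c => f (t c) := by
  refine LZ.of_local fun N => ?_
  obtain ⟨B, hB⟩ := ht.bdd N
  obtain ⟨s, hs, h⟩ := hf.local_ival (B + 1)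
  exact ⟨_, LZ.of_ival (hs.comp t), fun c hc => h _ (lt_add_one_iff.2 (hB c hc))⟩

theorem LS.mk2_comp {p q : M.Num → M.Str} (hp : LS p) (hq : LS q) : LS fun c => mk2 (p c) (q c) := by
  have := hp.comp (snd : M.Num → M.Num)
  have := hq.comp (snd : M.Num → M.Num)
  refine LS.of_bits ?_ fun N => ?_
  · simp only [mem_mk2]
    infer_instance
  · obtain ⟨B, hB⟩ := hp.len_bdd N
    obtain ⟨B', hB'⟩ := hq.len_bdd N
    refine ⟨kpair 1 (B + B') + 1, fun c hc => (len_mk2_le _ _).trans ?_⟩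
    exact add_le_add_left (kpair_mono le_rfl (add_le_add (hB c hc) (hB' c hc))) _

theorem LZ.of_parts {p q : M.Num → M.Str} (hp : LS p) (hq : LS q) :
    LZ fun c => (toZ (p c) - toZ (q c) : ZM M) := by
  have := LZ.of_ival (hp.mk2_comp hq)
  simpa only [ival_mk2] using this

theorem LZ.local_parts {f : M.Num → ZM M} (hf : LZ f) (N : M.Num) :
    ∃ p q : M.Num → M.Str, LS p ∧ LS q ∧ ∀ c < N, toZ (p c) - toZ (q c) = f c := by
  obtain ⟨s, hs, h⟩ := hf.local_ival N
  exact ⟨fun c => row (s c) 0, fun c => row (s c) 1, inferInstance, inferInstance, h⟩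

instance LZ.ival_comp {s : M.Num → M.Str} [hs : LS s] : LZ fun c => ival (s c) := LZ.of_ival hs

instance (priority := low) LZ.const (z : ZM M) : LZ fun _ : M.Num => z := by
  obtain ⟨p, q, rfl⟩ := exists_toZ_sub z
  exact LZ.of_parts inferInstance inferInstance

instance LZ.toZ_comp {s : M.Num → M.Str} [hs : LS s] : LZ fun c => (toZ (s c) : ZM M) := by
  simpa using LZ.of_parts hs (LS.const 0)

instance LZ.add {f g : M.Num → ZM M} [hf : LZ f] [hg : LZ g] : LZ fun c => f c + g c := by
  refine LZ.of_local fun N => ?_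
  obtain ⟨p, q, hp, hq, h⟩ := hf.local_parts N
  obtain ⟨p', q', hp', hq', h'⟩ := hg.local_parts N
  refine ⟨_, LZ.of_parts (LS.add (s := p) (t := p')) (LS.add (s := q) (t := q')), fun c hc => ?_⟩
  rw [← h c hc, ← h' c hc, map_add, map_add]
  abel

instance LZ.neg {f : M.Num → ZM M} [hf : LZ f] : LZ fun c => - f c := by
  refine LZ.of_local fun N => ?_
  obtain ⟨p, q, hp, hq, h⟩ := hf.local_parts N
  exact ⟨_, LZ.of_parts hq hp, fun c hc => by rw [← h c hc, neg_sub]⟩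

instance LZ.sub {f g : M.Num → ZM M} [LZ f] [LZ g] : LZ fun c => f c - g c := by
  simp only [sub_eq_add_neg]
  infer_instance

instance LZ.sh_comp {f : M.Num → ZM M} {t : M.Num → M.Num} [hf : LZ f] [LF t] :
    LZ fun c => sh (t c) (f c) := by
  refine LZ.of_local fun N => ?_
  obtain ⟨p, q, hp, hq, h⟩ := hf.local_parts N
  exact ⟨_, LZ.of_parts (LS.shift_comp (s := p) (t := t)) (LS.shift_comp (s := q) (t := t)),
    fun c hc => by rw [← h c hc, sh_toZ_sub]⟩

open Classical in
instance LZ.ite {P : M.Num → Prop} {f g : M.Num → ZM M} [LP P] [hf : LZ f] [hg : LZ g]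
    [∀ c, Decidable (P c)] : LZ fun c => if P c then f c else g c := by
  refine LZ.of_local fun N => ?_
  obtain ⟨s, hs, h⟩ := hf.local_ival N
  obtain ⟨t, ht, h'⟩ := hg.local_ival N
  refine ⟨_, LZ.of_ival (LS.ite (P := P) (s := s) (t := t)), fun c hc => ?_⟩
  split
  · exact h c hc
  · exact h' c hc

instance LZ.zguard_comp {P : M.Num → Prop} {f : M.Num → ZM M} [LP P] [LZ f] :
    LZ fun c => zguard (P c) (f c) := by
  unfold BoundedArith.zguard
  infer_instance

/-- Equality of two differences of strings is an equality of sums of strings, hence decided by their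
bits below a common bound. -/
instance LP.z_eq {f g : M.Num → ZM M} [hf : LZ f] [hg : LZ g] : LP fun c => f c = g c := by
  refine LP.of_local fun N => ?_
  obtain ⟨p, q, hp, hq, h⟩ := hf.local_parts N
  obtain ⟨p', q', hp', hq', h'⟩ := hg.local_parts N
  refine ⟨fun c => p c + q' c = p' c + q c, inferInstance, fun c hc => ?_⟩
  rw [← h c hc, ← h' c hc, toZ_sub_eq_iff]

/-- The form of induction used for nearly all identities between integers: the equation itself is a
locally coded predicate of the index. -/
theorem LZ.induction {f g : M.Num → ZM M} (hf : LZ f) (hg : LZ g) {n : M.Num} (h0 : f 0 = g 0)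
    (h1 : ∀ a < n, f a = g a → f (a + 1) = g (a + 1)) : ∀ a ≤ n, f a = g a :=
  LP.induction_lt inferInstance h0 h1

open Classical in
/-- The string with rows `s 0, …, s (N - 1)`. -/
noncomputable def mkRows (N : M.Num) (s : M.Num → M.Str) : M.Str :=
  if h : LS s then mkS (fun j => j = kpair (fst j) (snd j) ∧ fst j < N ∧ snd j ∈ s (fst j))
    (kpair N (h.len_bdd N).choose) else 0

theorem mem_mkRows {N : M.Num} {s : M.Num → M.Str} [hs : LS s] {j : M.Num} :
    j ∈ mkRows N s ↔ j = kpair (fst j) (snd j) ∧ fst j < N ∧ snd j ∈ s (fst j) := by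
  have := hs.comp (fst : M.Num → M.Num)
  rw [mkRows, dif_pos hs, mem_mkS]
  refine ⟨fun h => h.2, fun h => ⟨?_, h⟩⟩
  have h1 := (lt_len h.2.2).trans_le ((hs.len_bdd N).choose_spec _ h.2.1)
  rw [h.1]
  exact kpair_lt h.2.1 h1.le

theorem row_mkRows {N : M.Num} {s : M.Num → M.Str} [LS s] {c : M.Num} (hc : c < N) :
    row (mkRows N s) c = s c := by
  refine Struct.ext fun i => ?_
  simp [mem_row, mem_mkRows, hc]

instance LS.mkRows_comp {N : M.Num} {s : M.Num → M.Num → M.Str}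
    [hs : LS fun d => s (snd d) (fst d)] : LS fun c => mkRows N (s c) := by
  have h1 : ∀ c, LS (s c) := fun c => by
    have := hs.comp fun i => kpair i c
    simpa using this
  refine LS.of_bits ?_ fun N' => ?_
  · simp only [mem_mkRows]
    have := hs.comp fun d : M.Num => kpair (fst (fst d)) (snd d)
    simp only [fst_kpair, snd_kpair] at this
    infer_instance
  · obtain ⟨B, hB⟩ := hs.len_bdd (kpair N N')
    refine ⟨kpair N B, fun c hc => len_le fun j hj => ?_⟩
    rw [mem_mkRows] at hj
    have h2 := hB (kpair (fst j) c) (kpair_lt hj.2.1 hc.le)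
    rw [fst_kpair, snd_kpair] at h2
    rw [hj.1]
    exact kpair_lt hj.2.1 ((lt_len hj.2.2).le.trans h2)

end Integers

/-! ## Semantics of formulas written with fresh names -/

section Semantics
variable {M : Struct.{u}}

/-- An assignment, in which the names from `k` on are unused. -/
structure World (M : Struct.{u}) where
  k : ℕ
  ρ : ℕ → M.Num
  σ : ℕ → M.Str

instance : Preorder (World M) where
  le w w' := w.k ≤ w'.k ∧ ∀ i < w.k, w'.ρ i = w.ρ i ∧ w'.σ i = w.σ i
  le_refl w := ⟨le_rfl, fun _ _ => ⟨rfl, rfl⟩⟩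
  le_trans w w' w'' h h' := ⟨h.1.trans h'.1, fun i hi =>
    ⟨(h'.2 i (hi.trans_le h.1)).1.trans (h.2 i hi).1,
      (h'.2 i (hi.trans_le h.1)).2.trans (h.2 i hi).2⟩⟩

/-- The term `t` denotes the number `a`. -/
def TM (w : World M) (t : Term) (a : M.Num) : Prop := ∀ w', w ≤ w' → t.eval M w'.ρ w'.σ = a

/-- The formula `φ` expresses `p`. -/
def FM (w : World M) (φ : Fml) (p : Prop) : Prop :=
  ∀ w', w ≤ w' → ((φ w'.k).Sat M w'.ρ w'.σ ↔ p)

theorem TM.mono {w w' : World M} {t : Term} {a : M.Num} (h : TM w t a) (hw : w ≤ w') : TM w' t a :=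
  fun _ h' => h _ (hw.trans h')

theorem FM.mono {w w' : World M} {φ : Fml} {p : Prop} (h : FM w φ p) (hw : w ≤ w') : FM w' φ p :=
  fun _ h' => h _ (hw.trans h')

section rules
variable {w : World M} {s t : Term} {a b : M.Num} {φ ψ : Fml} {p q : Prop}

theorem TM.zero : TM w 0 (0 : M.Num) := fun _ _ => rfl
theorem TM.one : TM w 1 (1 : M.Num) := fun _ _ => rfl
theorem TM.add (hs : TM w s a) (ht : TM w t b) : TM w (s + t) (a + b) := fun w' h => by
  rw [eval_add, hs w' h, ht w' h]
theorem TM.mul (hs : TM w s a) (ht : TM w t b) : TM w (s * t) (a * b) := fun w' h => by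
  rw [eval_mul, hs w' h, ht w' h]
theorem TM.pair (hs : TM w s a) (ht : TM w t b) : TM w (pair s t) (kpair a b) := fun w' h => by
  rw [eval_pair, hs w' h, ht w' h]

theorem FM.congr (h : FM w φ p) (hpq : p ↔ q) : FM w φ q := fun w' hw => (h w' hw).trans hpq
theorem FM.and (h : FM w φ p) (h' : FM w ψ q) : FM w (φ.and ψ) (p ∧ q) := fun w' hw =>
  and_congr (h w' hw) (h' w' hw)
theorem FM.or (h : FM w φ p) (h' : FM w ψ q) : FM w (φ.or ψ) (p ∨ q) := fun w' hw =>
  or_congr (h w' hw) (h' w' hw)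
theorem FM.imp (h : FM w φ p) (h' : FM w ψ q) : FM w (φ.imp ψ) (p → q) := fun w' hw =>
  imp_congr (h w' hw) (h' w' hw)
theorem FM.not (h : FM w φ p) : FM w φ.not (¬ p) := fun w' hw => not_congr (h w' hw)
theorem FM.iff (h : FM w φ p) (h' : FM w ψ q) : FM w (φ.iff ψ) (p ↔ q) :=
  ((h.imp h').and (h'.imp h)).congr iff_def.symm
theorem FM.xor (h : FM w φ p) (h' : FM w ψ q) : FM w (φ.xor ψ) (¬ (p ↔ q)) := (h.iff h').not
theorem FM.eqN (hs : TM w s a) (ht : TM w t b) : FM w (eqN s t) (a = b) := fun w' hw => by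
  rw [Fml.eqN, sat_eqN, hs w' hw, ht w' hw]
theorem FM.le (hs : TM w s a) (ht : TM w t b) : FM w (le s t) (a ≤ b) := fun w' hw => by
  rw [Fml.le, sat_le, hs w' hw, ht w' hw]
theorem FM.lt (hs : TM w s a) (ht : TM w t b) : FM w (lt s t) (a < b) :=
  (FM.le hs ht).and (FM.eqN hs ht).not
theorem FM.falsum : FM w falsum False := (FM.not (FM.eqN TM.zero TM.zero)).congr (by simp)

theorem World.le_bind (w : World M) (a : M.Num) :
    w ≤ ⟨w.k + 1, Function.update w.ρ w.k a, w.σ⟩ :=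
  ⟨Nat.le_succ _, fun i hi => ⟨Function.update_of_ne hi.ne _ _, rfl⟩⟩

theorem World.le_bindS (w : World M) (X : M.Str) :
    w ≤ ⟨w.k + 1, w.ρ, Function.update w.σ w.k X⟩ :=
  ⟨Nat.le_succ _, fun i hi => ⟨rfl, Function.update_of_ne hi.ne _ _⟩⟩

theorem TM.bind (w : World M) (a : M.Num) :
    TM ⟨w.k + 1, Function.update w.ρ w.k a, w.σ⟩ (.var w.k) a := fun _ h =>
  (h.2 w.k (Nat.lt_succ_self _)).1.trans (Function.update_self _ _ _)

/-- The quantifier takes the first unused name, so binding it extends the assignment without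
disturbing anything already interpreted. Since `FM` and `TM` speak of all extensions, earlier
denotations carry over to the scope. -/
theorem FM.allN {f : Term → Fml} {p : M.Num → Prop}
    (h : ∀ w', w ≤ w' → ∀ t a, TM w' t a → FM w' (f t) (p a)) : FM w (allN f) (∀ a, p a) :=
  fun w' hw => forall_congr' fun a =>
    h _ (hw.trans (w'.le_bind a)) _ a (TM.bind w' a) _ le_rfl

theorem FM.exN {f : Term → Fml} {p : M.Num → Prop}
    (h : ∀ w', w ≤ w' → ∀ t a, TM w' t a → FM w' (f t) (p a)) : FM w (exN f) (∃ a, p a) :=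
  fun w' hw => exists_congr fun a =>
    h _ (hw.trans (w'.le_bind a)) _ a (TM.bind w' a) _ le_rfl

theorem FM.allLe {f : Term → Fml} {p : M.Num → Prop} (ht : TM w t b)
    (h : ∀ w', w ≤ w' → ∀ t a, TM w' t a → FM w' (f t) (p a)) :
    FM w (allLe t f) (∀ a, a ≤ b → p a) :=
  FM.allN fun w' hw s a hs => (FM.le hs (ht.mono hw)).imp (h w' hw s a hs)

theorem FM.exLe {f : Term → Fml} {p : M.Num → Prop} (ht : TM w t b)
    (h : ∀ w', w ≤ w' → ∀ t a, TM w' t a → FM w' (f t) (p a)) :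
    FM w (exLe t f) (∃ a, a ≤ b ∧ p a) :=
  FM.exN fun w' hw s a hs => (FM.le hs (ht.mono hw)).and (h w' hw s a hs)

theorem FM.allLt {f : Term → Fml} {p : M.Num → Prop} (ht : TM w t b)
    (h : ∀ w', w ≤ w' → ∀ t a, TM w' t a → FM w' (f t) (p a)) :
    FM w (allLt t f) (∀ a, a < b → p a) :=
  (FM.allLe ht (p := fun a => ¬ a = b → p a) fun w' hw s a hs =>
    (FM.eqN hs (ht.mono hw)).not.imp (h w' hw s a hs)).congr <| forall_congr' fun a =>
      ⟨fun h h' => h h'.1 h'.2, fun h h1 h2 => h ⟨h1, h2⟩⟩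

theorem FM.exLt {f : Term → Fml} {p : M.Num → Prop} (ht : TM w t b)
    (h : ∀ w', w ≤ w' → ∀ t a, TM w' t a → FM w' (f t) (p a)) :
    FM w (exLt t f) (∃ a, a < b ∧ p a) :=
  (FM.exLe ht (p := fun a => ¬ a = b ∧ p a) fun w' hw s a hs =>
    (FM.eqN hs (ht.mono hw)).not.and (h w' hw s a hs)).congr <| exists_congr fun a =>
      ⟨fun h => ⟨⟨h.1, h.2.1⟩, h.2.2⟩, fun h => ⟨h.1.1, h.1.2, h.2⟩⟩

end rules

/-! ### Denotations of definable binary numbers and integers -/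

variable [VModel M]

variable (M) in
/-- A string with a strict upper bound of its elements. -/
structure NV where
  s : M.Str
  b : M.Num
  lt : ∀ i ∈ s, i < b

namespace NV

noncomputable def zero : NV M := ⟨0, 0, fun _ h => absurd h (not_mem_zero _)⟩
noncomputable def one : NV M := ⟨1, 1, fun i h => by rw [mem_one] at h; rw [h]; exact zero_lt_one⟩
def ofStr (X : M.Str) : NV M := ⟨X, M.len X, fun _ => lt_len⟩
noncomputable def add (x y : NV M) : NV M := ⟨x.s + y.s, x.b + y.b, fun _ h =>
  (lt_len h).trans_le ((len_add_le _ _).trans (add_le_add (len_le x.lt) (len_le y.lt)))⟩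
noncomputable def shift (c : M.Num) (x : NV M) : NV M := ⟨Struct.shift c x.s, c + x.b, fun _ h => by
  obtain ⟨l, rfl, hl⟩ := mem_shift.1 h
  exact (add_lt_add_iff_left c).2 (x.lt l hl)⟩
noncomputable def guard (p : Prop) (x : NV M) : NV M :=
  ⟨Struct.guard p x.s, x.b, fun i h => x.lt i (mem_guard.1 h).2⟩
noncomputable def row (x : NV M) (i : M.Num) : NV M := ⟨Struct.row x.s i, x.b, fun j h =>
  (le_kpair_right i j).trans_lt (x.lt _ (mem_row.1 h))⟩

end NV

/-- The definable number `X` denotes `x`. -/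
structure NM (w : World M) (X : Nat2) (x : NV M) : Prop where
  bit : ∀ w', w ≤ w' → ∀ t a, TM w' t a → FM w' (X.bit t) (a ∈ x.s)
  bd : TM w X.bd x.b

namespace NM
variable {w : World M} {X Y : Nat2} {x y : NV M} {t : Term} {a : M.Num} {φ : Fml} {p : Prop}

theorem mono {w' : World M} (h : NM w X x) (hw : w ≤ w') : NM w' X x :=
  ⟨fun w'' hw' => h.bit w'' (hw.trans hw'), h.bd.mono hw⟩

theorem zero : NM w .zero (NV.zero (M := M)) :=
  ⟨fun _ _ _ a _ => FM.falsum.congr (iff_of_false id (not_mem_zero a)), TM.zero⟩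

theorem one : NM w .one (NV.one (M := M)) :=
  ⟨fun _ _ _ _ h => (FM.eqN h TM.zero).congr mem_one.symm, TM.one⟩

theorem carry (hX : NM w X x) (hY : NM w Y y) (ht : TM w t a) :
    FM w (Nat2.carry X Y t) (Carry x.s y.s a) :=
  FM.exLt ht fun w1 h1 k k' hk => (hX.bit w1 h1 k k' hk).and <| (hY.bit w1 h1 k k' hk).and <|
    FM.allLt (ht.mono h1) fun w2 h2 j j' hj => (FM.lt (hk.mono h2) hj).imp <|
      (hX.bit w2 (h1.trans h2) j j' hj).or (hY.bit w2 (h1.trans h2) j j' hj)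

theorem add (hX : NM w X x) (hY : NM w Y y) : NM w (X.add Y) (x.add y) where
  bit w' hw t a ht := FM.congr (((hX.bit w' hw t a ht).xor (hY.bit w' hw t a ht)).xor
    ((hX.mono hw).carry (hY.mono hw) ht)) mem_add.symm
  bd := hX.bd.add hY.bd

theorem shift (hX : NM w X x) (ht : TM w t a) : NM w (X.shift t) (x.shift a) where
  bit w' hw s b hs := FM.congr (FM.exLe hs fun w1 h1 l l' hl =>
    (FM.eqN ((ht.mono (hw.trans h1)).add hl) (hs.mono h1)).and (hX.bit w1 (hw.trans h1) l l' hl))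
    mem_shift'.symm
  bd := ht.add hX.bd

theorem guard (h : FM w φ p) (hX : NM w X x) : NM w (X.guard φ) (x.guard p) where
  bit w' hw t a ht := FM.congr ((h.mono hw).and (hX.bit w' hw t a ht)) mem_guard.symm
  bd := hX.bd

theorem row (hX : NM w X x) (ht : TM w t a) : NM w (X.row t) (x.row a) where
  bit w' hw s b hs := FM.congr (hX.bit w' hw _ _ ((ht.mono hw).pair hs)) mem_row.symm
  bd := hX.bd

/-- The formula compares bits only below the sum of the two bounds. This suffices because a
denotation carries a strict upper bound of its elements. -/
theorem eqv (hX : NM w X x) (hY : NM w Y y) : FM w (X.eqv Y) (x.s = y.s) :=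
  FM.congr (FM.allLt (hX.bd.add hY.bd) fun w1 h1 i i' hi =>
    (hX.bit w1 h1 i i' hi).iff (hY.bit w1 h1 i i' hi))
    ⟨fun h => Struct.ext fun i => ⟨fun hi => (h i ((x.lt i hi).trans_le le_self_add)).1 hi,
      fun hi => (h i ((y.lt i hi).trans_le le_add_self)).2 hi⟩, fun h => by simp [h]⟩

end NM

theorem FM.all {w : World M} {f : Nat2 → Fml} {p : M.Str → Prop}
    (h : ∀ w', w ≤ w' → ∀ X s, NM w' X (NV.ofStr s) → FM w' (f X) (p s)) :
    FM w (Fml.all f) (∀ s, p s) :=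
  fun w' hw => forall_congr' fun a => by
    have hσ : ∀ w'', (⟨w'.k + 1, w'.ρ, Function.update w'.σ w'.k a⟩ : World M) ≤ w'' →
        w''.σ w'.k = a := fun w'' h =>
      (h.2 w'.k (Nat.lt_succ_self _)).2.trans (Function.update_self _ _ _)
    refine h _ (hw.trans (w'.le_bindS a)) (str w'.k) a ⟨fun w1 h1 t b ht w2 h2 => ?_, fun w1 h1 => ?_⟩
      _ le_rfl
    · change t.eval M w2.ρ w2.σ ∈ w2.σ w'.k ↔ b ∈ a
      rw [hσ w2 (h1.trans h2), ht w2 h2]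
    · change M.len (w1.σ w'.k) = M.len a
      rw [hσ w1 h1]

theorem FM.ex {w : World M} {f : Nat2 → Fml} {p : M.Str → Prop}
    (h : ∀ w', w ≤ w' → ∀ X s, NM w' X (NV.ofStr s) → FM w' (f X) (p s)) :
    FM w (Fml.ex f) (∃ s, p s) :=
  fun w' hw => exists_congr fun a => by
    have hσ : ∀ w'', (⟨w'.k + 1, w'.ρ, Function.update w'.σ w'.k a⟩ : World M) ≤ w'' →
        w''.σ w'.k = a := fun w'' h =>
      (h.2 w'.k (Nat.lt_succ_self _)).2.trans (Function.update_self _ _ _)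
    refine h _ (hw.trans (w'.le_bindS a)) (str w'.k) a ⟨fun w1 h1 t b ht w2 h2 => ?_, fun w1 h1 => ?_⟩
      _ le_rfl
    · change t.eval M w2.ρ w2.σ ∈ w2.σ w'.k ↔ b ∈ a
      rw [hσ w2 (h1.trans h2), ht w2 h2]
    · change M.len (w1.σ w'.k) = M.len a
      rw [hσ w1 h1]

variable (M) in
/-- Integers with a positive and a negative part. -/
structure IV where
  pos : NV M
  neg : NV M

namespace IV
noncomputable def zero : IV M := ⟨.zero, .zero⟩
noncomputable def one : IV M := ⟨.one, .zero⟩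
noncomputable def add (x y : IV M) : IV M := ⟨x.pos.add y.pos, x.neg.add y.neg⟩
def opp (x : IV M) : IV M := ⟨x.neg, x.pos⟩
noncomputable def shift (b : M.Num) (x : IV M) : IV M := ⟨x.pos.shift b, x.neg.shift b⟩
noncomputable def guard (p : Prop) (x : IV M) : IV M := ⟨x.pos.guard p, x.neg.guard p⟩
noncomputable def bd (x : IV M) : M.Num := x.pos.b + x.neg.b
/-- The value of `x`. -/
noncomputable def val (x : IV M) : ZM M := toZ x.pos.s - toZ x.neg.s
end IV

namespace NV
noncomputable def int (x : NV M) : IV M := ⟨x.row 0, x.row 1⟩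
noncomputable def at1 (x : NV M) (i : M.Num) : IV M := (x.row i).int
noncomputable def at2 (x : NV M) (i j : M.Num) : IV M := ((x.row i).row j).int
noncomputable def at3 (x : NV M) (i j k : M.Num) : IV M := (((x.row i).row j).row k).int
end NV

/-- The definable integer `X` denotes `x`. -/
structure IM (w : World M) (X : Int2) (x : IV M) : Prop where
  pos : NM w X.pos x.pos
  neg : NM w X.neg x.neg

namespace IV

theorem val_zero : (zero : IV M).val = 0 := by simp [val, zero]
theorem val_add (x y : IV M) : (x.add y).val = x.val + y.val := by
  simp only [val, add, NV.add, map_add]; abel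
theorem val_opp (x : IV M) : x.opp.val = - x.val := by simp [val, opp]
theorem val_shift (b : M.Num) (x : IV M) : (x.shift b).val = sh b x.val :=
  (sh_toZ_sub _ _ _).symm
theorem val_guard (p : Prop) (x : IV M) : (x.guard p).val = zguard p x.val := by
  simp only [val, guard, NV.guard, toZ_guard, zguard_sub]

end IV

namespace IM
variable {w : World M} {X Y : Int2} {x y : IV M} {N : Nat2} {n : NV M} {t s r : Term}
  {a b c : M.Num} {φ : Fml} {p : Prop}

theorem mono {w' : World M} (h : IM w X x) (hw : w ≤ w') : IM w' X x :=
  ⟨h.pos.mono hw, h.neg.mono hw⟩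
theorem zero : IM w .zero (IV.zero (M := M)) := ⟨.zero, .zero⟩
theorem one : IM w .one (IV.one (M := M)) := ⟨.one, .zero⟩
theorem add (hX : IM w X x) (hY : IM w Y y) : IM w (X.add Y) (x.add y) :=
  ⟨hX.pos.add hY.pos, hX.neg.add hY.neg⟩
theorem opp (hX : IM w X x) : IM w X.opp x.opp := ⟨hX.neg, hX.pos⟩
theorem shift (hX : IM w X x) (ht : TM w t a) : IM w (X.shift t) (x.shift a) :=
  ⟨hX.pos.shift ht, hX.neg.shift ht⟩
theorem guard (h : FM w φ p) (hX : IM w X x) : IM w (X.guard φ) (x.guard p) :=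
  ⟨.guard h hX.pos, .guard h hX.neg⟩
theorem bd (hX : IM w X x) : TM w X.bd x.bd := hX.pos.bd.add hX.neg.bd
theorem eqv (hX : IM w X x) (hY : IM w Y y) : FM w (X.eqv Y) (x.val = y.val) :=
  ((hX.pos.add hY.neg).eqv (hY.pos.add hX.neg)).congr toZ_sub_eq_iff.symm
theorem int (h : NM w N n) : IM w N.int n.int := ⟨h.row .zero, h.row .one⟩
theorem at1 (h : NM w N n) (ht : TM w t a) : IM w (N.at1 t) (n.at1 a) := .int (h.row ht)
theorem at2 (h : NM w N n) (ht : TM w t a) (hs : TM w s b) : IM w (N.at2 t s) (n.at2 a b) :=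
  .int ((h.row ht).row hs)
theorem at3 (h : NM w N n) (ht : TM w t a) (hs : TM w s b) (hr : TM w r c) :
    IM w (N.at3 t s r) (n.at3 a b c) := .int (((h.row ht).row hs).row hr)

end IM

/-! ### Semantic versions of the definitions -/

namespace IV

def isTable (x y : IV M) (W : NV M) : Prop :=
  (W.at1 0).val = 0 ∧ ∀ b < y.bd, (W.at1 (b + 1)).val =
    (W.at1 b).val + zguard (b ∈ y.pos.s) (sh b x.val) - zguard (b ∈ y.neg.s) (sh b x.val)

def isMul (x y z : IV M) : Prop := ∃ W : M.Str, isTable x y (.ofStr W) ∧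
  z.val = ((NV.ofStr W).at1 y.bd).val

def isDot (n : M.Num) (a b : M.Num → IV M) (c : IV M) (T : NV M) : Prop :=
  (∀ k < n, isTable (a k) (b k) ((T.row 0).row k)) ∧
  ((T.row 1).at1 0).val = 0 ∧
  (∀ k < n, ((T.row 1).at1 (k + 1)).val =
    ((T.row 1).at1 k).val + (((T.row 0).row k).at1 (b k).bd).val) ∧
  c.val = ((T.row 1).at1 n).val

end IV

variable {w : World M}

theorem FM.isTable {X Y : Int2} {x y : IV M} {W : Nat2} {v : NV M} (hX : IM w X x) (hY : IM w Y y)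
    (hW : NM w W v) : FM w (Int2.isTable X Y W) (x.isTable y v) := by
  refine FM.and (FM.congr ((IM.at1 hW .zero).eqv .zero) (by rw [IV.val_zero])) ?_
  refine FM.allLt hY.bd fun w1 h1 b b' hb => ?_
  refine FM.congr ((IM.at1 (hW.mono h1) (hb.add .one)).eqv
    (((IM.at1 (hW.mono h1) hb).add (.guard ((hY.mono h1).pos.bit w1 le_rfl b b' hb)
      ((hX.mono h1).shift hb))).add (.opp (.guard ((hY.mono h1).neg.bit w1 le_rfl b b' hb)
      ((hX.mono h1).shift hb))))) ?_
  simp only [IV.val_add, IV.val_opp, IV.val_guard, IV.val_shift, sub_eq_add_neg]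

theorem FM.isMul {X Y Z : Int2} {x y z : IV M} (hX : IM w X x) (hY : IM w Y y) (hZ : IM w Z z) :
    FM w (Int2.isMul X Y Z) (x.isMul y z) :=
  FM.ex fun _ h _ _ hW => (FM.isTable (hX.mono h) (hY.mono h) hW).and
    ((hZ.mono h).eqv (.at1 hW (hY.mono h).bd))

theorem FM.isDot {n : Term} {n' : M.Num} {a b : Term → Int2} {a' b' : M.Num → IV M} {C : Int2}
    {c : IV M} {T : Nat2} {v : NV M} (hn : TM w n n')
    (ha : ∀ w', w ≤ w' → ∀ t x, TM w' t x → IM w' (a t) (a' x))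
    (hb : ∀ w', w ≤ w' → ∀ t x, TM w' t x → IM w' (b t) (b' x))
    (hC : IM w C c) (hT : NM w T v) : FM w (Int2.isDot n a b C T) (IV.isDot n' a' b' c v) := by
  refine FM.and (FM.allLt hn fun w1 h1 k k' hk => FM.isTable (ha w1 h1 k k' hk) (hb w1 h1 k k' hk)
    (((hT.mono h1).row .zero).row hk)) <| FM.and (FM.congr ((IM.at1 (hT.row .one) .zero).eqv .zero)
    (by rw [IV.val_zero])) <| FM.and (FM.allLt hn fun w1 h1 k k' hk => ?_)
    (hC.eqv (.at1 (hT.row .one) hn))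
  refine FM.congr ((IM.at1 ((hT.mono h1).row .one) (hk.add .one)).eqv
    ((IM.at1 ((hT.mono h1).row .one) hk).add (.at1 (((hT.mono h1).row .zero).row hk)
      (hb w1 h1 k k' hk).bd))) ?_
  rw [IV.val_add]

def isMatMul' (n : M.Num) (A B C : M.Num → M.Num → IV M) : Prop := ∃ T : M.Str,
  ∀ i < n, ∀ j < n, IV.isDot n (fun k => A i k) (fun k => B k j) (C i j)
    (((NV.ofStr T).row i).row j)

theorem FM.isMatMul {n : Term} {n' : M.Num} {A B C : Term → Term → Int2}
    {A' B' C' : M.Num → M.Num → IV M} (hn : TM w n n')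
    (hA : ∀ w', w ≤ w' → ∀ t x s y, TM w' t x → TM w' s y → IM w' (A t s) (A' x y))
    (hB : ∀ w', w ≤ w' → ∀ t x s y, TM w' t x → TM w' s y → IM w' (B t s) (B' x y))
    (hC : ∀ w', w ≤ w' → ∀ t x s y, TM w' t x → TM w' s y → IM w' (C t s) (C' x y)) :
    FM w (isMatMul n A B C) (isMatMul' n' A' B' C') :=
  FM.ex fun _ h1 _ _ hT => FM.allLt (hn.mono h1) fun _ h2 _ _ hi =>
    FM.allLt (hn.mono (h1.trans h2)) fun w3 h3 _ _ hj =>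
      have h := h1.trans (h2.trans h3)
      FM.isDot (hn.mono h) (fun w4 h4 _ _ hk => hA w4 (h.trans h4) _ _ _ _ (hi.mono (h3.trans h4)) hk)
        (fun w4 h4 _ _ hk => hB w4 (h.trans h4) _ _ _ _ hk (hj.mono h4))
        (hC w3 h _ _ _ _ (hi.mono h3) hj) (((hT.mono (h2.trans h3)).row (hi.mono h3)).row hj)

def isMatPow' (n : M.Num) (X : NV M) (m : M.Num) (Y : NV M) : Prop := ∃ S T : M.Str,
  (∀ i < n, ∀ j < n, (i = j → ((NV.ofStr S).at3 0 i j).val = IV.one.val) ∧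
    (¬ i = j → ((NV.ofStr S).at3 0 i j).val = IV.zero.val)) ∧
  (∀ e < m, ∀ i < n, ∀ j < n, IV.isDot n (fun k => (NV.ofStr S).at3 e i k) (fun k => X.at2 k j)
    ((NV.ofStr S).at3 (e + 1) i j) ((((NV.ofStr T).row e).row i).row j)) ∧
  (∀ i < n, ∀ j < n, (Y.at2 i j).val = ((NV.ofStr S).at3 m i j).val)

theorem FM.isMatPow {n m : Term} {n' m' : M.Num} {X Y : Nat2} {x y : NV M} (hn : TM w n n')
    (hX : NM w X x) (hm : TM w m m') (hY : NM w Y y) :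
    FM w (isMatPow n X m Y) (isMatPow' n' x m' y) := by
  refine FM.ex fun w1 h1 S S' hS => FM.ex fun w2 h2 T T' hT => ?_
  replace hS := hS.mono h2
  replace hn := hn.mono (h1.trans h2)
  replace hm := hm.mono (h1.trans h2)
  replace hX := hX.mono (h1.trans h2)
  replace hY := hY.mono (h1.trans h2)
  refine FM.and (FM.allLt hn fun w3 h3 i i' hi => FM.allLt (hn.mono h3) fun w4 h4 j j' hj => ?_) <|
    FM.and (FM.allLt hm fun w3 h3 e e' he => FM.allLt (hn.mono h3) fun w4 h4 i i' hi =>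
      FM.allLt (hn.mono (h3.trans h4)) fun w5 h5 j j' hj => ?_)
    (FM.allLt hn fun w3 h3 i i' hi => FM.allLt (hn.mono h3) fun w4 h4 j j' hj => ?_)
  · replace hS := hS.mono (h3.trans h4)
    have hij := FM.eqN (hi.mono h4) hj
    exact (hij.imp ((IM.at3 hS .zero (hi.mono h4) hj).eqv .one)).and
      (hij.not.imp ((IM.at3 hS .zero (hi.mono h4) hj).eqv .zero))
  · replace he := he.mono (h4.trans h5)
    replace hi := hi.mono h5
    have h := h3.trans (h4.trans h5)
    exact FM.isDot (hn.mono h)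
      (fun w6 h6 k k' hk => .at3 (hS.mono (h.trans h6)) (he.mono h6) (hi.mono h6) hk)
      (fun w6 h6 k k' hk => .at2 (hX.mono (h.trans h6)) hk (hj.mono h6))
      (.at3 (hS.mono h) (he.add .one) hi hj) ((((hT.mono h).row he).row hi).row hj)
  · exact (IM.at2 (hY.mono (h3.trans h4)) (hi.mono h4) hj).eqv
      (.at3 (hS.mono (h3.trans h4)) (hm.mono (h3.trans h4)) (hi.mono h4) hj)

theorem sat_close {φ : Fml} {p : Prop} (h : ∀ w : World M, FM w φ p) (ρ : ℕ → M.Num)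
    (σ : ℕ → M.Str) : φ.close.Sat M ρ σ ↔ p := h ⟨0, ρ, σ⟩ _ le_rfl

theorem models_close {φ : Fml} {p : Prop} (h : ∀ w : World M, FM w φ p) :
    M.Models φ.close ↔ p :=
  ⟨fun h' => (sat_close h (fun _ => 0) fun _ => 0).1 (h' _ _), fun hp ρ σ => (sat_close h ρ σ).2 hp⟩

/-- The value of this axiom lies in the witnesses `S` and `T` hidden in `isMatPow'`: they hold every
intermediate power, every multiplication table and every partial sum, and products and sums are read
off from them. -/
theorem exists_isMatPow (n : M.Num) (X : M.Str) (m : M.Num) :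
    ∃ Y : M.Str, isMatPow' n (.ofStr X) m (.ofStr Y) := by
  have h := VModel.models (M := M) powAxiom (Or.inr (Or.inr rfl))
  rw [powAxiom, models_close (p := ∀ (n : M.Num) (X : M.Str) (m : M.Num),
    ∃ Y : M.Str, isMatPow' n (.ofStr X) m (.ofStr Y)) fun w => ?_] at h
  · exact h n X m
  · exact FM.allN fun w1 h1 n n' hn => FM.all fun w2 h2 X X' hX => FM.allN fun w3 h3 m m' hm =>
      FM.ex fun w4 h4 Y Y' hY => FM.isMatPow (hn.mono (h2.trans (h3.trans h4)))
        (hX.mono (h3.trans h4)) (hm.mono h4) hY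

end Semantics

/-! ## Multiplication -/

section Product
variable {M : Struct.{u}} [VModel M]

theorem NV.val_at1 (x : NV M) (i : M.Num) : (x.at1 i).val = ival (Struct.row x.s i) := rfl
theorem NV.val_at2 (x : NV M) (i j : M.Num) :
    (x.at2 i j).val = ival (Struct.row (Struct.row x.s i) j) := rfl
theorem NV.val_at3 (x : NV M) (i j k : M.Num) :
    (x.at3 i j k).val = ival (Struct.row (Struct.row (Struct.row x.s i) j) k) := rfl

theorem IV.lt_bd_pos (x : IV M) {i : M.Num} (h : i ∈ x.pos.s) : i < x.bd :=
  (x.pos.lt i h).trans_le le_self_add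
theorem IV.lt_bd_neg (x : IV M) {i : M.Num} (h : i ∈ x.neg.s) : i < x.bd :=
  (x.neg.lt i h).trans_le le_add_self

/-- `F t = x · t` for all binary numbers `t`. -/
structure IsStar (x : ZM M) (F : M.Str → ZM M) : Prop where
  code : ∀ t, LZ fun b => F (restrict t b)
  zero : F 0 = 0
  succ : ∀ t b, F (restrict t (b + 1)) = F (restrict t b) + zguard (b ∈ t) (sh b x)

/-- A table runs through the bits of the positive and the negative part at the same time. By
induction its entry `b` is the difference of the products with the two truncations at `b`, and the
bound of `y` exceeds all bits of both. -/
theorem IsStar.isTable {x : IV M} {F : M.Str → ZM M} (hF : IsStar x.val F) {y : IV M} {W : NV M}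
    (h : x.isTable y W) : (W.at1 y.bd).val = F y.pos.s - F y.neg.s := by
  have h1 := hF.code y.pos.s
  have h2 := hF.code y.neg.s
  have h3 : LZ fun b => (W.at1 b).val := by simp only [NV.val_at1]; infer_instance
  have key := LZ.induction (f := fun b => (W.at1 b).val)
    (g := fun b => F (restrict y.pos.s b) - F (restrict y.neg.s b)) (n := y.bd) inferInstance
    inferInstance (by simp only [restrict_zero, hF.zero, h.1, sub_zero]) (fun b hb ih => by
      simp only [h.2 b hb, hF.succ]
      rw [ih]; abel) y.bd le_rfl
  rw [restrict_of_len_le (len_le fun i => y.lt_bd_pos),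
    restrict_of_len_le (len_le fun i => y.lt_bd_neg)] at key
  exact key

theorem toZ_restrict_succ (t : M.Str) (b : M.Num) : (toZ (restrict t (b + 1)) : ZM M) =
    toZ (restrict t b) + zguard (b ∈ t) (toZ (shift b 1)) := by
  rw [restrict_succ, map_add, toZ_guard]

/-- The products with 1 and 0 can be written down without any multiplication. They evaluate the
inner products with rows of the unit matrix that lead to the first power of a matrix. -/
theorem isStar_one : IsStar (toZ (1 : M.Str)) (fun t => toZ t) where
  code _ := inferInstance
  zero := map_zero _
  succ t b := by rw [toZ_restrict_succ, sh_toZ]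

theorem isStar_zero : IsStar (0 : ZM M) (fun _ => 0) where
  code _ := inferInstance
  zero := rfl
  succ t b := by simp [zguard]

/-- The string of a matrix with given entries. -/
theorem exists_matrix (N : M.Num) (s : M.Num → M.Num → M.Str)
    [hs : LS fun d => s (snd d) (fst d)] :
    ∃ X : M.Str, ∀ i < N, ∀ j < N, row (row X i) j = s i j := by
  have h1 : ∀ c, LS (s c) := fun c => by
    have := hs.comp fun i => kpair i c
    simpa using this
  exact ⟨mkRows N fun i => mkRows N (s i), fun i hi j hj => by rw [row_mkRows hi, row_mkRows hj]⟩

theorem IV.val_one : (IV.one : IV M).val = toZ 1 := by simp [IV.val, IV.one, NV.one, NV.zero]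

/-- The sequence of products of `x` with the truncations of `t` is found inside the computation of
the square of a 2 × 2 matrix. -/
theorem exists_table (x : ZM M) (t : M.Str) : ∃ V : M.Num → ZM M, LZ V ∧ V 0 = 0 ∧
    ∀ b, V (b + 1) = V b + zguard (b ∈ t) (sh b x) := by
  classical
  obtain ⟨x', hx⟩ := exists_ival x
  -- Rows `(x, x)` and `(t, t)`. The entry (0, 0) of the square is an inner product whose second
  -- summand is `x · t`, so its table is the one wanted.
  obtain ⟨X, hX⟩ := exists_matrix (1 + 1 : M.Num) fun i _ => if i = 0 then x' else mk2 t 0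
  obtain ⟨Y, S, T, h0, h1, -⟩ := exists_isMatPow (1 + 1) X (1 + 1)
  have l0 : (0 : M.Num) < 1 + 1 := (zero_lt_one).trans (lt_succ_self 1)
  have l1 : (1 : M.Num) < 1 + 1 := lt_succ_self 1
  have d1 := h1 0 l0 0 l0 1 l1
  obtain ⟨a1, a2, a3, a4⟩ := d1
  have e0 := a3 0 l0
  have e1 := a3 1 l1
  rw [zero_add] at e0
  rw [a2, zero_add] at e0
  have f0 : IsStar ((NV.ofStr S).at3 0 0 0).val (fun t => toZ t) := by
    rw [(h0 0 l0 0 l0).1 rfl, IV.val_one]; exact isStar_one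
  have f1 : IsStar ((NV.ofStr S).at3 0 0 1).val (fun _ => 0) := by
    rw [(h0 0 l0 1 l1).2 zero_ne_one, IV.val_zero]; exact isStar_zero
  have g0 := f0.isTable (a1 0 l0)
  have g1 := f1.isTable (a1 1 l1)
  have hS : ((NV.ofStr S).at3 (0 + 1) 0 1).val = x := by
    rw [a4, e1, e0, g0, g1, sub_zero, add_zero]
    change ival (row (row X 0) 1) = x
    rw [hX 0 l0 1 l1, if_pos rfl, hx]
  rw [zero_add] at hS
  obtain ⟨W0, W1⟩ := (h1 1 l1 0 l0 0 l0).1 1 l1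
  have hp : ((NV.ofStr X).at2 1 0).pos.s = t := by
    change row (row (row X 1) 0) 0 = t
    rw [hX 1 l1 0 l0, if_neg one_ne_zero, row_mk2_zero]
  have hn : ((NV.ofStr X).at2 1 0).neg.s = 0 := by
    change row (row (row X 1) 0) 1 = 0
    rw [hX 1 l1 0 l0, if_neg one_ne_zero, row_mk2_one]
  have hbd := fun i => ((NV.ofStr X).at2 1 0).lt_bd_pos (i := i)
  generalize ((NV.ofStr X).at2 1 0).bd = B at *
  simp only [hS, hp, hn, NV.val_at1] at W0 W1 hbd
  generalize ((((NV.ofStr T).row 1).row 0).row 0) = W at *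
  generalize ((W.row 0).row 1).s = V at *
  -- The table is specified only up to `B`. Beyond it `t` has no bits, so the sequence is continued
  -- as a constant.
  refine ⟨fun b => if b ≤ B then ival (row V b) else ival (row V B), inferInstance, ?_, fun b => ?_⟩
  · beta_reduce
    rw [if_pos zero_le, W0]
  · beta_reduce
    rcases lt_or_ge b B with h | h
    · rw [if_pos (add_one_le_iff.2 h), if_pos h.le, W1 b h, zguard_false (not_mem_zero b), sub_zero]
    · rw [if_neg (not_le.2 (lt_add_one_iff.2 h)), zguard_false fun h' => absurd (hbd b h') (not_lt.2 h),
        add_zero]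
      split
      · rw [le_antisymm ‹_› h]
      · rfl

/-- The tables for different `t` are chosen independently. They cohere because entry `b` of a table
depends only on the bits below `b`, and because tables are constant beyond the length of `t`. -/
theorem exists_isStar (x : ZM M) : ∃ F, IsStar x F := by
  choose V hV V0 V1 using exists_table x
  have key : ∀ t b, V (restrict t b) (M.len (restrict t b)) = V t b := by
    intro t b
    have h1 : ∀ c ≤ b, V (restrict t b) c = V t c :=
      LZ.induction (hV _) (hV _) (by rw [V0, V0]) fun c hc ih => by
        rw [V1, V1, ih]
        congr 2
        rw [mem_restrict]
        exact propext ⟨fun h => h.2, fun h => ⟨hc, h⟩⟩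
    have h2 : M.len (restrict t b) ≤ b := len_le fun i hi => (mem_restrict.1 hi).1
    rw [← h1 b le_rfl]
    obtain ⟨d, hd⟩ := le_iff_add.1 h2
    have h3 : LZ fun d => V (restrict t b) (M.len (restrict t b) + d) := (hV (restrict t b)).comp _
    have h4 := LZ.induction (g := fun _ => V (restrict t b) (M.len (restrict t b))) (n := d) h3
      inferInstance (by simp) (fun a _ ih => by
        rw [← add_assoc, V1, ih, zguard_false fun h => absurd (lt_len h) (not_lt.2 le_self_add),
          add_zero]) d le_rfl
    beta_reduce at h4
    rw [← hd] at h4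
    exact h4.symm
  refine ⟨fun t => V t (M.len t), fun t => ?_, ?_, fun t b => ?_⟩
  · simp only [key]; exact hV t
  · have h : M.len (0 : M.Str) = 0 := le_antisymm (len_le fun i hi => absurd hi (not_mem_zero i)) zero_le
    rw [h, V0]
  · rw [key, key, V1]

/-- The product of an integer and a binary number. -/
noncomputable def star (x : ZM M) : M.Str → ZM M := (exists_isStar x).choose

theorem isStar_star (x : ZM M) : IsStar x (star x) := (exists_isStar x).choose_spec

theorem star_zero (x : ZM M) : star x 0 = 0 := (isStar_star x).zero
theorem star_restrict_succ (x : ZM M) (t : M.Str) (b : M.Num) :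
    star x (restrict t (b + 1)) = star x (restrict t b) + zguard (b ∈ t) (sh b x) :=
  (isStar_star x).succ t b

instance LZ.star_restrict (x : ZM M) (t : M.Str) : LZ fun b => star x (restrict t b) :=
  (isStar_star x).code t

theorem str_induction {A B : M.Str → ZM M} (t : M.Str) (hA : LZ fun b => A (restrict t b))
    (hB : LZ fun b => B (restrict t b)) (h0 : A 0 = B 0)
    (h1 : ∀ b, A (restrict t b) = B (restrict t b) →
      A (restrict t (b + 1)) = B (restrict t (b + 1))) : A t = B t := by
  have := LZ.induction hA hB (n := M.len t) (by simpa only [restrict_zero] using h0)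
    (fun b _ => h1 b) _ le_rfl
  simpa only [restrict_of_len_le (_root_.le_refl (M.len t))] using this

/-- Uniqueness of the solution of the bitwise recursion. An identity for `star` in its left argument
is thus proved by checking that the other side satisfies the recursion. -/
theorem IsStar.eq_star {x : ZM M} {F : M.Str → ZM M} (hF : IsStar x F) (t : M.Str) :
    F t = star x t :=
  str_induction t (hF.code t) inferInstance (by rw [hF.zero, star_zero]) fun b h => by
    rw [hF.succ, star_restrict_succ, h]

theorem star_add_left (x y : ZM M) (t : M.Str) : star (x + y) t = star x t + star y t := by
  refine (IsStar.eq_star (F := fun t => star x t + star y t) ⟨fun t => inferInstance, ?_, ?_⟩ t).symm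
  · simp [star_zero]
  · intro t b
    rw [star_restrict_succ, star_restrict_succ, map_add, zguard_add]
    abel

theorem star_sh (c : M.Num) (x : ZM M) (t : M.Str) : star (sh c x) t = sh c (star x t) := by
  refine (IsStar.eq_star (F := fun t => sh c (star x t)) ⟨fun t => inferInstance, ?_, ?_⟩ t).symm
  · simp [star_zero]
  · intro t b
    rw [star_restrict_succ, map_add, sh_sh, add_comm b c, ← sh_sh]
    congr 1
    unfold zguard
    split <;> simp

/-- The invariant at position `b`: the product with the truncated sum, plus `2^b x` if there is a
carry into `b`, equals the sum of the products with the truncated summands. Beyond both lengths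
there is no carry. -/
theorem star_add_right (x : ZM M) (s t : M.Str) : star x (s + t) = star x s + star x t := by
  have key := LZ.induction
    (f := fun b => star x (restrict (s + t) b) + zguard (Carry s t b) (sh b x))
    (g := fun b => star x (restrict s b) + star x (restrict t b)) (n := M.len s + M.len t)
    inferInstance inferInstance ?_ ?_ _ le_rfl
  · simpa only [zguard_false (not_carry_of_ge (_root_.le_refl (M.len s + M.len t))), add_zero,
      restrict_of_len_le (len_add_le s t), restrict_of_len_le (X := s) (b := M.len s + M.len t)
      le_self_add, restrict_of_len_le (X := t) (b := M.len s + M.len t) le_add_self] using key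
  · simp only [restrict_zero, star_zero, zguard_false (not_carry_zero s t), add_zero]
  · intro b _ ih
    simp only [star_restrict_succ, mem_add, carry_succ, sh_succ] at ih ⊢
    rw [show star x (restrict s b) + zguard (b ∈ s) (sh b x) +
      (star x (restrict t b) + zguard (b ∈ t) (sh b x)) = star x (restrict s b) +
      star x (restrict t b) + (zguard (b ∈ s) (sh b x) + zguard (b ∈ t) (sh b x)) by abel, ← ih]
    generalize (b ∈ s) = p, (b ∈ t) = q, Carry s t b = c
    by_cases p <;> by_cases q <;> by_cases c <;> simp_all [zguard, add_assoc]

theorem star_toZ_one (t : M.Str) : star (toZ 1) t = toZ t := (isStar_one.eq_star t).symm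

theorem star_one (x : ZM M) : star x 1 = x := by
  have h := star_restrict_succ x 1 0
  rwa [restrict_zero, star_zero, zero_add, zguard_true (mem_one.2 rfl), sh_zero, zero_add,
    restrict_of_len_le (len_le fun i hi => by rw [mem_one.1 hi]; exact zero_lt_one)] at h

/-- Multiplication by `x` as an additive map. -/
noncomputable def mulHom (x : ZM M) : ZM M →+ ZM M :=
  Algebra.GrothendieckAddGroup.lift ⟨⟨star x, star_zero x⟩, star_add_right x⟩

noncomputable instance : Mul (ZM M) := ⟨fun x y => mulHom x y⟩

theorem mul_toZ (x : ZM M) (t : M.Str) : x * toZ t = star x t := by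
  have := DFunLike.congr_fun (Algebra.GrothendieckAddGroup.lift.symm_apply_apply
    (⟨⟨star x, star_zero x⟩, star_add_right x⟩ : M.Str →+ ZM M)) t
  exact this

theorem z_mul_add (x y z : ZM M) : x * (y + z) = x * y + x * z := map_add (mulHom x) y z
theorem z_mul_sub (x y z : ZM M) : x * (y - z) = x * y - x * z := map_sub (mulHom x) y z
theorem z_mul_zero (x : ZM M) : x * 0 = 0 := map_zero (mulHom x)

theorem z_add_mul (x y z : ZM M) : (x + y) * z = x * z + y * z := by
  obtain ⟨p, q, rfl⟩ := exists_toZ_sub z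
  simp only [z_mul_sub, mul_toZ, star_add_left]
  abel

theorem sh_mul (c : M.Num) (x y : ZM M) : sh c x * y = sh c (x * y) := by
  obtain ⟨p, q, rfl⟩ := exists_toZ_sub y
  simp only [z_mul_sub, mul_toZ, star_sh, map_sub]

theorem IV.isTable.eval {x y : IV M} {W : NV M} (h : x.isTable y W) :
    (W.at1 y.bd).val = x.val * y.val := by
  rw [(isStar_star x.val).isTable h, IV.val, IV.val, z_mul_sub, mul_toZ, mul_toZ]

noncomputable instance : One (ZM M) := ⟨toZ 1⟩
theorem z_one_def : (1 : ZM M) = toZ 1 := rfl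
theorem z_one_mul (x : ZM M) : 1 * x = x := by
  obtain ⟨p, q, rfl⟩ := exists_toZ_sub x
  rw [z_mul_sub, mul_toZ, mul_toZ, z_one_def, star_toZ_one, star_toZ_one]
theorem z_mul_one (x : ZM M) : x * 1 = x := by rw [z_one_def, mul_toZ, star_one]
theorem z_zero_mul (x : ZM M) : 0 * x = 0 := by
  have := z_add_mul 0 0 x
  simpa using this

/-- A dot product with a row of the unit matrix. -/
theorem IV.isDot.eval_unit {n i : M.Num} (hi : i < n) {a b : M.Num → IV M} {c : IV M} {T : NV M}
    (h : IV.isDot n a b c T) (h1 : (a i).val = 1)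
    (h0 : ∀ k < n, k ≠ i → (a k).val = 0) : c.val = (b i).val := by
  classical
  obtain ⟨t, p0, p1, e⟩ := h
  rw [e]
  have h3 : LZ fun b => ((T.row 1).at1 b).val := by simp only [NV.val_at1]; infer_instance
  have key := LZ.induction (f := fun k => ((T.row 1).at1 k).val)
    (g := fun k => if k ≤ i then 0 else (b i).val) (n := n) h3 inferInstance
    (by simp [p0]) (fun k hk ih => by
      rw [p1 k hk, ih, (t k hk).eval]
      rcases lt_trichotomy k i with h | rfl | h
      · rw [if_pos h.le, if_pos (add_one_le_iff.2 h), h0 k hk h.ne, z_zero_mul, zero_add]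
      · rw [if_pos le_rfl, if_neg (not_le.2 (lt_succ_self k)), h1, z_one_mul, zero_add]
      · rw [if_neg (not_le.2 h), if_neg (not_le.2 (h.trans (lt_succ_self k))), h0 k hk h.ne',
          z_zero_mul, add_zero]) n le_rfl
  rw [key, if_neg (not_le.2 hi)]

/-- In a computation of powers of `X`, the first power is `X`. -/
theorem isMatPow_one {n : M.Num} {X S T : M.Str}
    (h0 : ∀ i < n, ∀ j < n, (i = j → ((NV.ofStr S).at3 0 i j).val = IV.one.val) ∧
      (¬ i = j → ((NV.ofStr S).at3 0 i j).val = IV.zero.val))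
    (h1 : ∀ i < n, ∀ j < n, IV.isDot n (fun k => (NV.ofStr S).at3 0 i k)
      (fun k => (NV.ofStr X).at2 k j) ((NV.ofStr S).at3 1 i j) ((((NV.ofStr T).row 0).row i).row j)) :
    ∀ i < n, ∀ j < n, ((NV.ofStr S).at3 1 i j).val = ((NV.ofStr X).at2 i j).val :=
  fun i hi j hj => (h1 i hi j hj).eval_unit hi
    (by rw [(h0 i hi i hi).1 rfl, IV.val_one]; rfl) fun k hk hne => by
      rw [(h0 i hi k hk).2 hne.symm, IV.val_zero]

/-- All products `f c * g c` with `c < N` come from one matrix square. Only after this may a product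
whose left factor varies occur in an induction, as commutativity requires. -/
instance LZ.mul {f g : M.Num → ZM M} [hf : LZ f] [hg : LZ g] : LZ fun c => f c * g c := by
  classical
  refine LZ.of_local fun N => ?_
  obtain ⟨F, hF⟩ := hf.code N
  obtain ⟨G, hG⟩ := hg.code N
  -- Row `c < N` is constantly `f c`, and row `N + c` is constantly `g c`. In the inner product for
  -- the entry `(c, 0)` of the square, the summand with index `N + c` is `f c * g c`.
  obtain ⟨X, hX⟩ := exists_matrix (N + N) fun i _ => if i < N then row F i else row G (i - N)
  obtain ⟨Y, S, T, h0, h1, -⟩ := exists_isMatPow (N + N) X (1 + 1)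
  have l0 : (0 : M.Num) < 1 + 1 := (zero_lt_one).trans (lt_succ_self 1)
  have l1 : (1 : M.Num) < 1 + 1 := lt_succ_self 1
  have hS := isMatPow_one h0 (by simpa using h1 0 l0)
  -- Both parts of an entry of `X` inherit the bound `M.len X`, so every table for a product with
  -- such an entry ends at `M.len X + M.len X`.
  refine ⟨fun c => ival (row (row (row (row (row (row T 1) c) 0) 0) (N + c))
    (M.len X + M.len X)), inferInstance, fun c hc => ?_⟩
  have hN : 0 < N := zero_le.trans_lt hc
  have hc1 : c < N + N := hc.trans_le le_self_add
  have hc2 : N + c < N + N := (add_lt_add_iff_left N).2 hc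
  have hN2 : 0 < N + N := hN.trans_le le_self_add
  have := ((h1 1 l1 c hc1 0 hN2).1 (N + c) hc2).eval
  rw [hS c hc1 _ hc2, NV.val_at2, NV.val_at2] at this
  change ival _ = ival (row (row X c) (N + c)) * ival (row (row X (N + c)) 0) at this
  rw [hX c hc1 _ hc2, hX _ hc2 _ hN2, if_pos hc, if_neg (not_lt.2 le_self_add),
    add_tsub_cancel_left, hF c hc, hG c hc] at this
  exact this

/-- Induction on the bits of one binary factor: a shift can be pulled out of the left factor by
`star_sh`, and 1 is a left unit. Integers follow by distributivity. -/
theorem z_mul_comm (x y : ZM M) : x * y = y * x := by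
  have key : ∀ s t : M.Str, (toZ s * toZ t : ZM M) = toZ t * toZ s := by
    intro s t
    refine str_induction (A := fun t => toZ s * toZ t) (B := fun t => toZ t * toZ s) t inferInstance
      inferInstance ?_ fun b ih => ?_
    · simp only [map_zero, z_mul_zero, z_zero_mul]
    · beta_reduce at ih ⊢
      rw [mul_toZ, star_restrict_succ, ← mul_toZ, ih, toZ_restrict_succ, z_add_mul]
      congr 1
      by_cases h : b ∈ t
      · rw [zguard_true h, zguard_true h, mul_toZ, ← sh_toZ, star_sh, star_toZ_one]
      · rw [zguard_false h, zguard_false h, z_zero_mul]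
  obtain ⟨p, q, rfl⟩ := exists_toZ_sub x
  obtain ⟨p', q', rfl⟩ := exists_toZ_sub y
  have h : ∀ a b c : ZM M, (a - b) * c = a * c - b * c := fun a b c => by
    rw [eq_sub_iff_add_eq, ← z_add_mul, sub_add_cancel]
  simp only [z_mul_sub, h, key]
  abel

/-- Induction on the bits of the third factor. A shift is moved from right to left by commutativity.
-/
theorem z_mul_assoc (x y z : ZM M) : x * y * z = x * (y * z) := by
  have key : ∀ t : M.Str, x * y * toZ t = x * (y * toZ t) := by
    intro t
    refine str_induction (A := fun t => x * y * toZ t) (B := fun t => x * (y * toZ t)) t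
      inferInstance inferInstance ?_ fun b ih => ?_
    · simp only [map_zero, z_mul_zero]
    · beta_reduce at ih ⊢
      rw [mul_toZ, star_restrict_succ, ← mul_toZ, ih, mul_toZ y, mul_toZ y, star_restrict_succ,
        z_mul_add]
      congr 1
      by_cases h : b ∈ t
      · rw [zguard_true h, zguard_true h, z_mul_comm x (sh b y), sh_mul, z_mul_comm y x]
      · rw [zguard_false h, zguard_false h, z_mul_zero]
  obtain ⟨p, q, rfl⟩ := exists_toZ_sub z
  simp only [z_mul_sub, key]

noncomputable instance : CommRing (ZM M) where
  __ := (inferInstance : AddCommGroup (ZM M))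
  left_distrib := z_mul_add
  right_distrib := z_add_mul
  zero_mul := z_zero_mul
  mul_zero := z_mul_zero
  mul_assoc := z_mul_assoc
  one_mul := z_one_mul
  mul_one := z_mul_one
  mul_comm := z_mul_comm

theorem IV.isMul.eval {x y z : IV M} (h : x.isMul y z) : z.val = x.val * y.val := by
  obtain ⟨W, h1, h2⟩ := h
  rw [h2, h1.eval]

end Product

/-! ## Sums -/

section Sums
variable {M : Struct.{u}} [VModel M]

theorem LZ.comp2 {f : M.Num → M.Num → ZM M} (hf : LZ fun d => f (snd d) (fst d))
    (t s : M.Num → M.Num) [LF t] [LF s] : LZ fun c => f (t c) (s c) := by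
  simpa only [fst_kpair, snd_kpair] using hf.comp fun c => kpair (s c) (t c)

theorem LS.comp2 {f : M.Num → M.Num → M.Str} (hf : LS fun d => f (snd d) (fst d))
    (t s : M.Num → M.Num) [LF t] [LF s] : LS fun c => f (t c) (s c) := by
  simpa only [fst_kpair, snd_kpair] using hf.comp fun c => kpair (s c) (t c)

/-- The entry of the matrix coded by `X`. -/
noncomputable def ent (X : M.Str) (i j : M.Num) : ZM M := ival (row (row X i) j)

instance LZ.ent_comp {X : M.Str} {t s : M.Num → M.Num} [LF t] [LF s] :
    LZ fun c => ent X (t c) (s c) := by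
  unfold ent; infer_instance

/-- The entry of the three-dimensional array coded by `X`. -/
noncomputable def ent3 (X : M.Str) (i j k : M.Num) : ZM M := ival (row (row (row X i) j) k)

instance LZ.ent3_comp {X : M.Str} {t s r : M.Num → M.Num} [LF t] [LF s] [LF r] :
    LZ fun c => ent3 X (t c) (s c) (r c) := by
  unfold ent3; infer_instance

instance LZ.ent_self {X : M.Str} {i : M.Num} : LZ (ent X i) :=
  LZ.ent_comp (t := fun _ => i) (s := fun j => j)

instance LZ.ent3_self {X : M.Str} {i j : M.Num} : LZ (ent3 X i j) :=
  LZ.ent3_comp (t := fun _ => i) (s := fun _ => j) (r := fun k => k)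

theorem exists_ent (N N' : M.Num) (f : M.Num → M.Num → ZM M)
    [hf : LZ fun d => f (snd d) (fst d)] :
    ∃ X : M.Str, ∀ i < N, ∀ j < N', ent X i j = f i j := by
  obtain ⟨F, hF⟩ := hf.code (kpair N' N)
  refine ⟨mkRows N fun i => mkRows N' fun j => row F (kpair j i), fun i hi j hj => ?_⟩
  rw [ent, row_mkRows hi, row_mkRows hj, hF _ (kpair_lt hj hi.le), fst_kpair, snd_kpair]

theorem exists_ent3 (N N' N'' : M.Num) (f : M.Num → M.Num → M.Num → ZM M)
    [hf : LZ fun d => f (snd d) (snd (fst d)) (fst (fst d))] :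
    ∃ X : M.Str, ∀ i < N, ∀ j < N', ∀ k < N'', ent3 X i j k = f i j k := by
  obtain ⟨F, hF⟩ := hf.code (kpair (kpair N'' N') N)
  refine ⟨mkRows N fun i => mkRows N' fun j => mkRows N'' fun k => row F (kpair (kpair k j) i),
    fun i hi j hj k hk => ?_⟩
  rw [ent3, row_mkRows hi, row_mkRows hj, row_mkRows hk,
    hF _ (kpair_lt (kpair_lt hk hj.le) hi.le)]
  simp only [fst_kpair, snd_kpair]

theorem exists_partial_sums (f : M.Num → M.Num → ZM M) [hf : LZ fun d => f (snd d) (fst d)]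
    (N B : M.Num) : ∃ V : M.Num → M.Num → ZM M, LZ (fun d => V (snd d) (fst d)) ∧
      ∀ i < N, V i 0 = 0 ∧ ∀ k < B, V i (k + 1) = V i k + f i k := by
  classical
  have := hf.comp2 snd fun d => fst d - N
  -- Row `i < N` consists of `N` zeros followed by `f i 0, f i 1, …`, and the remaining rows are
  -- constantly 1. The inner product for the entry `(i, 0)` of the square then sums `f i`, and its
  -- partial sums appear shifted by `N`.
  obtain ⟨X, hX⟩ := exists_ent (N + B) (N + B)
    fun i d => if i < N then (if d < N then 0 else f i (d - N)) else 1
  obtain ⟨Y, S, T, h0, h1, -⟩ := exists_isMatPow (N + B) X (1 + 1)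
  have l0 : (0 : M.Num) < 1 + 1 := (zero_lt_one).trans (lt_succ_self 1)
  have l1 : (1 : M.Num) < 1 + 1 := lt_succ_self 1
  have hS := isMatPow_one h0 (by simpa using h1 0 l0)
  refine ⟨fun i k => ival (row (row (row (row (row T 1) i) 0) 1) (N + k)), inferInstance,
    fun i hi => ?_⟩
  have hi1 : i < N + B := hi.trans_le le_self_add
  have hN2 : 0 < N + B := zero_le.trans_lt hi1
  obtain ⟨t, p0, p1, -⟩ := h1 1 l1 i hi1 0 hN2
  have step : ∀ d < N + B, ival (row (row (row (row (row T 1) i) 0) 1) (d + 1)) =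
      ival (row (row (row (row (row T 1) i) 0) 1) d) + ent X i d * ent X d 0 := by
    intro d hd
    have := p1 d hd
    rw [(t d hd).eval, hS i hi1 d hd] at this
    exact this
  refine ⟨?_, fun k hk => ?_⟩
  · beta_reduce
    rw [add_zero]
    refine LZ.induction (f := fun d => ival (row (row (row (row (row T 1) i) 0) 1) d))
      (g := fun _ => 0) (n := N) inferInstance inferInstance p0 (fun a ha ih => ?_) N le_rfl
    have ha' : a < N + B := ha.trans_le le_self_add
    rw [step a ha', ih, hX i hi1 a ha', if_pos hi, if_pos ha, zero_mul, add_zero]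
  · have hk' : N + k < N + B := (add_lt_add_iff_left N).2 hk
    beta_reduce
    rw [← add_assoc, step _ hk', hX i hi1 _ hk', hX _ hk' 0 hN2, if_pos hi,
      if_neg (not_lt.2 le_self_add), if_neg (not_lt.2 le_self_add), add_tsub_cancel_left, mul_one]

theorem exists_psum (f : M.Num → ZM M) [hf : LZ f] (n : M.Num) :
    ∃ V : M.Num → ZM M, LZ V ∧ V 0 = 0 ∧ ∀ k < n, V (k + 1) = V k + f k := by
  have := hf.comp (fst : M.Num → M.Num)
  obtain ⟨V, h, h'⟩ := exists_partial_sums (fun _ k => f k) 1 n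
  exact ⟨V 0, h.comp2 (fun _ => 0) (fun k => k), h' 0 zero_lt_one⟩

open Classical in
/-- `∑_{k < n} f k` -/
noncomputable def psum (f : M.Num → ZM M) (n : M.Num) : ZM M :=
  if h : LZ f then (exists_psum f n).choose n else 0

/-- `psum f n` is defined from a sequence of partial sums that is chosen anew for every `n`. Since
the recursion has only one solution, any sequence of partial sums computes it. -/
theorem psum_eq {f V : M.Num → ZM M} [hf : LZ f] (hV : LZ V) {n : M.Num} (h0 : V 0 = 0)
    (h1 : ∀ k < n, V (k + 1) = V k + f k) {m : M.Num} (hm : m ≤ n) : psum f m = V m := by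
  rw [psum, dif_pos hf]
  obtain ⟨h, e0, e1⟩ := (exists_psum f m).choose_spec
  exact LZ.induction h hV (n := m) (by rw [e0, h0])
    (fun a ha ih => by rw [e1 a ha, h1 a (ha.trans_le hm), ih]) m le_rfl

theorem psum_zero (f : M.Num → ZM M) [LZ f] : psum f 0 = 0 := by
  obtain ⟨V, h, h0, h1⟩ := exists_psum f 0
  rw [psum_eq h h0 h1 le_rfl, h0]

theorem psum_succ (f : M.Num → ZM M) [LZ f] (n : M.Num) :
    psum f (n + 1) = psum f n + f n := by
  obtain ⟨V, h, h0, h1⟩ := exists_psum f (n + 1)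
  rw [psum_eq h h0 h1 le_rfl, psum_eq h h0 h1 (lt_succ_self n).le, h1 n (lt_succ_self n)]

instance LZ.psum_comp {f : M.Num → M.Num → ZM M} {t : M.Num → M.Num}
    [hf : LZ fun d => f (snd d) (fst d)] [ht : LF t] : LZ fun c => psum (f c) (t c) := by
  refine LZ.of_local fun N => ?_
  obtain ⟨B, hB⟩ := ht.bdd N
  obtain ⟨V, h, h'⟩ := exists_partial_sums f N B
  refine ⟨_, h.comp2 (fun c => c) t, fun c hc => ?_⟩
  have : LZ (f c) := hf.comp2 (fun _ => c) fun k => k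
  exact (psum_eq (h.comp2 (fun _ => c) fun k => k) (h' c hc).1 (h' c hc).2 (hB c hc)).symm

instance LZ.psum_const {f : M.Num → ZM M} {t : M.Num → M.Num} [hf : LZ f] [LF t] :
    LZ fun c => psum f (t c) := by
  have := hf.comp (fst : M.Num → M.Num)
  infer_instance

instance LZ.psum_self {f : M.Num → ZM M} [LZ f] : LZ (psum f) :=
  LZ.psum_const (t := fun n => n)

section
variable {f g : M.Num → ZM M} [hf : LZ f] [hg : LZ g] {n : M.Num}

theorem psum_congr (h : ∀ k < n, f k = g k) : psum f n = psum g n := by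
  exact LZ.induction (f := fun n => psum f n) (g := fun n => psum g n) inferInstance inferInstance
    (by rw [psum_zero, psum_zero]) (fun a ha ih => by rw [psum_succ, psum_succ, ih, h a ha]) n le_rfl

theorem psum_gap {a b : M.Num} (hab : a ≤ b) (h : ∀ k, a ≤ k → k < b → f k = 0) :
    psum f b = psum f a := by
  obtain ⟨d, rfl⟩ := le_iff_add.1 hab
  refine LZ.induction (f := fun d => psum f (a + d)) (g := fun _ => psum f a) inferInstance
    inferInstance (by rw [add_zero]) (fun e he ih => ?_) d le_rfl
  rw [← add_assoc, psum_succ, ih, h _ le_self_add ((add_lt_add_iff_left a).2 he), add_zero]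

theorem psum_eq_zero (h : ∀ k < n, f k = 0) : psum f n = 0 := by
  rw [psum_gap zero_le fun k _ => h k, psum_zero]

theorem psum_single {i : M.Num} (hi : i < n) (h : ∀ k < n, k ≠ i → f k = 0) :
    psum f n = f i := by
  rw [psum_gap (add_one_le_iff.2 hi) fun k h1 h2 => h k h2 (add_one_le_iff.1 h1).ne', psum_succ,
    psum_eq_zero fun k hk => h k (hk.trans hi) hk.ne, zero_add]

/-- For `f` supported on the range of a strictly increasing `e`, nothing is added between `e a + 1`
and `e (a + 1)`. This removes the gaps in sums over codes of pairs. -/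
theorem psum_strictMono {e : M.Num → M.Num} [he : LF e] (hmono : ∀ s t, s < t → e s < e t)
    (h : ∀ p, (∀ s, p ≠ e s) → f p = 0) (m : M.Num) : psum f (e m) = psum (fun s => f (e s)) m := by
  have := hf.comp e
  have hlt : ∀ s t, e s < e t → s < t := fun s t hst => by
    by_contra hc
    rcases (not_lt.1 hc).lt_or_eq with h' | h'
    · exact absurd (hmono _ _ h') hst.asymm
    · exact hst.ne (by rw [h'])
  refine LZ.induction (f := fun m => psum f (e m)) (g := fun m => psum (fun s => f (e s)) m)
    inferInstance inferInstance ?_ (fun a _ ih => ?_) m le_rfl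
  · rw [psum_zero]
    refine psum_eq_zero fun p hp => h p ?_
    rintro s rfl
    exact absurd (hlt _ _ hp) (not_lt.2 zero_le)
  · rw [psum_succ, ← ih, ← psum_succ]
    refine psum_gap (add_one_le_iff.2 (hmono _ _ (lt_succ_self a))) fun p h1 h2 => h p ?_
    rintro s rfl
    exact absurd (hlt _ _ h2) (not_lt.2 (add_one_le_iff.2 (hlt _ _ (add_one_le_iff.1 h1))))

end

theorem IV.isDot.eval {n : M.Num} {a b : M.Num → IV M} {c : IV M} {T : NV M}
    (h : IV.isDot n a b c T) (ha : LZ fun k => (a k).val) (hb : LZ fun k => (b k).val) :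
    c.val = psum (fun k => (a k).val * (b k).val) n := by
  obtain ⟨t, p0, p1, e⟩ := h
  have h3 : LZ fun b => ((T.row 1).at1 b).val := by simp only [NV.val_at1]; infer_instance
  rw [e]
  exact (psum_eq h3 p0 (fun k hk => by rw [p1 k hk, (t k hk).eval]) le_rfl).symm

/-- Inner products of families of integers can be computed simultaneously. -/
theorem exists_isDot (N : M.Num) (n : M.Num → M.Num) (a b : M.Num → M.Num → IV M) (B : M.Num)
    (hn : ∀ c < N, n c ≤ B)
    (ha : LZ fun d => (a (snd d) (fst d)).val) (hp : LS fun d => (b (snd d) (fst d)).pos.s)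
    (hq : LS fun d => (b (snd d) (fst d)).neg.s) (hB : ∀ c k, (b c k).bd ≤ B) :
    ∃ s : M.Num → M.Str, LS s ∧ ∀ c < N, ∀ z : IV M,
      z.val = psum (fun k => (a c k).val * (b c k).val) (n c) →
      ∀ v : NV M, v.s = s c → IV.isDot (n c) (a c) (b c) z v := by
  classical
  have hb : LZ fun d => (b (snd d) (fst d)).val := LZ.of_parts hp hq
  have i1 := LZ.comp2 (f := fun c k => (a c k).val) ha (fun d => snd (snd d)) (fun d : M.Num => fst (snd d))
  have i2 := LS.comp2 (f := fun c k => (b c k).pos.s) hp (fun d => snd (snd d)) (fun d : M.Num => fst (snd d))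
  have i3 := LS.comp2 (f := fun c k => (b c k).neg.s) hq (fun d => snd (snd d)) (fun d : M.Num => fst (snd d))
  have i4 := LZ.comp2 (f := fun c k => (a c k).val) ha (fun d => snd (snd d)) (fun d : M.Num => fst d)
  have i5 := LZ.comp2 (f := fun c k => (b c k).val) hb (fun d => snd (snd d)) (fun d : M.Num => fst d)
  -- Entry `y` of the table for `a · b` is explicitly the product of `a` with the truncation of `b`
  -- at `y`.
  obtain ⟨F, hF⟩ : ∃ F : M.Str, ∀ c < N, ∀ k < B, ∀ y ≤ B, ival (row F (kpair y (kpair k c))) =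
      (a c k).val * (toZ (restrict (b c k).pos.s y) - toZ (restrict (b c k).neg.s y)) := by
    obtain ⟨F, hF⟩ := (inferInstance : LZ fun d : M.Num => (a (snd (snd d)) (fst (snd d))).val *
      (toZ (restrict (b (snd (snd d)) (fst (snd d))).pos.s (fst d)) -
        toZ (restrict (b (snd (snd d)) (fst (snd d))).neg.s (fst d)))).code
      (kpair (B + 1) (kpair B N))
    refine ⟨F, fun c hc k hk y hy => ?_⟩
    rw [hF _ (kpair_lt (lt_add_one_iff.2 hy) (kpair_lt hk hc.le).le)]
    simp only [fst_kpair, snd_kpair]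
  obtain ⟨G, hG⟩ : ∃ G : M.Str, ∀ c < N, ∀ k ≤ B, ival (row G (kpair k c)) =
      psum (fun k => (a c k).val * (b c k).val) k := by
    obtain ⟨G, hG⟩ := (inferInstance : LZ fun d : M.Num =>
      psum (fun k => (a (snd d) k).val * (b (snd d) k).val) (fst d)).code (kpair (B + 1) N)
    refine ⟨G, fun c hc k hk => ?_⟩
    rw [hG _ (kpair_lt (lt_add_one_iff.2 hk) hc.le)]
    simp only [fst_kpair, snd_kpair]
  have l1 : (1 : M.Num) < 1 + 1 := lt_succ_self 1
  have i8 : LS fun d : M.Num => mkRows B fun k => mkRows (B + 1) fun y =>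
    row F (kpair y (kpair k (snd d))) := inferInstance
  have i9 : LS fun d : M.Num => mkRows (B + 1) fun k => row G (kpair k (snd d)) := inferInstance
  refine ⟨fun c => mkRows (1 + 1) fun i => if i = 0 then
    mkRows B fun k => mkRows (B + 1) fun y => row F (kpair y (kpair k c)) else
    mkRows (B + 1) fun k => row G (kpair k c), inferInstance, fun c hc z hz v hv => ?_⟩
  have e0 : Struct.row v.s 0 = mkRows B fun k => mkRows (B + 1) fun y => row F (kpair y (kpair k c)) := by
    rw [hv, row_mkRows (zero_lt_one.trans l1), if_pos rfl]
  have e1 : Struct.row v.s 1 = mkRows (B + 1) fun k => row G (kpair k c) := by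
    rw [hv, row_mkRows l1, if_neg one_ne_zero]
  have f0 : ∀ k < B, ∀ y ≤ B, (((v.row 0).row k).at1 y).val =
      (a c k).val * (toZ (restrict (b c k).pos.s y) - toZ (restrict (b c k).neg.s y)) := by
    intro k hk y hy
    change ival (row (row (row v.s 0) k) y) = _
    rw [e0, row_mkRows hk, row_mkRows (lt_add_one_iff.2 hy), hF c hc k hk y hy]
  have f1 : ∀ k ≤ B, ((v.row 1).at1 k).val = psum (fun k => (a c k).val * (b c k).val) k := by
    intro k hk
    change ival (row (row v.s 1) k) = _
    rw [e1, row_mkRows (lt_add_one_iff.2 hk), hG c hc k hk]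
  have i6 : LZ fun k => (a c k).val := LZ.comp2 (f := fun c k => (a c k).val) ha (fun _ => c) fun k => k
  have i7 : LZ fun k => (b c k).val := LZ.comp2 (f := fun c k => (b c k).val) hb (fun _ => c) fun k => k
  refine ⟨fun k hk => ⟨?_, fun y hy => ?_⟩, ?_, fun k hk => ?_, ?_⟩
  · rw [f0 k (hk.trans_le (hn c hc)) 0 zero_le]
    simp only [restrict_zero, sub_self, mul_zero]
  · have hy' := hy.trans_le (hB c k)
    rw [f0 k (hk.trans_le (hn c hc)) _ (add_one_le_iff.2 hy'),
      f0 k (hk.trans_le (hn c hc)) _ hy'.le]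
    simp only [mul_sub, mul_toZ, star_restrict_succ]
    abel
  · rw [f1 0 zero_le, psum_zero]
  · have hk' := hk.trans_le (hn c hc)
    rw [f1 _ (add_one_le_iff.2 hk'), f1 _ hk'.le, psum_succ, f0 k hk' _ (hB c k),
      restrict_of_len_le (len_le fun i => (b c k).lt_bd_pos),
      restrict_of_len_le (len_le fun i => (b c k).lt_bd_neg)]
    rfl
  · rw [hz, f1 _ (hn c hc)]

/-- Linear recurrences can be iterated. -/
theorem exists_linRec (N m : M.Num) (x : M.Num → ZM M) [hx : LZ x] (B : M.Num → M.Num → ZM M)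
    [hB : LZ fun d => B (snd d) (fst d)] : ∃ u : M.Num → M.Num → ZM M,
      LZ (fun d => u (snd d) (fst d)) ∧ (∀ q < N, u 0 q = x q) ∧
      ∀ j < m, ∀ q < N, u (j + 1) q = psum (fun p => u j p * B p q) N := by
  classical
  have := hx.comp (fst : M.Num → M.Num)
  -- The matrix `B` is bordered by the start vector `x` as last row and by zeros as last column. The
  -- last row of the power `j + 1` is then `x B^j`, followed by 0, so the sequence can start from an
  -- arbitrary vector.
  obtain ⟨X, hX⟩ := exists_ent (N + 1) (N + 1)
    fun p q => if q < N then (if p < N then B p q else x q) else 0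
  obtain ⟨Y, S, T, h0, h1, -⟩ := exists_isMatPow (N + 1) X (m + 1)
  have hS := isMatPow_one h0 (by simpa using h1 0 (lt_add_one_iff.2 zero_le))
  have hN := lt_succ_self N
  have step : ∀ j < m + 1, ∀ q < N + 1, ent3 S (j + 1) N q =
      psum (fun k => ent3 S j N k * ent X k q) (N + 1) := fun j hj q hq =>
    (h1 j hj N hN q hq).eval (by simp only [NV.val_at3]; infer_instance)
      (by simp only [NV.val_at2]; infer_instance)
  refine ⟨fun j q => ent3 S (j + 1) N q, by beta_reduce; infer_instance, fun q hq => ?_, fun j hj q hq => ?_⟩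
  · have hq' := hq.trans hN
    beta_reduce
    rw [zero_add]
    refine (hS N hN q hq').trans ((hX N hN q hq').trans ?_)
    rw [if_pos hq, if_neg (lt_irrefl N)]
  · have hq' := hq.trans hN
    have h2 : ent3 S (j + 1) N N = 0 := by
      rw [step j (hj.trans (lt_succ_self m)) N hN]
      refine psum_eq_zero fun k hk => ?_
      rw [hX k hk N hN, if_neg (lt_irrefl N), mul_zero]
    beta_reduce
    have := hB.comp2 (fun p => p) (fun _ => q)
    rw [step _ (add_lt_add_left hj 1) q hq', psum_succ, h2, zero_mul, add_zero]
    refine psum_congr fun p hp => ?_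
    rw [hX p (hp.trans hN) q hq', if_pos hq, if_pos hp]

end Sums

/-! ## Semantics of the Pfaffian -/

section PfaffianSemantics
variable {M : Struct.{u}} [VModel M]

def isSkew' (N : M.Num) (A : NV M) : Prop :=
  ∀ i < N, ∀ j < N, (A.at2 i j).val = - (A.at2 j i).val

def isPfStep' (A U C P Q T₁ T₂ T₃ : NV M) (k r : M.Num) : Prop :=
  (∀ l < r, (U.at3 k 0 (l + l)).val = - (A.at2 (k + k) ((k + k) + (1 + 1) + (l + l + 1))).val ∧
    (U.at3 k 0 (l + l + 1)).val = (A.at2 (k + k) ((k + k) + (1 + 1) + (l + l))).val) ∧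
  (∀ j < r, j + 1 < r → ∀ l < r,
    IV.isDot (r + r) (fun s => U.at3 k j s)
      (fun s => (A.at2 ((k + k) + (1 + 1) + s) ((k + k) + (1 + 1) + (l + l + 1))).opp)
      (U.at3 k (j + 1) (l + l)) (((T₁.row k).row j).row (l + l)) ∧
    IV.isDot (r + r) (fun s => U.at3 k j s)
      (fun s => A.at2 ((k + k) + (1 + 1) + s) ((k + k) + (1 + 1) + (l + l)))
      (U.at3 k (j + 1) (l + l + 1)) (((T₁.row k).row j).row (l + l + 1))) ∧
  (∀ j < r, IV.isDot (r + r) (fun s => U.at3 k j s)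
    (fun s => A.at2 ((k + k) + (1 + 1) + s) (k + k + 1)) (C.at2 k j) ((T₂.row k).row j)) ∧
  (∀ i < r + 1 + 1, ∀ i' < r + 1,
    (i < i' → (P.at3 k i i').val = 0) ∧
    (i = i' → (P.at3 k i i').val = 1) ∧
    (i = i' + 1 → (P.at3 k i i').val = (A.at2 (k + k) (k + k + 1)).val) ∧
    (∀ j < r, i = i' + (1 + 1) + j → (P.at3 k i i').val = (C.at2 k j).val)) ∧
  (∀ i < r + 1 + 1, IV.isDot (r + 1) (fun i' => P.at3 k i i') (fun i' => Q.at2 (k + 1) i')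
    (Q.at2 k i) ((T₃.row k).row i))

def isPf' (n : M.Num) (A : NV M) (p : IV M) : Prop :=
  ∃ U C P Q T₁ T₂ T₃ : M.Str,
    (∀ k < n, ∀ r < n, k + 1 + r = n → isPfStep' A (.ofStr U) (.ofStr C) (.ofStr P) (.ofStr Q)
      (.ofStr T₁) (.ofStr T₂) (.ofStr T₃) k r) ∧
    ((NV.ofStr Q).at2 n 0).val = 1 ∧ p.val = ((NV.ofStr Q).at2 0 n).val

def isDet' (N : M.Num) (B : NV M) (d : IV M) : Prop := ∃ D : M.Str,
  (∀ i < N, ∀ j < N, ((NV.ofStr D).at2 i j).val = 0 ∧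
    ((NV.ofStr D).at2 i (N + j)).val = (B.at2 i j).val ∧
    ((NV.ofStr D).at2 (N + i) j).val = - (B.at2 j i).val ∧
    ((NV.ofStr D).at2 (N + i) (N + j)).val = 0) ∧
  ∃ q : M.Str, isPf' N (.ofStr D) (NV.ofStr q).int ∧
    ((∃ m ≤ N * N, N * N = N + (m + m + m + m)) → d.val = (NV.ofStr q).int.val) ∧
    (¬ (∃ m ≤ N * N, N * N = N + (m + m + m + m)) → d.val = - (NV.ofStr q).int.val)

def isSwapped' (i j s t : M.Num) : Prop :=
  (s = i ∧ t = j) ∨ (s = j ∧ t = i) ∨ (¬ s = i ∧ ¬ s = j ∧ t = s)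

def isSwap' (N : M.Num) (A : NV M) (i j : M.Num) (A' : NV M) : Prop :=
  ∀ s < N, ∀ t < N, ∀ s' < N, ∀ t' < N, isSwapped' i j s s' ∧ isSwapped' i j t t' →
    (A'.at2 s' t').val = (A.at2 s t).val

variable (M) in
def MP' : Prop := ∀ (n : M.Num) (A B D C : M.Str), isSkew' (n + n) (.ofStr A) →
  isMatMul' (n + n) (fun i j => (NV.ofStr A).at2 i j) (fun i j => (NV.ofStr B).at2 i j)
    (fun i j => (NV.ofStr D).at2 i j) →
  isMatMul' (n + n) (fun i j => (NV.ofStr B).at2 j i) (fun i j => (NV.ofStr D).at2 i j)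
    (fun i j => (NV.ofStr C).at2 i j) →
  ∀ p q d : M.Str, isPf' n (.ofStr A) (NV.ofStr p).int → isPf' n (.ofStr C) (NV.ofStr q).int →
    isDet' (n + n) (.ofStr B) (NV.ofStr d).int →
    (NV.ofStr p).int.isMul (NV.ofStr d).int (NV.ofStr q).int

variable (M) in
def PALT' : Prop := ∀ (n : M.Num) (A : M.Str), ∀ i < n + n, ∀ j < n + n, ∀ A' : M.Str,
  isSkew' (n + n) (.ofStr A) → ¬ i = j → isSwap' (n + n) (.ofStr A) i j (.ofStr A') →
    (∃ p : M.Str, isPf' n (.ofStr A) (NV.ofStr p).int) ∧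
    (∃ q : M.Str, isPf' n (.ofStr A') (NV.ofStr q).int) ∧
    ∀ p q : M.Str, isPf' n (.ofStr A) (NV.ofStr p).int → isPf' n (.ofStr A') (NV.ofStr q).int →
      (NV.ofStr q).int.val = - (NV.ofStr p).int.val

variable {w : World M}

theorem IM.eqv_zero {X : Int2} {x : IV M} (h : IM w X x) : FM w (X.eqv .zero) (x.val = 0) :=
  (h.eqv .zero).congr (by rw [IV.val_zero])
theorem IM.eqv_one {X : Int2} {x : IV M} (h : IM w X x) : FM w (X.eqv .one) (x.val = 1) :=
  (h.eqv .one).congr (by rw [IV.val_one, z_one_def])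
theorem IM.eqv_opp {X Y : Int2} {x y : IV M} (h : IM w X x) (h' : IM w Y y) :
    FM w (X.eqv Y.opp) (x.val = - y.val) :=
  (h.eqv h'.opp).congr (by rw [IV.val_opp])

theorem FM.isSkew {N : Term} {n : M.Num} {A : Nat2} {a : NV M} (hN : TM w N n) (hA : NM w A a) :
    FM w (isSkew N A) (isSkew' n a) :=
  FM.allLt hN fun w1 h1 i i' hi => FM.allLt (hN.mono h1) fun w2 h2 j j' hj =>
    (IM.at2 (hA.mono (h1.trans h2)) (hi.mono h2) hj).eqv_opp
      (IM.at2 (hA.mono (h1.trans h2)) hj (hi.mono h2))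

theorem FM.isPfStep {A U C P Q T₁ T₂ T₃ : Nat2} {A' U' C' P' Q' T₁' T₂' T₃' : NV M} {k r : Term}
    {k' r' : M.Num} (hA : NM w A A') (hU : NM w U U') (hC : NM w C C') (hP : NM w P P')
    (hQ : NM w Q Q') (hT₁ : NM w T₁ T₁') (hT₂ : NM w T₂ T₂') (hT₃ : NM w T₃ T₃')
    (hk : TM w k k') (hr : TM w r r') :
    FM w (isPfStep A U C P Q T₁ T₂ T₃ k r) (isPfStep' A' U' C' P' Q' T₁' T₂' T₃' k' r') := by
  have ho : TM w ((k + k) + (1 + 1)) ((k' + k') + (1 + 1)) := (hk.add hk).add (TM.one.add .one)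
  have hR : ∀ w', w ≤ w' → ∀ t x, TM w' t x → IM w' (A.at2 (k + k) ((k + k) + (1 + 1) + t))
      (A'.at2 (k' + k') ((k' + k') + (1 + 1) + x)) := fun w' h t x ht =>
    .at2 (hA.mono h) ((hk.add hk).mono h) ((ho.mono h).add ht)
  have hS : ∀ w', w ≤ w' → ∀ t x, TM w' t x → IM w' (A.at2 ((k + k) + (1 + 1) + t) (k + k + 1))
      (A'.at2 ((k' + k') + (1 + 1) + x) (k' + k' + 1)) := fun w' h t x ht =>
    .at2 (hA.mono h) ((ho.mono h).add ht) (((hk.add hk).add .one).mono h)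
  have hM : ∀ w', w ≤ w' → ∀ t x s y, TM w' t x → TM w' s y →
      IM w' (A.at2 ((k + k) + (1 + 1) + t) ((k + k) + (1 + 1) + s))
      (A'.at2 ((k' + k') + (1 + 1) + x) ((k' + k') + (1 + 1) + y)) := fun w' h t x s y ht hs =>
    .at2 (hA.mono h) ((ho.mono h).add ht) ((ho.mono h).add hs)
  have hu : ∀ w', w ≤ w' → ∀ t x s y, TM w' t x → TM w' s y →
      IM w' (U.at3 k t s) (U'.at3 k' x y) := fun w' h t x s y ht hs =>
    .at3 (hU.mono h) (hk.mono h) ht hs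
  have hp : ∀ w', w ≤ w' → ∀ t x s y, TM w' t x → TM w' s y →
      IM w' (P.at3 k t s) (P'.at3 k' x y) := fun w' h t x s y ht hs =>
    .at3 (hP.mono h) (hk.mono h) ht hs
  have hc : ∀ w', w ≤ w' → ∀ t x, TM w' t x → IM w' (C.at2 k t) (C'.at2 k' x) :=
    fun w' h t x ht => .at2 (hC.mono h) (hk.mono h) ht
  have hr1 := hr.add TM.one
  have hr2 := hr1.add TM.one
  refine FM.and (FM.allLt hr fun w1 h1 l l' hl => ?_) <|
    FM.and (FM.allLt hr fun w1 h1 j j' hj => FM.imp (FM.lt (hj.add .one) (hr.mono h1)) <|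
      FM.allLt (hr.mono h1) fun w2 h2 l l' hl => ?_) <|
    FM.and (FM.allLt hr fun w1 h1 j j' hj => ?_) <|
    FM.and (FM.allLt hr2 fun w1 h1 i i' hi => FM.allLt (hr1.mono h1) fun w2 h2 j j' hj => ?_)
    (FM.allLt hr2 fun w1 h1 i i' hi => ?_)
  · have hl2 := hl.add hl
    exact ((hu w1 h1 _ _ _ _ .zero hl2).eqv_opp (hR w1 h1 _ _ (hl2.add .one))).and
      ((hu w1 h1 _ _ _ _ .zero (hl2.add .one)).eqv (hR w1 h1 _ _ hl2))
  · have hl2 := hl.add hl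
    have hl3 := hl2.add TM.one
    have h := h1.trans h2
    replace hj := hj.mono h2
    have hT := ((hT₁.mono h).row (hk.mono h)).row hj
    refine FM.and ?_ ?_
    · exact FM.isDot ((hr.add hr).mono h)
        (fun w3 h3 s s' hs => hu w3 (h.trans h3) _ _ _ _ (hj.mono h3) hs)
        (fun w3 h3 s s' hs => (hM w3 (h.trans h3) _ _ _ _ hs (hl3.mono h3)).opp)
        (hu w2 h _ _ _ _ (hj.add .one) hl2) (hT.row hl2)
    · exact FM.isDot ((hr.add hr).mono h)
        (fun w3 h3 s s' hs => hu w3 (h.trans h3) _ _ _ _ (hj.mono h3) hs)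
        (fun w3 h3 s s' hs => hM w3 (h.trans h3) _ _ _ _ hs (hl2.mono h3))
        (hu w2 h _ _ _ _ (hj.add .one) hl3) (hT.row hl3)
  · exact FM.isDot ((hr.add hr).mono h1)
      (fun w3 h3 s s' hs => hu w3 (h1.trans h3) _ _ _ _ (hj.mono h3) hs)
      (fun w3 h3 s s' hs => hS w3 (h1.trans h3) _ _ hs)
      (hc w1 h1 _ _ hj) (((hT₂.mono h1).row (hk.mono h1)).row hj)
  · have h := h1.trans h2
    replace hi := hi.mono h2
    have hpp := hp w2 h _ _ _ _ hi hj
    exact FM.and ((FM.lt hi hj).imp hpp.eqv_zero) <| FM.and ((FM.eqN hi hj).imp hpp.eqv_one) <|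
      FM.and ((FM.eqN hi (hj.add .one)).imp (hpp.eqv
        (.at2 (hA.mono h) ((hk.add hk).mono h) (((hk.add hk).add .one).mono h)))) <|
      FM.allLt (hr.mono h) fun w3 h3 l l' hl =>
        (FM.eqN (hi.mono h3) (((hj.mono h3).add (TM.one.add .one)).add hl)).imp
          ((hpp.mono h3).eqv (hc w3 (h.trans h3) _ _ hl))
  · exact FM.isDot (hr1.mono h1)
      (fun w3 h3 s s' hs => hp w3 (h1.trans h3) _ _ _ _ (hi.mono h3) hs)
      (fun w3 h3 s s' hs => .at2 (hQ.mono (h1.trans h3)) ((hk.add .one).mono (h1.trans h3)) hs)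
      (.at2 (hQ.mono h1) (hk.mono h1) hi) (((hT₃.mono h1).row (hk.mono h1)).row hi)

theorem FM.isPf {n : Term} {n' : M.Num} {A : Nat2} {a : NV M} {p : Int2} {p' : IV M}
    (hn : TM w n n') (hA : NM w A a) (hp : IM w p p') : FM w (isPf n A p) (isPf' n' a p') := by
  refine FM.ex fun w1 h1 U U' hU => FM.ex fun w2 h2 C C' hC => FM.ex fun w3 h3 P P' hP =>
    FM.ex fun w4 h4 Q Q' hQ => FM.ex fun w5 h5 T₁ T₁' hT₁ => FM.ex fun w6 h6 T₂ T₂' hT₂ =>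
    FM.ex fun w7 h7 T₃ T₃' hT₃ => ?_
  replace hT₂ := hT₂.mono h7
  replace h6 := h6.trans h7
  replace hT₁ := hT₁.mono h6
  replace h5 := h5.trans h6
  replace hQ := hQ.mono h5
  replace h4 := h4.trans h5
  replace hP := hP.mono h4
  replace h3 := h3.trans h4
  replace hC := hC.mono h3
  replace h2 := h2.trans h3
  replace hU := hU.mono h2
  replace h1 := h1.trans h2
  replace hn := hn.mono h1
  replace hA := hA.mono h1
  replace hp := hp.mono h1
  refine FM.and (FM.allLt hn fun w8 h8 k k' hk => FM.allLt (hn.mono h8) fun w9 h9 r r' hr => ?_)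
    (FM.and (IM.at2 hQ hn .zero).eqv_one (hp.eqv (.at2 hQ .zero hn)))
  have h := h8.trans h9
  replace hk := hk.mono h9
  exact (FM.eqN ((hk.add .one).add hr) (hn.mono h)).imp
    (FM.isPfStep (hA.mono h) (hU.mono h) (hC.mono h) (hP.mono h) (hQ.mono h) (hT₁.mono h)
      (hT₂.mono h) (hT₃.mono h) hk hr)

theorem FM.isDet {n : Term} {n' : M.Num} {B : Nat2} {b : NV M} {d : Int2} {d' : IV M}
    (hn : TM w n n') (hB : NM w B b) (hd : IM w d d') : FM w (isDet n B d) (isDet' n' b d') := by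
  refine FM.ex fun w1 h1 D D' hD => ?_
  replace hn := hn.mono h1
  replace hB := hB.mono h1
  replace hd := hd.mono h1
  refine FM.and (FM.allLt hn fun w2 h2 i i' hi => FM.allLt (hn.mono h2) fun w3 h3 j j' hj => ?_)
    (FM.ex fun w2 h2 q q' hq => ?_)
  · have h := h2.trans h3
    replace hi := hi.mono h3
    replace hn := hn.mono h
    replace hD := hD.mono h
    replace hB := hB.mono h
    exact FM.and (IM.at2 hD hi hj).eqv_zero <|
      FM.and ((IM.at2 hD hi (hn.add hj)).eqv (.at2 hB hi hj)) <|
      FM.and ((IM.at2 hD (hn.add hi) hj).eqv_opp (.at2 hB hj hi))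
      (IM.at2 hD (hn.add hi) (hn.add hj)).eqv_zero
  · replace hn := hn.mono h2
    have hs : FM w2 (Fml.exLe (n * n) fun m => Fml.eqN (n * n) (n + (m + m + m + m)))
        (∃ m ≤ n' * n', n' * n' = n' + (m + m + m + m)) :=
      FM.exLe (hn.mul hn) fun w3 h3 m m' hm => FM.eqN ((hn.mul hn).mono h3)
        ((hn.mono h3).add (((hm.add hm).add hm).add hm))
    exact FM.and (FM.isPf hn (hD.mono h2) (.int hq)) <|
      FM.and (hs.imp ((hd.mono h2).eqv (.int hq))) (hs.not.imp ((hd.mono h2).eqv_opp (.int hq)))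

theorem FM.isSwapped {i j s t : Term} {i' j' s' t' : M.Num} (hi : TM w i i') (hj : TM w j j')
    (hs : TM w s s') (ht : TM w t t') : FM w (isSwapped i j s t) (isSwapped' i' j' s' t') :=
  FM.or ((FM.eqN hs hi).and (FM.eqN ht hj)) <| FM.or ((FM.eqN hs hj).and (FM.eqN ht hi)) <|
    (FM.eqN hs hi).not.and <| (FM.eqN hs hj).not.and (FM.eqN ht hs)

theorem FM.isSwap {N i j : Term} {n i' j' : M.Num} {A B : Nat2} {a b : NV M} (hN : TM w N n)
    (hA : NM w A a) (hi : TM w i i') (hj : TM w j j') (hB : NM w B b) :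
    FM w (isSwap N A i j B) (isSwap' n a i' j' b) := by
  refine FM.allLt hN fun w1 h1 s s1 hs => FM.allLt (hN.mono h1) fun w2 h2 t t1 ht =>
    FM.allLt (hN.mono (h1.trans h2)) fun w3 h3 s' s1' hs' =>
    FM.allLt (hN.mono (h1.trans (h2.trans h3))) fun w4 h4 t' t1' ht' => ?_
  replace hs' := hs'.mono h4
  replace ht := ht.mono (h3.trans h4)
  replace hs := hs.mono (h2.trans (h3.trans h4))
  have h := h1.trans (h2.trans (h3.trans h4))
  exact FM.imp ((FM.isSwapped (hi.mono h) (hj.mono h) hs hs').and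
    (FM.isSwapped (hi.mono h) (hj.mono h) ht ht'))
    ((IM.at2 (hB.mono h) hs' ht').eqv (.at2 (hA.mono h) hs ht))

variable (M) in
theorem sat_MP (ρ : ℕ → M.Num) (σ : ℕ → M.Str) : MP.Sat M ρ σ ↔ MP' M := by
  refine sat_close (fun w => ?_) ρ σ
  refine FM.allN fun w1 h1 n n' hn => FM.all fun w2 h2 A A' hA =>
    FM.all fun w3 h3 B B' hB => FM.all fun w4 h4 D D' hD => FM.all fun w5 h5 C C' hC => ?_
  replace hD := hD.mono h5
  replace h4 := h4.trans h5
  replace hB := hB.mono h4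
  replace h3 := h3.trans h4
  replace hA := hA.mono h3
  replace hn := hn.mono (h2.trans h3)
  refine FM.imp (FM.isSkew (hn.add hn) hA) <| FM.imp (FM.isMatMul (hn.add hn)
    (fun w' h _ _ _ _ hi hj => .at2 (hA.mono h) hi hj)
    (fun w' h _ _ _ _ hi hj => .at2 (hB.mono h) hi hj)
    (fun w' h _ _ _ _ hi hj => .at2 (hD.mono h) hi hj)) <| FM.imp (FM.isMatMul (hn.add hn)
    (fun w' h _ _ _ _ hi hj => .at2 (hB.mono h) hj hi)
    (fun w' h _ _ _ _ hi hj => .at2 (hD.mono h) hi hj)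
    (fun w' h _ _ _ _ hi hj => .at2 (hC.mono h) hi hj)) <|
    FM.all fun w6 h6 p p' hp => FM.all fun w7 h7 q q' hq => FM.all fun w8 h8 d d' hd => ?_
  replace hq := IM.int (hq.mono h8)
  replace h7 := h7.trans h8
  replace hp := IM.int (hp.mono h7)
  replace h6 := h6.trans h7
  replace hn := hn.mono h6
  exact FM.imp (FM.isPf hn (hA.mono h6) hp) <| FM.imp (FM.isPf hn (hC.mono h6) hq) <|
    FM.imp (FM.isDet (hn.add hn) (hB.mono h6) (.int hd)) (FM.isMul hp (.int hd) hq)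

variable (M) in
theorem sat_PALT (ρ : ℕ → M.Num) (σ : ℕ → M.Str) : PALT.Sat M ρ σ ↔ PALT' M := by
  refine sat_close (fun w => ?_) ρ σ
  refine FM.allN fun w1 h1 n n' hn => FM.all fun w2 h2 A A' hA =>
    FM.allLt ((hn.add hn).mono h2) fun w3 h3 i i' hi =>
    FM.allLt ((hn.add hn).mono (h2.trans h3)) fun w4 h4 j j' hj => FM.all fun w5 h5 B B' hB => ?_
  replace hj := hj.mono h5
  replace h4 := h4.trans h5
  replace hi := hi.mono h4
  replace h3 := h3.trans h4
  replace hA := hA.mono h3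
  replace hn := hn.mono (h2.trans h3)
  refine FM.imp (FM.isSkew (hn.add hn) hA) <| FM.imp (FM.eqN hi hj).not <|
    FM.imp (FM.isSwap (hn.add hn) hA hi hj hB) <|
    FM.and (FM.ex fun w' h _ _ hp => FM.isPf (hn.mono h) (hA.mono h) (.int hp)) <|
    FM.and (FM.ex fun w' h _ _ hp => FM.isPf (hn.mono h) (hB.mono h) (.int hp)) <|
    FM.all fun w6 h6 p p' hp => FM.all fun w7 h7 q q' hq => ?_
  replace hp := IM.int (hp.mono h7)
  replace h6 := h6.trans h7
  replace hn := hn.mono h6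
  exact FM.imp (FM.isPf hn (hA.mono h6) hp) <| FM.imp (FM.isPf hn (hB.mono h6) (.int hq)) <|
    IM.eqv_opp (.int hq) hp

end PfaffianSemantics

/-! ## Existence of the Pfaffian -/

section Existence
variable {M : Struct.{u}} [VModel M]

theorem LZ.comp3 {f : M.Num → M.Num → M.Num → ZM M}
    (hf : LZ fun d => f (snd d) (snd (fst d)) (fst (fst d)))
    (t s r : M.Num → M.Num) [LF t] [LF s] [LF r] : LZ fun c => f (t c) (s c) (r c) := by
  simpa only [fst_kpair, snd_kpair] using hf.comp fun c => kpair (kpair (r c) (s c)) (t c)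

theorem exists_rows2 {s : M.Num → M.Str} (hs : LS s) (N N' : M.Num) :
    ∃ T : M.Str, ∀ i < N, ∀ j < N', row (row T i) j = s (kpair j i) := by
  have := LS.comp hs fun d : M.Num => kpair (fst d) (snd d)
  have h2 : LS fun i => mkRows N' fun j => s (kpair j i) := inferInstance
  refine ⟨mkRows N fun i => mkRows N' fun j => s (kpair j i), fun i hi j hj => ?_⟩
  have h1 : LS fun j => s (kpair j i) := LS.comp hs fun j => kpair j i
  rw [row_mkRows hi, row_mkRows hj]

theorem exists_rows3 {s : M.Num → M.Str} (hs : LS s) (N N' N'' : M.Num) :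
    ∃ T : M.Str, ∀ i < N, ∀ j < N', ∀ k < N'',
      row (row (row T i) j) k = s (kpair (kpair k j) i) := by
  have h4 : ∀ i, LS fun j => mkRows N'' fun k => s (kpair (kpair k j) i) := fun i => by
    have := LS.comp hs fun d : M.Num => kpair (kpair (fst d) (snd d)) i
    infer_instance
  have h3 : LS fun d : M.Num => mkRows N'' fun k => s (kpair (kpair k (fst d)) (snd d)) := by
    have := LS.comp hs fun d : M.Num => kpair (kpair (fst d) (fst (snd d))) (snd (snd d))
    infer_instance
  have h2 : LS fun i => mkRows N' fun j => mkRows N'' fun k => s (kpair (kpair k j) i) :=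
    LS.mkRows_comp (hs := h3)
  refine ⟨mkRows N fun i => mkRows N' fun j => mkRows N'' fun k => s (kpair (kpair k j) i),
    fun i hi j hj k hk => ?_⟩
  have h1 : LS fun k => s (kpair (kpair k j) i) := LS.comp hs fun k => kpair (kpair k j) i
  have := h4 i
  rw [row_mkRows hi, row_mkRows hj, row_mkRows hk]

theorem kpair_strictMono (k : M.Num) {s t : M.Num} (h : s < t) : kpair k s < kpair k t :=
  lt_of_le_of_ne (kpair_mono le_rfl h.le) fun h' => h.ne (kpair_inj.1 h').2

/-- Restricts a sum over codes to one block, the codes `kpair k s` with `s < m`, off which the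
summands vanish. -/
theorem psum_kpair {f g : M.Num → ZM M} [hf : LZ f] [hg : LZ g] {k m N : M.Num}
    (hN : kpair k m ≤ N) (h1 : ∀ s < m, f (kpair k s) = g s)
    (h0 : ∀ p, (∀ s < m, p ≠ kpair k s) → f p = 0) : psum f N = psum g m := by
  have := hf.comp (fun s => kpair k s)
  rw [psum_gap hN fun p hp _ => h0 p fun s hs h => ?_, psum_strictMono (f := f)
    (e := fun s => kpair k s) (fun s t => kpair_strictMono k) fun p hp => h0 p fun s _ => hp s]
  · exact psum_congr h1
  · exact absurd (kpair_strictMono k hs) (not_lt.2 (h ▸ hp))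

def IsEven (t : M.Num) : Prop := ∃ l ≤ t, t = l + l

instance LP.isEven_comp {t : M.Num → M.Num} [LF t] : LP fun c => IsEven (t c) := by
  have : LF fun d : M.Num => t (snd d) := LF.comp inferInstance inferInstance
  unfold IsEven; infer_instance

theorem isEven_add_self (l : M.Num) : IsEven (l + l) := ⟨l, le_self_add, rfl⟩

theorem not_isEven (l : M.Num) : ¬ IsEven (l + l + 1) := by
  rintro ⟨m, -, h⟩
  rcases lt_or_ge l m with h' | h'
  · have h1 := add_le_add (add_one_le_iff.2 h') (add_one_le_iff.2 h')
    rw [← h, add_add_add_comm, ← add_assoc] at h1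
    exact absurd h1 (not_le.2 (lt_succ_self _))
  · have h1 := add_le_add h' h'
    rw [← h] at h1
    exact absurd h1 (not_le.2 (lt_succ_self _))

/-- The first index of the matrix that remains after `k + 1` steps. -/
def off (k : M.Num) : M.Num := (k + k) + (1 + 1)

instance LF.off_comp {t : M.Num → M.Num} [LF t] : LF fun c => off (t c) := by
  unfold off; infer_instance

open Classical in
/-- The entry `t` of row `i` of the matrix `A`, times `J`, in step `k`. -/
noncomputable def turn (A : M.Str) (k i t : M.Num) : ZM M :=
  if IsEven t then - ent A i (off k + (t + 1)) else ent A i (off k + (t - 1))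

instance LZ.turn_comp {A : M.Str} {k i t : M.Num → M.Num} [LF k] [LF i] [LF t] :
    LZ fun c => turn A (k c) (i c) (t c) := by
  unfold turn; infer_instance

theorem turn_even (A : M.Str) (k i l : M.Num) :
    turn A k i (l + l) = - ent A i (off k + (l + l + 1)) := if_pos (isEven_add_self l)

theorem turn_odd (A : M.Str) (k i l : M.Num) :
    turn A k i (l + l + 1) = ent A i (off k + (l + l)) := by
  rw [turn, if_neg (not_isEven l), add_tsub_cancel_right]

/-- The vectors `R J (M J)^j` of all the steps `k` are computed together. Coordinate `t` in step `k`
becomes coordinate `kpair k t` of one long vector, which is multiplied by the block diagonal matrix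
with the blocks `M J`. `turn` gives the entries of `R J` in row `k + k` and of `M J` in the rows
from `off k` on. -/
theorem exists_krylov (n : M.Num) (A : M.Str) : ∃ u : M.Num → M.Num → M.Num → ZM M,
    LZ (fun d => u (snd d) (snd (fst d)) (fst (fst d))) ∧
    ∀ k < n, ∀ r, k + 1 + r = n → (∀ t < r + r, u k 0 t = turn A k (k + k) t) ∧
      ∀ j < n, ∀ t < r + r,
        u k (j + 1) t = psum (fun s => u k j s * turn A k (off k + s) t) (r + r) := by
  classical
  obtain ⟨u, hu, h0, h1⟩ := exists_linRec (kpair n (n + n)) n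
    (fun q => turn A (fst q) (fst q + fst q) (snd q))
    (fun p q => if p = kpair (fst q) (snd p) ∧
      snd p < (n - (fst q + 1)) + (n - (fst q + 1)) then
      turn A (fst q) (off (fst q) + snd p) (snd q) else 0)
  have hr : ∀ {k r : M.Num}, k + 1 + r = n → r ≤ n := fun h => h ▸ le_add_self
  refine ⟨fun k j t => u j (kpair k t), ?_, fun k hk r hkr => ?_⟩
  · exact hu.comp2 (fun d => snd (fst d)) fun d =>
      kpair (snd d) (fst (fst d))
  have hlt : ∀ t < r + r, kpair k t < kpair n (n + n) := fun t ht =>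
    kpair_lt hk (ht.le.trans (add_le_add (hr hkr) (hr hkr)))
  beta_reduce
  refine ⟨fun t ht => ?_, fun j hj t ht => ?_⟩
  · rw [h0 _ (hlt t ht)]
    simp only [fst_kpair, snd_kpair]
  · rw [h1 j hj _ (hlt t ht)]
    have hn : n - (k + 1) = r := by rw [← hkr, add_tsub_cancel_left]
    have i1 : LZ (u j) := hu.comp2 (fun _ => j) fun q => q
    have i2 := hu.comp2 (fun _ => j) fun s => kpair k s
    simp only [fst_kpair, snd_kpair, hn]
    refine psum_kpair (kpair_lt hk (add_le_add (hr hkr) (hr hkr))).le (fun s hs => ?_)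
      fun p hp => ?_
    · rw [snd_kpair, if_pos ⟨rfl, hs⟩]
    · rw [if_neg fun h => hp _ h.2 h.1, mul_zero]

/-- The matrices of the successive steps differ, so they are placed in one block matrix that maps
block `k + 1` to block `k` by the matrix of step `k`. Started with the vector (1) in block `n`, the
iteration has the coefficients of step `k` in block `k` at time `n - k`; other blocks are not read
at that time. -/
theorem exists_pfCoeffs (n : M.Num) (P : M.Num → M.Num → M.Num → ZM M)
    (hP : LZ fun d => P (snd d) (snd (fst d)) (fst (fst d))) : ∃ v : M.Num → M.Num → ZM M,
    LZ (fun d => v (snd d) (fst d)) ∧ v n 0 = 1 ∧ ∀ k < n, ∀ r, k + 1 + r = n →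
      ∀ i < r + 1 + 1, v k i = psum (fun i' => P k i i' * v (k + 1) i') (r + 1) := by
  classical
  have := hP.comp3 (fun d => fst (fst d)) (fun d => snd (fst d)) (fun d : M.Num => snd (snd d))
  have := hP.comp3 (fun d => fst (snd d)) (fun d => snd (snd d)) (fun d : M.Num => snd (fst d))
  have := hP.comp3 (fun d => fst (fst d)) (fun d => snd (fst d)) (fun d : M.Num => snd (snd d))
  obtain ⟨u, hu, h0, h1⟩ := exists_linRec (kpair (n + 1) (n + 1)) n
    (fun q => if q = kpair n 0 then 1 else 0)
    (fun p q => if p = kpair (fst q + 1) (snd p) ∧ snd p < n - fst q then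
      P (fst q) (snd q) (snd p) else 0)
  refine ⟨fun k i => u (n - k) (kpair k i), hu.comp2 (fun d => n - snd d) fun d =>
    kpair (snd d) (fst d), ?_, fun k hk r hkr i hi => ?_⟩
  · beta_reduce
    rw [tsub_self, h0 _ (kpair_lt (lt_succ_self n) zero_le), if_pos rfl]
  · have hn1 : n - (k + 1) = r := by rw [← hkr, add_tsub_cancel_left]
    have hn : n - k = r + 1 := by rw [← hkr, add_assoc, add_tsub_cancel_left, add_comm]
    have hr : r + 1 ≤ n := by rw [← hkr, add_right_comm, add_assoc]; exact le_add_self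
    have hi' : i < n + 1 := hi.trans_le (add_le_add_left hr 1)
    beta_reduce
    rw [hn, hn1, h1 r (add_one_le_iff.1 hr) _ (kpair_lt (hk.trans (lt_succ_self n)) hi'.le)]
    simp only [fst_kpair, snd_kpair, hn]
    have i1 : LZ (u r) := hu.comp2 (fun _ => r) fun q => q
    have : LF fun s : M.Num => kpair (k + 1) s := LF.kpair_left _
    have i2 := hu.comp2 (fun _ => r) fun s => kpair (k + 1) s
    have i3 := hP.comp3 (fun _ => k) (fun _ => i) fun s => s
    have i4 := hP.comp3 (fun _ => k) (fun _ => i) (fun s : M.Num => snd s)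
    refine psum_kpair (k := k + 1) (m := r + 1) (kpair_mono (add_le_add_left hk.le 1)
      (hr.trans (lt_succ_self n).le)) (fun s hs => ?_) fun p hp => ?_
    · rw [snd_kpair, if_pos ⟨rfl, hs⟩, mul_comm]
    · rw [if_neg fun h => hp _ h.2 h.1, mul_zero]

end Existence

/-! ### Computations of Pfaffians and determinants -/

section Existence
variable {M : Struct.{u}} [VModel M]

instance LZ.at2_val {X : M.Str} {t s : M.Num → M.Num} [LF t] [LF s] :
    LZ fun c => ((NV.ofStr X).at2 (t c) (s c)).val := LZ.ent_comp

instance LZ.at3_val {X : M.Str} {t s r : M.Num → M.Num} [LF t] [LF s] [LF r] :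
    LZ fun c => ((NV.ofStr X).at3 (t c) (s c) (r c)).val := LZ.ent3_comp

instance LS.at2_pos {X : M.Str} {t s : M.Num → M.Num} [LF t] [LF s] :
    LS fun c => ((NV.ofStr X).at2 (t c) (s c)).pos.s :=
  (inferInstance : LS fun c => row (row (row X (t c)) (s c)) 0)

instance LS.at2_neg {X : M.Str} {t s : M.Num → M.Num} [LF t] [LF s] :
    LS fun c => ((NV.ofStr X).at2 (t c) (s c)).neg.s :=
  (inferInstance : LS fun c => row (row (row X (t c)) (s c)) 1)

instance LS.opp_pos {x : M.Num → IV M} [h : LS fun c => (x c).neg.s] :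
    LS fun c => (x c).opp.pos.s := h

instance LS.opp_neg {x : M.Num → IV M} [h : LS fun c => (x c).pos.s] :
    LS fun c => (x c).opp.neg.s := h

instance LZ.opp_val {x : M.Num → IV M} [h : LZ fun c => (x c).val] :
    LZ fun c => (x c).opp.val := by
  simp only [IV.val_opp]
  infer_instance

theorem add_self_lt {l r : M.Num} (h : l < r) : l + l < r + r := add_lt_add h h

theorem add_self_add_one_lt {l r : M.Num} (h : l < r) : l + l + 1 < r + r := by
  have h1 := add_le_add (add_one_le_iff.2 h) (add_one_le_iff.2 h)
  rw [add_add_add_comm, ← add_assoc] at h1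
  exact (lt_succ_self _).trans_le h1

/-- The Pfaffian of every matrix exists. -/
theorem exists_isPf (n : M.Num) (A : M.Str) :
    ∃ p : M.Str, isPf' n (.ofStr A) (NV.ofStr p).int := by
  classical
  obtain ⟨u, hu, hu'⟩ := exists_krylov n A
  have u1 := hu.comp3 (fun d => snd (snd d)) (fun d => fst (snd d)) (fun d : M.Num => fst d)
  obtain ⟨c, hc⟩ : ∃ c : M.Num → M.Num → ZM M, c = fun k j =>
    psum (fun s => u k j s * ent A (off k + s) (k + k + 1)) ((n - (k + 1)) + (n - (k + 1))) := ⟨_, rfl⟩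
  have lc : LZ fun d => c (snd d) (fst d) := by
    subst hc; beta_reduce; infer_instance
  have c1 := lc.comp2 snd fun d => snd (fst d) - (fst (fst d) + (1 + 1 : M.Num))
  -- The last branch is reached only for `i ≥ i' + 2`, where the truncated difference is the true
  -- index of the entry of `C`.
  obtain ⟨P', hP'⟩ : ∃ P' : M.Num → M.Num → M.Num → ZM M, P' = fun k i i' =>
    if i < i' then 0 else if i = i' then 1 else if i = i' + 1 then ent A (k + k) (k + k + 1)
      else c k (i - (i' + (1 + 1))) := ⟨_, rfl⟩
  have lP : LZ fun d => P' (snd d) (snd (fst d)) (fst (fst d)) := by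
    subst hP'; beta_reduce; infer_instance
  obtain ⟨v, hv, v0, hv'⟩ := exists_pfCoeffs n P' lP
  obtain ⟨U, hU⟩ := exists_ent3 n n (n + n) u
  obtain ⟨C, hC⟩ := exists_ent n n c
  obtain ⟨P, hP⟩ := exists_ent3 n (n + 1) (n + 1) P'
  obtain ⟨Q, hQ⟩ := exists_ent (n + 1) (n + 1) v
  -- `exists_isDot` takes one bound for the lengths of the inner products and for the bounds of the
  -- right factors; a sum of all the candidates serves every application.
  have hle : ∀ m : M.Num, (n - m) + (n - m) ≤ n + n + 1 + ((M.len A + M.len A) + (M.len Q + M.len Q)) :=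
    fun m => (add_le_add tsub_le_self tsub_le_self).trans (le_self_add.trans le_self_add)
  have hbA : M.len A + M.len A ≤ n + n + 1 + ((M.len A + M.len A) + (M.len Q + M.len Q)) :=
    le_self_add.trans le_add_self
  have hbQ : M.len Q + M.len Q ≤ n + n + 1 + ((M.len A + M.len A) + (M.len Q + M.len Q)) :=
    le_add_self.trans le_add_self
  obtain ⟨s₁, ls₁, hs₁⟩ := exists_isDot (kpair (kpair (n + n) n) n)
    (fun c => (n - (snd c + 1)) + (n - (snd c + 1)))
    (fun c s => (NV.ofStr U).at3 (snd c) (snd (fst c)) s)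
    (fun c s => ((NV.ofStr A).at2 (off (snd c) + s) (off (snd c) + (fst (fst c) + 1))).opp)
    _ (fun _ _ => hle _) (by infer_instance) (by infer_instance)
    (by infer_instance) fun _ _ => hbA
  obtain ⟨s₂, ls₂, hs₂⟩ := exists_isDot (kpair (kpair (n + n) n) n)
    (fun c => (n - (snd c + 1)) + (n - (snd c + 1)))
    (fun c s => (NV.ofStr U).at3 (snd c) (snd (fst c)) s)
    (fun c s => (NV.ofStr A).at2 (off (snd c) + s) (off (snd c) + (fst (fst c) - 1)))
    _ (fun _ _ => hle _) (by infer_instance) (by infer_instance)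
    (by infer_instance) fun _ _ => hbA
  obtain ⟨s₃, ls₃, hs₃⟩ := exists_isDot (kpair n n)
    (fun c => (n - (snd c + 1)) + (n - (snd c + 1)))
    (fun c s => (NV.ofStr U).at3 (snd c) (fst c) s)
    (fun c s => (NV.ofStr A).at2 (off (snd c) + s) (snd c + snd c + 1))
    _ (fun _ _ => hle _) (by infer_instance) (by infer_instance)
    (by infer_instance) fun _ _ => hbA
  obtain ⟨s₄, ls₄, hs₄⟩ := exists_isDot (kpair (n + 1) n) (fun c => n - snd c)
    (fun c s => (NV.ofStr P).at3 (snd c) (fst c) s)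
    (fun c s => (NV.ofStr Q).at2 (snd c + 1) s)
    _ (fun _ _ => le_self_add.trans (hle _)) (by infer_instance) (by infer_instance)
    (by infer_instance) fun _ _ => hbQ
  -- Multiplication by `J` exchanges neighbouring columns, with a sign at even places. Even and odd
  -- coordinates therefore come from two families of inner products, which are interleaved by
  -- parity.
  obtain ⟨T₁, hT₁⟩ := exists_rows3
    (LS.ite (P := fun c : M.Num => IsEven (fst (fst c))) (s := s₁) (t := s₂)) n n (n + n)
  obtain ⟨T₂, hT₂⟩ := exists_rows2 ls₃ n n
  obtain ⟨T₃, hT₃⟩ := exists_rows2 ls₄ n (n + 1)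
  simp only [fst_kpair] at hT₁
  -- The string coding the result is the entry `(0, n)` of `Q` itself, so the last clause of `isPf'`
  -- holds by definition.
  refine ⟨row (row Q 0) n, U, C, P, Q, T₁, T₂, T₃, fun k hk r hr hkr => ?_,
    (hQ n (lt_succ_self n) 0 (lt_add_one_iff.2 zero_le)).trans v0, rfl⟩
  obtain ⟨hu0, hu1⟩ := hu' k hk r hkr
  have hn1 : n - (k + 1) = r := by rw [← hkr, add_tsub_cancel_left]
  have hn : n - k = r + 1 := by rw [← hkr, add_assoc, add_tsub_cancel_left, add_comm]
  have hr1 : r + 1 ≤ n := add_one_le_iff.2 hr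
  have h0n : 0 < n := zero_le.trans_lt hk
  have h2 : ∀ {t}, t < r + r → t < n + n := fun h => h.trans_le (add_le_add hr.le hr.le)
  have lu : ∀ j, LZ fun s => u k j s := fun j => hu.comp3 (fun _ => k) (fun _ => j) fun s => s
  refine ⟨fun l hl => ?_, fun j hj hj1 l hl => ?_, fun j hj => ?_, fun i hi i' hi' => ?_,
    fun i hi => ?_⟩
  · have l0 := add_self_lt hl
    have l1 := add_self_add_one_lt hl
    exact ⟨(hU k hk 0 h0n _ (h2 l0)).trans ((hu0 _ l0).trans (turn_even ..)),
      (hU k hk 0 h0n _ (h2 l1)).trans ((hu0 _ l1).trans (turn_odd ..))⟩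
  · have l0 := add_self_lt hl
    have l1 := add_self_add_one_lt hl
    have hjn := hj.trans hr
    have hj1n := hj1.trans hr
    have := lu j
    constructor
    · have := hs₁ (kpair (kpair (l + l) j) k) (kpair_lt (kpair_lt (h2 l0) hjn.le) hk.le)
        ((NV.ofStr U).at3 k (j + 1) (l + l))
      simp only [fst_kpair, snd_kpair, hn1] at this
      refine this ((hU k hk _ hj1n _ (h2 l0)).trans ((hu1 j hjn _ l0).trans ?_)) _
        ((hT₁ k hk j hjn _ (h2 l0)).trans (if_pos (isEven_add_self l)))
      refine psum_congr fun s hs => ?_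
      rw [turn_even, IV.val_opp]
      exact congrArg (· * _) (hU k hk j hjn s (h2 hs)).symm
    · have := hs₂ (kpair (kpair (l + l + 1) j) k) (kpair_lt (kpair_lt (h2 l1) hjn.le) hk.le)
        ((NV.ofStr U).at3 k (j + 1) (l + l + 1))
      simp only [fst_kpair, snd_kpair, hn1, add_tsub_cancel_right] at this
      refine this ((hU k hk _ hj1n _ (h2 l1)).trans ((hu1 j hjn _ l1).trans ?_)) _
        ((hT₁ k hk j hjn _ (h2 l1)).trans (if_neg (not_isEven l)))
      refine psum_congr fun s hs => ?_
      rw [turn_odd]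
      exact congrArg (· * _) (hU k hk j hjn s (h2 hs)).symm
  · have hjn := hj.trans hr
    have := lu j
    have := hs₃ (kpair j k) (kpair_lt hjn hk.le) ((NV.ofStr C).at2 k j)
    simp only [fst_kpair, snd_kpair, hn1] at this
    refine this ((hC k hk j hjn).trans ?_) _ (hT₂ k hk j hjn)
    rw [hc]
    beta_reduce
    rw [hn1]
    exact psum_congr fun s hs => congrArg (· * _) (hU k hk j hjn s (h2 hs)).symm
  · have hPe : ((NV.ofStr P).at3 k i i').val = P' k i i' := hP k hk i
      (hi.trans_le (add_le_add_left hr1 1)) i' ((hi'.trans_le hr1).trans (lt_succ_self n))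
    rw [hPe, hP']
    beta_reduce
    refine ⟨fun h => if_pos h, ?_, ?_, fun j hj => ?_⟩
    · rintro rfl
      rw [if_neg (lt_irrefl _), if_pos rfl]
    · rintro rfl
      rw [if_neg (lt_succ_self i').asymm, if_neg (lt_succ_self i').ne', if_pos rfl]
      rfl
    · rintro rfl
      have h3 : i' + 1 < i' + (1 + 1) + j := by
        rw [← add_assoc]; exact (lt_succ_self _).trans_le le_self_add
      have h4 := (lt_succ_self i').trans h3
      rw [if_neg h4.asymm, if_neg h4.ne', if_neg h3.ne', add_tsub_cancel_left]
      exact (hC k hk j (hj.trans hr)).symm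
  · have hin : i < n + 1 := hi.trans_le (add_le_add_left hr1 1)
    have := lP.comp3 (fun _ => k) (fun _ => i) (fun s => s)
    have lv : ∀ k, LZ fun s => v k s := fun k => hv.comp2 (fun _ => k) (fun s => s)
    have := lv (k + 1)
    have := hs₄ (kpair i k) (kpair_lt hin hk.le) ((NV.ofStr Q).at2 k i)
    simp only [fst_kpair, snd_kpair, hn] at this
    refine this ((hQ k (hk.trans (lt_succ_self n)) i hin).trans ((hv' k hk r hkr i hi).trans ?_)) _
      (hT₃ k hk i hin)
    refine psum_congr fun s hs => ?_
    have hs' := (hs.trans_le hr1).trans (lt_succ_self n)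
    exact congrArg₂ (· * ·) (hP k hk i hin s hs').symm
      (hQ (k + 1) (add_lt_add_left hk 1) s hs').symm

/-- The determinant of every matrix exists. -/
theorem exists_isDet (N : M.Num) (B : M.Str) :
    ∃ d : M.Str, isDet' N (.ofStr B) (NV.ofStr d).int := by
  classical
  obtain ⟨D, hD⟩ := exists_ent (N + N) (N + N) fun i j =>
    if i < N then (if j < N then 0 else ent B i (j - N)) else
      if j < N then - ent B j (i - N) else 0
  obtain ⟨q, hq⟩ := exists_isPf N D
  obtain ⟨d, hd⟩ := exists_ival (if ∃ m ≤ N * N, N * N = N + (m + m + m + m) then ival q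
    else - ival q)
  refine ⟨d, D, fun i hi j hj => ?_, q, hq, fun h => hd.trans (if_pos h),
    fun h => hd.trans (if_neg h)⟩
  have hl : ∀ {i}, i < N → i < N + N := fun h => h.trans_le le_self_add
  have hg : ∀ {i}, i < N → N + i < N + N := fun h => (add_lt_add_iff_left N).2 h
  have hn : ∀ i, ¬ N + i < N := fun i => not_lt.2 le_self_add
  refine ⟨(hD i (hl hi) j (hl hj)).trans ?_, (hD i (hl hi) _ (hg hj)).trans ?_,
    (hD _ (hg hi) j (hl hj)).trans ?_, (hD _ (hg hi) _ (hg hj)).trans ?_⟩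
  · rw [if_pos hi, if_pos hj]
  · rw [if_pos hi, if_neg (hn j), add_tsub_cancel_left]; rfl
  · rw [if_neg (hn i), if_pos hj, add_tsub_cancel_left]; rfl
  · rw [if_neg (hn i), if_neg (hn j)]

end Existence

/-! ## Swapping two indices -/

section Swap
variable {M : Struct.{u}} [VModel M]

/-- The Pfaffian of a matrix in which all the vectors `S` of the algorithm are zero. -/
theorem isPf'.eval_special {n : M.Num} (hn : 0 < n) {A : M.Str} {p : IV M} {z : ZM M}
    (hS : ∀ k s, off k + s < n + n → ent A (off k + s) (k + k + 1) = 0)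
    (ha : ent A 0 1 = z) (hb : ∀ k < n, k ≠ 0 → ent A (k + k) (k + k + 1) = 1)
    (h : isPf' n (.ofStr A) p) : p.val = z := by
  obtain ⟨U, C, P, Q, T₁, T₂, T₃, hstep, hq, hp⟩ := h
  -- All entries of `C` vanish, being inner products with `S`. The last row of the Toeplitz matrix
  -- is then zero except for the final entry `a`, so the last coefficient is merely multiplied by
  -- `a`.
  have key : ∀ k r, k + 1 + r = n →
      ent Q k (r + 1) = ent A (k + k) (k + k + 1) * ent Q (k + 1) r := by
    intro k r hkr
    have hk : k < n := by
      rw [← hkr]; exact (lt_succ_self k).trans_le le_self_add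
    have hr : r < n := by
      rw [← hkr, add_comm k 1, add_assoc, add_comm 1]
      exact lt_add_one_iff.2 le_add_self
    obtain ⟨-, -, h3, h4, h5⟩ := hstep k hk r hr hkr
    have hC : ∀ j < r, ent C k j = 0 := by
      intro j hj
      refine ((h3 j hj).eval inferInstance inferInstance).trans (psum_eq_zero fun s hs => ?_)
      refine (congrArg (_ * ·) (hS k s ?_)).trans (mul_zero _)
      have : off k + (r + r) = n + n := by
        rw [← hkr, off, add_add_add_comm k k 1 1, add_add_add_comm (k + 1)]
      rw [← this]
      exact (add_lt_add_iff_left _).2 hs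
    have hr2 := lt_succ_self (r + 1)
    refine ((h5 (r + 1) hr2).eval inferInstance inferInstance).trans
      ((psum_single (lt_succ_self r) fun i hi hne => ?_).trans ?_)
    · have hi' : i < r := lt_of_le_of_ne (lt_add_one_iff.1 hi) hne
      obtain ⟨j, hj⟩ := le_iff_add.1 (add_one_le_iff.2 hi')
      have hjr : j < r := by
        rw [hj, add_comm i 1, add_assoc, add_comm 1]
        exact lt_add_one_iff.2 le_add_self
      have := (h4 (r + 1) hr2 i hi).2.2.2 j hjr (by rw [hj]; ac_rfl)
      exact (congrArg (· * _) (this.trans (hC j hjr))).trans (zero_mul _)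
    · exact congrArg (· * _) ((h4 (r + 1) hr2 r (lt_succ_self r)).2.2.1 rfl)
  obtain ⟨m, rfl⟩ := exists_pred hn.ne'
  -- The last coefficient of the trailing submatrix with `2a` rows stays 1 as long as the factors
  -- are 1. The induction stops just before step 0, whose factor `z` is supplied separately, so no
  -- product over all steps has to be formed.
  have ind := LZ.induction (f := fun a => ent Q (m + 1 - a) a) (g := fun _ => 1) (n := m)
    (by infer_instance) inferInstance (by rw [tsub_zero]; exact hq) (fun a ha ih => by
      obtain ⟨d, hd⟩ := le_iff_add.1 (add_one_le_iff.2 ha)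
      have e1 : m + 1 - (a + 1) = d + 1 := by
        rw [hd, add_assoc, add_tsub_cancel_left]
      have e2 : m + 1 - a = d + 1 + 1 := by
        rw [hd, show a + 1 + d + 1 = a + (d + 1 + 1) by ac_rfl, add_tsub_cancel_left]
      rw [e2] at ih
      have hd0 : d + 1 < m + 1 := by
        rw [hd]
        refine add_lt_add_left ?_ 1
        rw [add_comm a 1, add_assoc, add_comm 1]
        exact lt_add_one_iff.2 le_add_self
      rw [e1, key (d + 1) a (by rw [hd]; ac_rfl), ih, mul_one, hb _ hd0 (add_pos_of_nonneg_of_pos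
        zero_le zero_lt_one).ne']) m le_rfl
  have h0 := key 0 m (by rw [zero_add, add_comm])
  rw [add_tsub_cancel_left] at ind
  rw [zero_add, zero_add, ha, ind, mul_one] at h0
  exact hp.trans h0

open Classical in
/-- The entries of the block diagonal matrix `J`. -/
noncomputable def jent (i j : M.Num) : ZM M :=
  if i = j + 1 ∧ IsEven j then -1 else if j = i + 1 ∧ IsEven i then 1 else 0

instance LZ.jent_comp {t s : M.Num → M.Num} [LF t] [LF s] : LZ fun c => jent (t c) (s c) := by
  unfold jent; infer_instance

theorem ne_add_one_of_lt {i j : M.Num} (h : i < j) : ¬ i = j + 1 := fun h' =>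
  absurd (lt_succ_self j) (h' ▸ h.asymm)

theorem jent_eq (k : M.Num) : jent (k + k) (k + k + 1) = 1 := by
  rw [jent, if_neg fun h => ne_add_one_of_lt (lt_succ_self _) h.1,
    if_pos ⟨rfl, isEven_add_self k⟩]

theorem jent_one_zero : jent (1 : M.Num) 0 = -1 := by
  rw [jent, if_pos ⟨(zero_add 1).symm, 0, le_rfl, (add_zero 0).symm⟩]

theorem lt_off (k s : M.Num) : k + k + 1 < off k + s := by
  rw [off, ← add_assoc]
  exact (lt_succ_self _).trans_le le_self_add

theorem jent_off (k s : M.Num) : jent (off k + s) (k + k + 1) = 0 := by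
  rw [jent, if_neg fun h => not_isEven k h.2, if_neg fun h => ne_add_one_of_lt (lt_off k s) h.1]

theorem jent_off_zero (s : M.Num) : jent (off 0 + s) 0 = 0 := by
  have h : (0 : M.Num) + 1 < off 0 + s := by simpa using lt_off 0 s
  rw [jent, if_neg fun h' => h.ne' h'.1,
    if_neg fun h' => ne_add_one_of_lt ((lt_succ_self 0).trans h) h'.1]

theorem jent_skew (i j : M.Num) : jent i j = - jent j i := by
  unfold jent
  by_cases h : i = j + 1 ∧ IsEven j
  · have h1 : j < i := by rw [h.1]; exact lt_succ_self j
    rw [if_pos h, if_neg fun h' => ne_add_one_of_lt h1 h'.1, if_pos h]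
  · by_cases h2 : j = i + 1 ∧ IsEven i
    · rw [if_neg h, if_pos h2, if_pos h2, neg_neg]
    · rw [if_neg h, if_neg h2, if_neg h2, if_neg h, neg_zero]

/-- Applying `σ` to the indices of a skew symmetric matrix multiplies the Pfaffian by `f`. -/
def IsSgn (n : M.Num) (σ : M.Num → M.Num) (f : ZM M) : Prop :=
  ∀ A C p q : M.Str, isSkew' (n + n) (.ofStr A) →
    (∀ i < n + n, ∀ j < n + n, ent C i j = ent A (σ i) (σ j)) →
    isPf' n (.ofStr A) (NV.ofStr p).int → isPf' n (.ofStr C) (NV.ofStr q).int →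
    ival q = ival p * f

/-- (MP) asks for the product as a formula, with a witness of the computation. Correct entries
suffice, because the computations of all the inner products exist. -/
theorem isMatMul'_of_entries {N B : M.Num} {a b c : M.Num → M.Num → IV M}
    (ha : LZ fun d => (a (snd d) (fst d)).val) (hp : LS fun d => (b (snd d) (fst d)).pos.s)
    (hq : LS fun d => (b (snd d) (fst d)).neg.s) (hB : ∀ i j, (b i j).bd ≤ B)
    (h : ∀ i < N, ∀ j < N, (c i j).val = psum (fun k => (a i k).val * (b k j).val) N) :
    isMatMul' N a b c := by
  obtain ⟨s, hs, h'⟩ := exists_isDot (kpair N N) (fun _ => N) (fun c k => a (snd c) k)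
    (fun c k => b k (fst c)) (N + B) (fun _ _ => le_self_add)
    (LZ.comp2 (f := fun i j => (a i j).val) ha _ _)
    (LS.comp2 (f := fun i j => (b i j).pos.s) hp _ _)
    (LS.comp2 (f := fun i j => (b i j).neg.s) hq _ _) fun _ _ => (hB _ _).trans le_add_self
  obtain ⟨T, hT⟩ := exists_rows2 hs N N
  refine ⟨T, fun i hi j hj => ?_⟩
  have := h' (kpair j i) (kpair_lt hj hi.le) (c i j)
  simp only [fst_kpair, snd_kpair] at this
  exact this (h i hi j hj) _ (hT i hi j hj)

/-- (MP) for the matrix of a map on the indices. -/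
theorem MP'.exists_isSgn (hMP : MP' M) {n : M.Num} {σ : M.Num → M.Num} [hσ : LF σ]
    (h1 : ∀ i < n + n, σ i < n + n) : ∃ f, IsSgn n σ f := by
  classical
  have := hσ.comp LF.fst_self
  -- Column `j` is the unit vector at `σ j`, so multiplication by `F` on the right selects columns,
  -- and by its transpose on the left selects rows. The scalar is the value of some computation of
  -- the determinant of `F`, whatever it is.
  obtain ⟨F, hF⟩ := exists_ent (n + n) (n + n) fun k j => if k = σ j then 1 else 0
  obtain ⟨d, hd⟩ := exists_isDet (n + n) F
  refine ⟨ival d, fun A C p q hA hC hp hq => ?_⟩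
  obtain ⟨D, hD⟩ := exists_ent (n + n) (n + n) fun i j => ent A i (σ j)
  refine (hMP n A F D C hA ?_ ?_ p q d hp hq hd).eval
  · refine isMatMul'_of_entries (B := M.len F + M.len F) inferInstance inferInstance inferInstance
      (fun _ _ => le_rfl) fun i hi j hj => ?_
    refine (hD i hi j hj).trans (((psum_single (f := fun k => ent A i k * ent F k j) (h1 j hj)
      fun k hk hne => ?_).trans ?_).symm)
    · rw [hF k hk j hj, if_neg hne, mul_zero]
    · rw [hF _ (h1 j hj) j hj, if_pos rfl, mul_one]
  · refine isMatMul'_of_entries (B := M.len D + M.len D) inferInstance inferInstance inferInstance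
      (fun _ _ => le_rfl) fun i hi j hj => ?_
    refine (hC i hi j hj).trans (((psum_single (f := fun k => ent F k i * ent D k j) (h1 i hi)
      fun k hk hne => ?_).trans ?_).symm)
    · rw [hF k hk i hi, if_neg hne, zero_mul]
    · rw [hF _ (h1 i hi) i hi, if_pos rfl, one_mul, hD _ (h1 i hi) j hj]

section
variable {n : M.Num} {σ τ : M.Num → M.Num} {f g : ZM M}

/-- The matrix `J`, with a map applied to its indices. -/
theorem exists_jent (n : M.Num) (σ : M.Num → M.Num) [hσ : LF σ] :
    ∃ C : M.Str, isSkew' (n + n) (.ofStr C) ∧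
      ∀ i < n + n, ∀ j < n + n, ent C i j = jent (σ i) (σ j) := by
  have := hσ.comp LF.fst_self
  have := hσ.comp LF.snd_self
  obtain ⟨C, hC⟩ := exists_ent (n + n) (n + n) fun i j => jent (σ i) (σ j)
  refine ⟨C, fun i hi j hj => ?_, hC⟩
  exact (hC i hi j hj).trans ((jent_skew _ _).trans (congrArg (- ·) (hC j hj i hi).symm))

theorem lt_add_self (hn : 0 < n) : 1 < n + n := by
  have := add_self_add_one_lt hn
  rwa [zero_add, zero_add] at this

/-- Below the diagonal blocks `J` vanishes, so every `S` is zero, and every factor `a` equals 1. -/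
theorem pf_jent (hn : 0 < n) {C p : M.Str}
    (hC : ∀ i < n + n, ∀ j < n + n, ent C i j = jent i j)
    (hp : isPf' n (.ofStr C) (NV.ofStr p).int) : ival p = 1 := by
  have h1 := lt_add_self hn
  refine hp.eval_special hn (fun k s h => ?_) ?_ fun k hk _ => ?_
  · rw [hC _ h _ ((lt_off k s).trans h), jent_off]
  · have := jent_eq (0 : M.Num)
    rw [zero_add, zero_add] at this
    rw [hC _ (zero_lt_one.trans h1) _ h1, this]
  · rw [hC _ (add_self_lt hk) _ (add_self_add_one_lt hk), jent_eq]

/-- Tested on `J`, whose Pfaffian 1 makes the scalar visible. This is how `f² = 1` is obtained for a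
transposition without knowing `f`. -/
theorem IsSgn.eq_one (hn : 0 < n) (h : IsSgn n (fun i => i) f) : f = 1 := by
  obtain ⟨C, h1, h2⟩ := exists_jent n fun i : M.Num => i
  obtain ⟨p, hp⟩ := exists_isPf n C
  have := h C C p p h1 (fun _ _ _ _ => rfl) hp hp
  rwa [pf_jent hn h2 hp, one_mul, eq_comm] at this

/-- The two maps are applied one after the other; the matrix in between is skew symmetric and has a
Pfaffian by `exists_isPf`. -/
theorem IsSgn.comp (hf : IsSgn n σ f) (hg : IsSgn n τ g) [hσ : LF σ]
    (h1 : ∀ i < n + n, σ i < n + n) (h2 : ∀ i < n + n, τ i < n + n) :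
    IsSgn n (fun i => σ (τ i)) (f * g) := by
  intro A C p q hA hC hp hq
  have := hσ.comp LF.fst_self
  have := hσ.comp LF.snd_self
  obtain ⟨D, hD⟩ := exists_ent (n + n) (n + n) fun i j => ent A (σ i) (σ j)
  obtain ⟨r, hr⟩ := exists_isPf n D
  have e1 := hf A D p r hA hD hp hr
  have e2 := hg D C r q (fun i hi j hj => (hD i hi j hj).trans
    ((hA _ (h1 i hi) _ (h1 j hj)).trans (congrArg (- ·) (hD j hj i hi).symm)))
    (fun i hi j hj => by rw [hC i hi j hj, hD _ (h2 i hi) _ (h2 j hj)]) hr hq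
  rw [e2, e1, mul_assoc]

open Classical in
instance LF.swap (i j : M.Num) : LF (Equiv.swap i j : M.Num → M.Num) := by
  simp only [show (Equiv.swap i j : M.Num → M.Num) = fun c => if c = i then j else
    if c = j then i else c from funext fun c => Equiv.swap_apply_def i j c]
  infer_instance

theorem swap_lt {i j : M.Num} [DecidableEq M.Num] (hi : i < n) (hj : j < n) :
    ∀ s < n, Equiv.swap i j s < n := fun s hs => by
  rw [Equiv.swap_apply_def]
  split_ifs <;> assumption

open Classical in
-- (MP) provides some scalar, and `J` identifies it. After the swap the column used in step 0 is the
-- former column 0, which also vanishes from row 2 on, so the algorithm still collapses; only the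
-- first factor changes, from 1 to -1.
theorem MP'.isSgn_swap_zero_one (hMP : MP' M) (hn : 0 < n) :
    IsSgn n (Equiv.swap 0 1) (-1 : ZM M) := by
  have l1 := lt_add_self hn
  have l0 := zero_lt_one.trans l1
  obtain ⟨f, hf⟩ := hMP.exists_isSgn (σ := Equiv.swap 0 1) (swap_lt l0 l1)
  obtain ⟨A, hA, hA'⟩ := exists_jent n fun i : M.Num => i
  obtain ⟨C, -, hC⟩ := exists_jent n (Equiv.swap 0 1 : M.Num → M.Num)
  obtain ⟨p, hp⟩ := exists_isPf n A
  obtain ⟨q, hq⟩ := exists_isPf n C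
  have e := hf A C p q hA (fun i hi j hj => by
    rw [hC i hi j hj, hA' _ (swap_lt l0 l1 i hi) _ (swap_lt l0 l1 j hj)]) hp hq
  have hs : ∀ i : M.Num, 1 < i → Equiv.swap 0 1 i = i := fun i hi =>
    Equiv.swap_apply_of_ne_of_ne (zero_lt_one.trans hi).ne' hi.ne'
  have hk1 : ∀ k : M.Num, k ≠ 0 → 1 < k + k := fun k hk => lt_add_self (pos_of_ne_zero hk)
  have hq' : (NV.ofStr q).int.val = -1 := by
    refine hq.eval_special hn (fun k s h => ?_) ?_ fun k hk hk0 => ?_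
    · rw [hC _ h _ ((lt_off k s).trans h), hs (off k + s) (lt_of_le_of_lt le_add_self (lt_off k s))]
      by_cases hk : k = 0
      · rw [hk, add_zero, zero_add, Equiv.swap_apply_right, jent_off_zero]
      · rw [hs _ ((hk1 k hk).trans (lt_succ_self _)), jent_off]
    · rw [hC _ l0 _ l1, Equiv.swap_apply_left, Equiv.swap_apply_right, jent_one_zero]
    · rw [hC _ (add_self_lt hk) _ (add_self_add_one_lt hk), hs _ (hk1 k hk0),
        hs _ ((hk1 k hk0).trans (lt_succ_self _)), jent_eq]
  rw [pf_jent hn hA' hp, one_mul] at e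
  rwa [← e, show ival q = -1 from hq'] at hf

open Classical in
-- Conjugation by (c d) costs its scalar `f` twice. The scalar `f` need not be known, since `f * f`
-- belongs to the identity.
theorem MP'.isSgn_conj (hMP : MP' M) (hn : 0 < n) {a b c d : M.Num}
    (ha : a < n + n) (hb : b < n + n) (hc : c < n + n) (hd : d < n + n)
    (h : IsSgn n (Equiv.swap a b) (-1 : ZM M)) :
    IsSgn n (Equiv.swap (Equiv.swap c d a) (Equiv.swap c d b)) (-1 : ZM M) := by
  obtain ⟨f, hf⟩ := hMP.exists_isSgn (σ := Equiv.swap c d) (swap_lt hc hd)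
  have h1 := hf.comp hf (swap_lt hc hd) (swap_lt hc hd)
  simp only [Equiv.swap_apply_self] at h1
  have h2 := hf.comp (h.comp hf (swap_lt ha hb) (swap_lt hc hd)) (swap_lt hc hd)
    fun i hi => swap_lt ha hb _ (swap_lt hc hd i hi)
  rw [mul_left_comm, h1.eq_one hn, mul_one] at h2
  rwa [Equiv.swap_apply_apply, Equiv.swap_inv]

open Classical in
theorem MP'.isSgn_swap (hMP : MP' M) {i j : M.Num} (hi : i < n + n) (hj : j < n + n)
    (hij : i ≠ j) : IsSgn n (Equiv.swap i j) (-1 : ZM M) := by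
  have hn : 0 < n := pos_of_ne_zero fun h => by
    rw [h, add_zero] at hi
    exact absurd hi (not_lt.2 zero_le)
  have l1 := lt_add_self hn
  have l0 := zero_lt_one.trans l1
  -- Conjugating (0 1) by (1 j) gives (0 j); for `j = 1` the conjugating swap is the identity.
  have h0 : ∀ j < n + n, j ≠ 0 → IsSgn n (Equiv.swap 0 j) (-1 : ZM M) := fun j hj hj0 => by
    have := hMP.isSgn_conj hn l0 l1 l1 hj (hMP.isSgn_swap_zero_one hn)
    rwa [Equiv.swap_apply_left, Equiv.swap_apply_of_ne_of_ne zero_ne_one hj0.symm] at this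
  by_cases hj0 : j = 0
  · subst hj0
    rw [Equiv.swap_comm]
    exact h0 i hi hij
  -- Conjugating (0 j) by (0 i) gives (i j), as `j` is fixed by (0 i).
  · have := hMP.isSgn_conj hn l0 hj l0 hi (h0 j hj hj0)
    rwa [Equiv.swap_apply_left, Equiv.swap_apply_of_ne_of_ne hj0 hij.symm] at this

end

theorem MP'.palt (hMP : MP' M) : PALT' M := by
  classical
  intro n A i hi j hj A' hA hij hswap
  refine ⟨exists_isPf n A, exists_isPf n A', fun p q hp hq => ?_⟩
  have hs : ∀ s, isSwapped' i j (Equiv.swap i j s) s := fun s => by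
    unfold isSwapped'
    rw [Equiv.swap_apply_def]
    split_ifs with h h'
    · exact Or.inr (Or.inl ⟨rfl, h⟩)
    · exact Or.inl ⟨rfl, h'⟩
    · exact Or.inr (Or.inr ⟨h, h', rfl⟩)
  -- A transposition is its own inverse, so the entry of `A'` at `(s, t)` is the entry of `A` at the
  -- swapped indices.
  have h := hMP.isSgn_swap hi hj hij A A' p q hA (fun s hs' t ht' =>
    hswap _ (swap_lt hi hj s hs') _ (swap_lt hi hj t ht') s hs' t ht' ⟨hs s, hs t⟩) hp hq
  rw [mul_neg_one] at h
  exact h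

end Swap

end BoundedArith

/-- `V#L ⊢ (MP) → (PALT)` -/
theorem mainTheorem4 :
    BoundedArith.Proves.{u} BoundedArith.VSharpL
      (BoundedArith.Formula.imp BoundedArith.MP BoundedArith.PALT) := by
  intro M hM ρ σ hMP
  have : BoundedArith.VModel M := ⟨hM⟩
  exact (BoundedArith.sat_PALT M ρ σ).2 ((BoundedArith.sat_MP M ρ σ).1 hMP).palt
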